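/- **System.** There are $N=N_H+N_L\ge 1$ users ($N_H$ of type $H$, $N_L$ of type $L$) and a finite set of miners $m=1,\dots,M$ with mining powers $\alpha_m>0$, $\sum_m\alpha_m=1$. Parameters: on-chain utilities $R_H\ge R_L$, impatience coefficient $\gamma>0$, block rate $\mu>0$, storage cost per byte $C_s\ge 0$ of every miner, and i.i.d. positive transaction sizes with finite mean $\bar s$. User $n$ has utility $R_n\in\{R_H,R_L\}$ according to his type. **Mechanism (Stage I).** The designer chooses fees per byte $\overline\rho>\underline\rho\ge 0$ and waiting tax rates $P=(P_{HH},P_{HL},P_{LH},P_{LL})\in\mathbb R^4$; $p_{nl}$ denotes the entry of $P$ given by the types of user $n$ (payer) and user $l$ (receiver). **Users (Stage II).** User $n$ chooses rates $\lambda_{n1},\lambda_{n2}\ge 0$ with $\lambda_{n1}+\lambda_{n2}\le\mu/N$, and generates transactions with fee per byte $\overline\rho$ and $\underline\rho$ by independent Poisson processes of these rates. A transaction of size $s$ and fee per byte $\rho$ that is eventually included in the blockchain, after a waiting time $w$, gives user $n$ the surplus $R_n-s\rho-\gamma w-\sum_{l\ne n}p_{nl}$, and gives every other user $l$ the tax $p_{nl}$;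 one that is never included has $w=\infty$ and gives user $n$ the surplus $-\gamma w$. The payoff $u_n\in[-\infty,\infty)$ of user $n$ is the limit, as $t\to\infty$, of $1/t$ times the expected sum of the surpluses from his transactions generated in $[0,t]$ and of the taxes he receives for the transactions that other users generate in $[0,t]$. **Miners (Stage III).** Blocks are found according to an independent Poisson process of rate $\mu$, each by miner $m$ with probability $\alpha_m$ independently. The transaction pool is empty at time $0$. In each round, every miner selects either no transaction or the transaction of highest fee per byte in the pool (the earliest generated one among equals); when a block is found, the selection of its finder is included and leaves the pool. If miner $j$ selects $X_j$ (a set of at most one transaction), the payoff of miner $m$ in the round is $\alpha_m\sum_{X_m}s\rho-\sum_j\alpha_j\sum_{X_j}sC_s$; his payoff $v_m$ is the limit as $t\to\infty$ of $1/t$ times the expected sum of his payoffs over the rounds that end in $[0,t]$. The miners play a Nash equilibrium in every round, in which an indifferent miner selects the transaction. **Equilibrium and welfare.** Given the mechanism and the equilibrium behaviour of the miners, the users play a symmetric Nash equilibrium $\lambda$ (users of the same type use the same rates) that is Pareto-dominant: no user has a greater payoff at any other symmetric Nash equilibrium. The social welfare is $\sum_n u_n+\sum_m v_m$. The *sufficient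 fee condition* is $$\rho_n^{\mathrm{avg}}=\frac{\lambda_{n1}\overline\rho+\lambda_{n2}\underline\rho}{\lambda_{n1}+\lambda_{n2}}\ \ge\ MC_s\qquad\text{for every user } n \text{ with }\lambda_{n1}+\lambda_{n2}>0 .$$ **Proposition 2.** When the miners play their equilibrium, the limits defining all $u_n$ and $v_m$ exist, for every mechanism and all feasible rates. The maximum of the social welfare over all mechanisms that satisfy the sufficient fee condition at the induced equilibrium (the welfare achieved by the optimal FWT mechanism) exists and equals the maximum of the social welfare over all mechanisms without that condition (the unconstrained social optimum), which also exists; the common value is a real number. -/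

import Mathlib

open Filter Topology MeasureTheory ProbabilityTheory

noncomputable section

namespace FWT

/-- The users: `NH` high-utility users (`Sum.inl`) and `NL` low-utility users (`Sum.inr`). -/
abbrev User (NH NL : ℕ) : Type := Fin NH ⊕ Fin NL

/-- The miners. -/
abbrev Miner (M : ℕ) : Type := Fin M

/-- The two fee-per-byte choices: `true` is the high choice, `false` is the low choice. -/
abbrev FeeClass : Type := Bool

/-- Parameters of the blockchain system. -/
structure Blockchain (NH NL M : ℕ) where
  /-- on-chain utility of a type-`H` user from one transaction -/
  RH : ℝ
  /-- on-chain utility of a type-`L` user from one transaction -/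
  RL : ℝ
  RL_le_RH : RL ≤ RH
  /-- impatience coefficient of the users -/
  γ : ℝ
  γ_pos : 0 < γ
  /-- average block generation rate -/
  μ : ℝ
  μ_pos : 0 < μ
  /-- storage cost per byte of each miner -/
  Cs : ℝ
  Cs_nonneg : 0 ≤ Cs
  /-- normalized mining powers -/
  α : Miner M → ℝ
  α_pos : ∀ m, 0 < α m
  α_sum : ∑ m, α m = 1
  /-- distribution of the size of a transaction; sizes are positive and have a finite mean -/
  sizeLaw : Measure ℝ
  sizeLaw_prob : IsProbabilityMeasure sizeLaw
  sizeLaw_pos : ∀ᵐ s ∂sizeLaw, 0 < s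
  sizeLaw_integrable : Integrable (fun s : ℝ => s) sizeLaw

/-- A mechanism of the protocol designer: the two fee-per-byte choices and the waiting tax rates
(the first letter of a tax rate is the type of the payer, the second that of the receiver).
Waiting taxes may be negative. -/
structure Mechanism where
  ρhigh : ℝ
  ρlow : ℝ
  PHH : ℝ
  PHL : ℝ
  PLH : ℝ
  PLL : ℝ

/-- The fee-per-byte of a fee class. -/
def Mechanism.fee (D : Mechanism) : FeeClass → ℝ
  | true => D.ρhigh
  | false => D.ρlow

/-- The constraint on the fee-per-byte choices. -/
def Mechanism.Feasible (D : Mechanism) : Prop := D.ρlow < D.ρhigh ∧ 0 ≤ D.ρlow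

/-- The waiting tax that user `n` pays to user `l` for each of his included transactions. -/
def Mechanism.tax {NH NL : ℕ} (D : Mechanism) : User NH NL → User NH NL → ℝ
  | .inl _, .inl _ => D.PHH
  | .inl _, .inr _ => D.PHL
  | .inr _, .inl _ => D.PLH
  | .inr _, .inr _ => D.PLL

/-- A transaction in the transaction pool. Its identifier is its rank in the order of events. -/
structure Tx where
  id : ℕ
  size : ℝ
  fee : ℝ

/-- A transaction pool, listed in the order of generation times. -/
abbrev Pool : Type := List Tx

/-- The highest-fee-per-byte transaction of a pool, the earliest generated one among equals
(`List.argmax` returns the first maximizer of the list); `none` for the empty pool. -/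
def Pool.head (Q : Pool) : Option Tx := List.argmax Tx.fee Q

/-! ### Stage III: transaction selection of the miners -/

/-- What a miner may select from the pool: no transaction, or the highest-fee-per-byte one. -/
def selections (Q : Pool) : Set (Option Tx) := {X | X = none ∨ X = Q.head}

/-- Strategies of all miners: the selection of each miner as a function of the pool. -/
abbrev MinerStrategy (M : ℕ) : Type := Miner M → Pool → Option Tx

/-- Transaction fee of a selection. -/
def selFee (X : Option Tx) : ℝ := X.elim 0 (fun q => q.size * q.fee)

/-- Size of a selection. -/
def selSize (X : Option Tx) : ℝ := X.elim 0 Tx.size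

variable {NH NL M : ℕ}

/-- Payoff of miner `m` in one round, given the selections of all miners: he obtains the fee of
his selection with probability `α m`, and he stores whatever the finder of the block selected. -/
def roundPayoff (B : Blockchain NH NL M) (m : Miner M) (X : Miner M → Option Tx) : ℝ :=
  B.α m * selFee (X m) - ∑ j, B.α j * (selSize (X j) * B.Cs)

/-- The selections `X` form a Nash equilibrium of the round with pool `Q`. -/
def IsRoundNash (B : Blockchain NH NL M) (Q : Pool) (X : Miner M → Option Tx) : Prop :=
  (∀ m, X m ∈ selections Q) ∧
  ∀ m, ∀ Y ∈ selections Q, roundPayoff B m (Function.update X m Y) ≤ roundPayoff B m X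

/-- The equilibrium of the miners in Stage III: a Nash equilibrium in every round, whatever the
pool, at which a miner who is indifferent between selecting the highest-fee-per-byte transaction
and selecting nothing selects the transaction. -/
def IsMinerEquilibrium (B : Blockchain NH NL M) (σ : MinerStrategy M) : Prop :=
  ∀ Q : Pool, (∀ q ∈ Q, 0 < q.size) →
    IsRoundNash B Q (fun m => σ m Q) ∧
    ∀ m, roundPayoff B m (Function.update (fun j => σ j Q) m none) =
        roundPayoff B m (Function.update (fun j => σ j Q) m Q.head) → σ m Q = Q.head

/-! ### The stochastic process of transaction generation and mining -/

/-- Transaction generation rates: `x n c` is the rate of user `n` at the fee class `c`. -/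
abbrev Profile (NH NL : ℕ) : Type := User NH NL → FeeClass → ℝ

/-- The kinds of events: a user generates a transaction of some fee class, or a miner finds a
block. -/
abbrev Mark (NH NL M : ℕ) : Type := (User NH NL × FeeClass) ⊕ Miner M

/-- Rate of each kind of events: `x n c` for the generation of transactions, and `μ * α m` for
blocks found by miner `m` (blocks are found at rate `μ`, by miner `m` with probability `α m`). -/
def rate (B : Blockchain NH NL M) (x : Profile NH NL) : Mark NH NL M → ℝ
  | .inl (n, c) => x n c
  | .inr m => B.μ * B.α m

/-- Rate of all events together. -/
def totalRate (B : Blockchain NH NL M) (x : Profile NH NL) : ℝ := ∑ a, rate B x a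

/-- Law of the kind of an event: each kind has a probability proportional to its rate. -/
def markLaw (B : Blockchain NH NL M) (x : Profile NH NL) : Measure (Mark NH NL M) :=
  ∑ a, ENNReal.ofReal (rate B x a / totalRate B x) • Measure.dirac a

/-- A sample of the whole process: for each event, the time elapsed since the preceding event, the
size of the transaction (used if the event is the generation of a transaction), and its kind. -/
abbrev Sample (NH NL M : ℕ) : Type := ℕ → ℝ × ℝ × Mark NH NL M

/-- Law of the process. The generation times of the transactions of all users at all fee classes
and the block times of all miners are independent Poisson processes with the rates `rate B x`,
realized as one Poisson process of rate `totalRate B x` with independent marks of law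
`markLaw B x`. Sizes are independent and identically distributed, independent of all the rest. -/
def law (B : Blockchain NH NL M) (x : Profile NH NL) : Measure (Sample NH NL M) :=
  Measure.infinitePi fun _ : ℕ =>
    (expMeasure (totalRate B x)).prod (B.sizeLaw.prod (markLaw B x))

/-- Size attached to event `j`. -/
def size (ω : Sample NH NL M) (j : ℕ) : ℝ := (ω j).2.1

/-- Kind of event `j`. -/
def mark (ω : Sample NH NL M) (j : ℕ) : Mark NH NL M := (ω j).2.2

/-- Time of event `j`. -/
def time (ω : Sample NH NL M) (j : ℕ) : ℝ := ∑ i ∈ Finset.range (j + 1), (ω i).1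

/-- The transaction pool just before event `j`. It is empty at time zero; a generated transaction
enters it, and the transaction that the finder of a block has selected leaves it. -/
def pool (D : Mechanism) (σ : MinerStrategy M) (ω : Sample NH NL M) : ℕ → Pool
  | 0 => []
  | j + 1 =>
    match mark ω j with
    | .inl (_, c) => pool D σ ω j ++ [⟨j, size ω j, D.fee c⟩]
    | .inr m =>
      match σ m (pool D σ ω j) with
      | none => pool D σ ω j
      | some q => (pool D σ ω j).filter (fun r => r.id ≠ q.id)

/-- Event `k` is a block that includes the transaction generated at event `j`. -/
def IncludedAt (D : Mechanism) (σ : MinerStrategy M) (ω : Sample NH NL M) (j k : ℕ) : Prop :=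
  ∃ m q, mark ω k = .inr m ∧ σ m (pool D σ ω k) = some q ∧ q.id = j

/-- The transaction generated at event `j` is included in some block. -/
def Included (D : Mechanism) (σ : MinerStrategy M) (ω : Sample NH NL M) (j : ℕ) : Prop :=
  ∃ k, IncludedAt D σ ω j k

/-- Waiting time of the transaction generated at event `j`: the time from its generation to the
end of the round in which it is included, and `⊤` if it is never included. -/
def waiting (D : Mechanism) (σ : MinerStrategy M) (ω : Sample NH NL M) (j : ℕ) : ENNReal :=
  ⨅ (k : ℕ) (_ : IncludedAt D σ ω j k), ENNReal.ofReal (time ω k - time ω j)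

/-! ### Payoffs -/

/-- On-chain utility of a user from one transaction. -/
def utility (B : Blockchain NH NL M) : User NH NL → ℝ
  | .inl _ => B.RH
  | .inr _ => B.RL

/-- Contribution of event `j` to the monetary payoff of user `n`, without waiting costs, provided
the event is the generation of a transaction that is included in the blockchain: if `n` generates
it, his on-chain utility minus the fee and the waiting taxes that he pays to all other users; if
another user generates it, the waiting tax that this user pays to `n`. -/
def transfer (B : Blockchain NH NL M) (D : Mechanism) (n : User NH NL) (s : ℝ) :
    Mark NH NL M → ℝ
  | .inl (l, c) =>
    if l = n then
      utility B n - s * D.fee c - ∑ i ∈ Finset.univ.erase n, D.tax n i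
    else D.tax l n
  | .inr _ => 0

open Classical in
/-- Monetary payoff of user `n` from the transactions generated in `[0, t]`. -/
def money (B : Blockchain NH NL M) (D : Mechanism) (σ : MinerStrategy M) (n : User NH NL)
    (t : ℝ) (ω : Sample NH NL M) : ℝ :=
  ∑' j, if time ω j ≤ t ∧ Included D σ ω j then transfer B D n (size ω j) (mark ω j) else 0

open Classical in
/-- Total waiting time of the transactions that user `n` generates in `[0, t]`. -/
def totalWaiting (D : Mechanism) (σ : MinerStrategy M) (n : User NH NL)
    (t : ℝ) (ω : Sample NH NL M) : ENNReal :=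
  ∑' j, if time ω j ≤ t ∧ ∃ c, mark ω j = .inl (n, c) then waiting D σ ω j else 0

/-- Expected payoff of user `n` per unit of time in `[0, t]`. -/
def userAverage (B : Blockchain NH NL M) (D : Mechanism) (σ : MinerStrategy M)
    (x : Profile NH NL) (n : User NH NL) (t : ℝ) : EReal :=
  (((∫ ω, money B D σ n t ω ∂law B x) / t : ℝ) : EReal) -
    ((ENNReal.ofReal (B.γ / t) * ∫⁻ ω, totalWaiting D σ n t ω ∂law B x : ENNReal) : EReal)

/-- Time-average payoff of user `n`. -/
def userPayoff (B : Blockchain NH NL M) (D : Mechanism) (σ : MinerStrategy M)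
    (x : Profile NH NL) (n : User NH NL) : EReal :=
  limUnder atTop (userAverage B D σ x n)

open Classical in
/-- Expected payoff of miner `m` per unit of time in `[0, t]`, from all rounds that end there. -/
def minerAverage (B : Blockchain NH NL M) (D : Mechanism) (σ : MinerStrategy M)
    (x : Profile NH NL) (m : Miner M) (t : ℝ) : ℝ :=
  (∫ ω, ∑' k, (if time ω k ≤ t ∧ ∃ i, mark ω k = .inr i then
    roundPayoff B m (fun i => σ i (pool D σ ω k)) else 0) ∂law B x) / t

/-- Time-average payoff of miner `m`. -/
def minerPayoff (B : Blockchain NH NL M) (D : Mechanism) (σ : MinerStrategy M)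
    (x : Profile NH NL) (m : Miner M) : ℝ :=
  limUnder atTop (minerAverage B D σ x m)

/-- Social welfare: the sum of the time-average payoffs of all users and all miners. -/
def socialWelfare (B : Blockchain NH NL M) (D : Mechanism) (σ : MinerStrategy M)
    (x : Profile NH NL) : EReal :=
  ∑ n, userPayoff B D σ x n + ∑ m, (minerPayoff B D σ x m : EReal)

/-! ### Stage II: transaction generation of the users -/

/-- Strategy space of a single user. -/
def userStrategies (B : Blockchain NH NL M) : Set (FeeClass → ℝ) :=
  {y | y true + y false ≤ B.μ / ((NH : ℝ) + (NL : ℝ)) ∧ ∀ c, 0 ≤ y c}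

/-- Users of the same type use the same strategy. -/
def IsSymmetric (x : Profile NH NL) : Prop :=
  (∀ i j : Fin NH, x (.inl i) = x (.inl j)) ∧ (∀ i j : Fin NL, x (.inr i) = x (.inr j))

/-- Symmetric Nash equilibrium of the transaction generation game. -/
def IsSNE (B : Blockchain NH NL M) (D : Mechanism) (σ : MinerStrategy M)
    (x : Profile NH NL) : Prop :=
  (∀ n, x n ∈ userStrategies B) ∧ IsSymmetric x ∧
  ∀ n, ∀ y ∈ userStrategies B,
    userPayoff B D σ (Function.update x n y) n ≤ userPayoff B D σ x n

/-- Pareto-dominant symmetric Nash equilibrium: no user has a greater payoff at any other one. -/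
def IsParetoDominantSNE (B : Blockchain NH NL M) (D : Mechanism) (σ : MinerStrategy M)
    (x : Profile NH NL) : Prop :=
  IsSNE B D σ x ∧ ∀ x', IsSNE B D σ x' → ∀ n, userPayoff B D σ x' n ≤ userPayoff B D σ x n

/-! ### Stage I: the two problems of the protocol designer -/

/-- Sufficient fee condition: the average fee-per-byte of each user who generates transactions
covers the storage costs per byte of all miners. -/
def SufficientFee (B : Blockchain NH NL M) (D : Mechanism) (x : Profile NH NL) : Prop :=
  ∀ n, 0 < x n true + x n false →
    (M : ℝ) * B.Cs ≤ (x n true * D.ρhigh + x n false * D.ρlow) / (x n true + x n false)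

/-- A mechanism together with a subgame equilibrium that it induces. -/
def IsOutcome (B : Blockchain NH NL M) (D : Mechanism) (σ : MinerStrategy M)
    (x : Profile NH NL) : Prop :=
  D.Feasible ∧ IsMinerEquilibrium B σ ∧ IsParetoDominantSNE B D σ x

/-- Values of social welfare attainable without the sufficient fee condition. -/
def unconstrainedWelfare (B : Blockchain NH NL M) : Set EReal :=
  {w | ∃ D σ x, IsOutcome B D σ x ∧ w = socialWelfare B D σ x}

/-- Values of social welfare attainable by mechanisms that meet the sufficient fee condition. -/
def constrainedWelfare (B : Blockchain NH NL M) : Set EReal :=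
  {w | ∃ D σ x, IsOutcome B D σ x ∧ SufficientFee B D x ∧ w = socialWelfare B D σ x}

end FWT

end

/-!
The event process is a marked Poisson process, so gaps, sizes and kinds of events are independent.
In every round the miners face a problem that depends on the head of the pool only, and in
equilibrium all of them select it exactly if its fee per byte covers the storage cost per byte of a
single miner (`select_eq`). The inclusion of transactions then depends on the kinds of events alone,
and the pool becomes a priority queue with two classes (`classPool`).

For an includable class `c`, the number of pooled transactions of class at least `c` is a lazy
random walk on the natural numbers, reflected at `0`. The position in the queue of a transaction is
such a walk, absorbed at `0`. For arrival probability `p` and block probability `q`, monotone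
iterates of the transition operator give the limit `p / (q - p)` of the mean queue length, which is
infinite for `p = q`, and the expected absorption time from `h` is `h / (q - p)`. The waiting time
of a transaction is the sum of the gaps that follow it until its position is `0`
(`waiting_eq_tsum`). Since the expected number of events up to time `t` is `t` times the total rate
(`tsum_arrivalProb`), this yields the long-run payoffs of users (`tendsto_userAverage`) and miners
(`tendsto_minerAverage`). The payoff of a user is his gains less the waiting costs of an `M/M/1`
queue with two priority classes, and it is `⊥` if he generates transactions of a class that the
miners refuse or whose queue is saturated.

Fees and taxes cancel in the sum of all payoffs, and so does the order of service: the social welfare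
is `⊥` or the function `welfare` of the total rates of the users (`socialWelfare_of_isStable`). It
attains its maximum over symmetric rates at some rates `r` (`exists_max_welfare`), so its value there
bounds the social welfare of every outcome.

To reach this value, let the low fee be exactly `M * Cs`, let the high fee exceed what any
transaction is worth, and choose the taxes so that the net value of a transaction of each user equals
his marginal waiting cost at `r`. Then nobody uses the high fee, the payoffs are concave in the own
rate, and `r` is an equilibrium; it is the only symmetric one, since marginal waiting costs increase
both in the total rate and in the own rate (`aggregative_unique`), hence it is Pareto-dominant. All
fees paid average to `M * Cs`, so the sufficient fee condition holds. A lone user has nobody to pay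
taxes to, but his payoff under these fees is the social welfare itself.
-/

noncomputable section

namespace FWT

/-! ### Lazy random walks on the natural numbers -/

/-- Step probabilities of a lazy nearest-neighbour walk without upward drift: `up` for `+1`,
`down` for `-1`, `stay` for `0`. -/
structure LazyWalk where
  up : ℝ
  down : ℝ
  stay : ℝ
  up_nonneg : 0 ≤ up
  down_pos : 0 < down
  stay_nonneg : 0 ≤ stay
  sum_eq : up + down + stay = 1
  up_le_down : up ≤ down

namespace LazyWalk

variable (w : LazyWalk)

/-- Transition operator of the walk reflected at `0`: the truncated `n - 1` makes the walk stay
at `0` when a downward step is due there. -/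
def refl : (ℕ → ℝ) →ₗ[ℝ] (ℕ → ℝ) where
  toFun f n := w.up * f (n + 1) + w.down * f (n - 1) + w.stay * f n
  map_add' f g := by ext n; simp only [Pi.add_apply]; ring
  map_smul' c f := by ext n; simp only [Pi.smul_apply, smul_eq_mul, RingHom.id_apply]; ring

/-- Transition operator of the walk absorbed at `0`. -/
def absorb : (ℕ → ℝ) →ₗ[ℝ] (ℕ → ℝ) where
  toFun f n := if n = 0 then f 0 else w.up * f (n + 1) + w.down * f (n - 1) + w.stay * f n
  map_add' f g := by
    ext n; simp only [Pi.add_apply]; split_ifs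
    · rfl
    · ring
  map_smul' c f := by
    ext n; simp only [Pi.smul_apply, smul_eq_mul, RingHom.id_apply]; split_ifs
    · rfl
    · ring

lemma refl_apply (f : ℕ → ℝ) (n : ℕ) :
    w.refl f n = w.up * f (n + 1) + w.down * f (n - 1) + w.stay * f n := rfl

lemma absorb_apply (f : ℕ → ℝ) (n : ℕ) :
    w.absorb f n =
      if n = 0 then f 0 else w.up * f (n + 1) + w.down * f (n - 1) + w.stay * f n := rfl

/-- The indicator of a nonempty queue. -/
def busy (n : ℕ) : ℝ := if n = 0 then 0 else 1

/-- The queue length as a real number. -/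
def len (n : ℕ) : ℝ := n

lemma busy_mono : Monotone busy := by
  intro a b h
  unfold busy
  split_ifs <;> first | omega | norm_num

lemma len_mono : Monotone len := fun _ _ h => Nat.cast_le.mpr h

lemma monotone_refl {f : ℕ → ℝ} (hf : Monotone f) : Monotone (w.refl f) := by
  intro a b h
  simp only [refl_apply]
  have h1 := mul_le_mul_of_nonneg_left (hf (Nat.add_le_add_right h 1)) w.up_nonneg
  have h2 := mul_le_mul_of_nonneg_left (hf (Nat.sub_le_sub_right h 1)) w.down_pos.le
  have h3 := mul_le_mul_of_nonneg_left (hf h) w.stay_nonneg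
  linarith

lemma refl_mono {f g : ℕ → ℝ} (h : f ≤ g) : w.refl f ≤ w.refl g := by
  intro n
  simp only [refl_apply]
  have h1 := mul_le_mul_of_nonneg_left (h (n + 1)) w.up_nonneg
  have h2 := mul_le_mul_of_nonneg_left (h (n - 1)) w.down_pos.le
  have h3 := mul_le_mul_of_nonneg_left (h n) w.stay_nonneg
  linarith

lemma absorb_mono {f g : ℕ → ℝ} (h : f ≤ g) : w.absorb f ≤ w.absorb g := by
  intro n
  simp only [absorb_apply]
  split_ifs
  · exact h 0
  · exact w.refl_mono h n

lemma refl_const (c : ℝ) : w.refl (fun _ => c) = fun _ => c := by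
  ext n
  simp only [refl_apply]
  rw [← add_mul, ← add_mul, w.sum_eq, one_mul]

lemma monotone_refl_pow {f : ℕ → ℝ} (hf : Monotone f) (j : ℕ) : Monotone ((w.refl ^ j) f) := by
  induction j with
  | zero => simpa using hf
  | succ j ih => rw [pow_succ']; exact w.monotone_refl ih

lemma refl_pow_mono {f g : ℕ → ℝ} (h : f ≤ g) (j : ℕ) : (w.refl ^ j) f ≤ (w.refl ^ j) g := by
  induction j with
  | zero => simpa using h
  | succ j ih => rw [pow_succ']; exact w.refl_mono ih

lemma absorb_pow_mono {f g : ℕ → ℝ} (h : f ≤ g) (j : ℕ) :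
    (w.absorb ^ j) f ≤ (w.absorb ^ j) g := by
  induction j with
  | zero => simpa using h
  | succ j ih => rw [pow_succ']; exact w.absorb_mono ih

lemma refl_pow_const (c : ℝ) (j : ℕ) : (w.refl ^ j) (fun _ => c) = fun _ => c := by
  induction j with
  | zero => simp
  | succ j ih => rw [pow_succ', Module.End.mul_apply, ih, refl_const]

/-- `w.mean f j` is the expectation of `f` at time `j` of the reflected walk started at `0`. -/
def mean (f : ℕ → ℝ) (j : ℕ) : ℝ := (w.refl ^ j) f 0

lemma mean_zero (f : ℕ → ℝ) : w.mean f 0 = f 0 := by simp [mean]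

lemma mean_succ (f : ℕ → ℝ) (j : ℕ) : w.mean f (j + 1) = w.mean (w.refl f) j := by
  simp [mean, pow_succ]

lemma mean_add (f g : ℕ → ℝ) (j : ℕ) : w.mean (f + g) j = w.mean f j + w.mean g j := by
  simp [mean]

lemma mean_smul (c : ℝ) (f : ℕ → ℝ) (j : ℕ) : w.mean (c • f) j = c * w.mean f j := by
  simp [mean]

lemma mean_const (c : ℝ) (j : ℕ) : w.mean (fun _ => c) j = c := by
  simp [mean, refl_pow_const]

lemma mean_mono {f g : ℕ → ℝ} (h : f ≤ g) (j : ℕ) : w.mean f j ≤ w.mean g j :=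
  w.refl_pow_mono h j 0

/-- Started at its minimum, the walk is stochastically increasing in time. -/
lemma monotone_mean {f : ℕ → ℝ} (hf : Monotone f) : Monotone (w.mean f) := by
  refine monotone_nat_of_le_succ fun j => ?_
  have h := w.monotone_refl_pow hf j
  have e : w.mean f (j + 1) = w.refl ((w.refl ^ j) f) 0 := by simp [mean, pow_succ']
  rw [e, refl_apply, mean]
  have h1 := mul_le_mul_of_nonneg_left (h (Nat.zero_le (0 + 1))) w.up_nonneg
  simp only [Nat.zero_sub]
  linear_combination h1 - (w.refl ^ j) f 0 * w.sum_eq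

lemma refl_len : w.refl len = len + ((fun _ => w.up) + (-w.down) • busy) := by
  ext n
  simp only [refl_apply, Pi.add_apply, Pi.smul_apply, smul_eq_mul, len, busy]
  have := w.sum_eq
  rcases n with _ | n
  · simp
  · simp only [Nat.add_sub_cancel, Nat.succ_ne_zero, if_false]
    push_cast
    linear_combination ((n : ℝ) + 1) * this

lemma mean_len_succ (j : ℕ) :
    w.mean len (j + 1) = w.mean len j + (w.up - w.down * w.mean busy j) := by
  rw [mean_succ, refl_len, mean_add, mean_add, mean_const, mean_smul]; ring

/-- The test function `n² + n`, whose drift under the reflected walk is affine in `n`. -/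
def quad (n : ℕ) : ℝ := (n : ℝ) ^ 2 + n

lemma quad_mono : Monotone quad := by
  intro a b h
  have : (a : ℝ) ≤ b := Nat.cast_le.mpr h
  unfold quad
  gcongr

lemma refl_quad : w.refl quad = quad + ((fun _ => 2 * w.up) + (-(2 * (w.down - w.up))) • len) := by
  ext n
  simp only [refl_apply, Pi.add_apply, Pi.smul_apply, smul_eq_mul, len, quad]
  have := w.sum_eq
  rcases n with _ | n
  · simp; ring
  · simp only [Nat.add_sub_cancel]
    push_cast
    linear_combination (((n : ℝ) + 1) ^ 2 + (n + 1)) * this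

lemma mean_quad_succ (j : ℕ) :
    w.mean quad (j + 1) =
      w.mean quad j + (2 * w.up - 2 * (w.down - w.up) * w.mean len j) := by
  rw [mean_succ, refl_quad, mean_add, mean_add, mean_const, mean_smul]; ring

/-- Base of the exponential Lyapunov function `n ↦ base ^ n`. -/
def base : ℝ := 2 * w.down / (w.up + w.down)

/-- Contraction factor of the Lyapunov function `n ↦ base ^ n` away from `0`. -/
def factor : ℝ := w.up * w.base + w.down / w.base + w.stay

variable {w} in
lemma one_lt_base (h : w.up < w.down) : 1 < w.base := by
  have := w.up_nonneg
  have := w.down_pos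
  unfold base
  rw [lt_div_iff₀ (by linarith)]; linarith

lemma factor_nonneg : 0 ≤ w.factor := by
  have h1 := w.up_nonneg
  have h2 := w.down_pos
  have h3 := w.stay_nonneg
  unfold factor base
  positivity

variable {w} in
lemma factor_lt_one (h : w.up < w.down) : w.factor < 1 := by
  have h1 := one_lt_base h
  have h2 : w.up * w.base < w.down := by
    have := w.up_nonneg
    have := w.down_pos
    unfold base
    rw [← mul_div_assoc, div_lt_iff₀ (by linarith)]; nlinarith
  have h3 : w.factor - 1 = (w.base - 1) * (w.up * w.base - w.down) / w.base := by
    unfold factor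
    have := w.sum_eq
    field_simp
    linear_combination w.base * this
  have : (w.base - 1) * (w.up * w.base - w.down) / w.base < 0 :=
    div_neg_of_neg_of_pos (mul_neg_of_pos_of_neg (by linarith) (by linarith)) (by linarith)
  linarith

variable {w} in
lemma exists_quad_le (h : w.up < w.down) : ∃ C : ℝ, 0 ≤ C ∧ ∀ n, quad n ≤ C * w.base ^ n := by
  have h1 := one_lt_base h
  have t2 := tendsto_pow_const_div_const_pow_of_one_lt 2 h1
  have t1 := tendsto_pow_const_div_const_pow_of_one_lt 1 h1
  obtain ⟨C, hC⟩ := (t2.add t1).bddAbove_range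
  refine ⟨C, ?_, fun n => ?_⟩
  · have := hC ⟨0, rfl⟩
    simpa using this
  · have := hC ⟨n, rfl⟩
    simp only [pow_one] at this
    rw [← add_div, div_le_iff₀ (by positivity)] at this
    exact this

variable {w} in
/-- Second moments of the positive recurrent walk stay bounded, by the Lyapunov function
`n ↦ base ^ n`. -/
lemma bddAbove_mean_quad (h : w.up < w.down) : BddAbove (Set.range (w.mean quad)) := by
  obtain ⟨C, hC0, hC⟩ := exists_quad_le h
  have hz := one_lt_base h
  have hφ := factor_lt_one h
  have hφ0 := w.factor_nonneg
  have step : w.refl (fun n => w.base ^ n) ≤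
      w.factor • (fun n => w.base ^ n) + fun _ => w.down := by
    intro n
    simp only [refl_apply, Pi.add_apply, Pi.smul_apply, smul_eq_mul, factor]
    rcases n with _ | n
    · simp only [Nat.zero_sub, pow_zero, zero_add, pow_one, mul_one]
      have : 0 ≤ w.down / w.base := div_nonneg w.down_pos.le (by linarith)
      linarith
    · simp only [Nat.add_sub_cancel]
      have : w.base ≠ 0 := by linarith
      have e : w.up * w.base ^ (n + 1 + 1) + w.down * w.base ^ n + w.stay * w.base ^ (n + 1) =
        (w.up * w.base + w.down / w.base + w.stay) * w.base ^ (n + 1) := by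
        field_simp
        ring
      rw [e]
      linarith [w.down_pos]
  set K := 1 + w.down / (1 - w.factor) with hK
  have hd : 0 < w.down / (1 - w.factor) := div_pos w.down_pos (by linarith)
  have bound : ∀ j, w.mean (fun n => w.base ^ n) j ≤ K := by
    intro j
    induction j with
    | zero => simp [mean_zero, hK, hd.le]
    | succ j ih =>
      have e : w.down = (1 - w.factor) * (w.down / (1 - w.factor)) := by
        have : 1 - w.factor ≠ 0 := by linarith
        field_simp
      calc w.mean (fun n => w.base ^ n) (j + 1)
          ≤ w.factor * w.mean (fun n => w.base ^ n) j + w.down := by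
            rw [mean_succ]
            refine (w.mean_mono step j).trans ?_
            rw [mean_add, mean_smul, mean_const]
        _ ≤ w.factor * K + w.down := by gcongr
        _ ≤ K := by rw [hK]; nlinarith
  refine ⟨C * K, ?_⟩
  rintro _ ⟨j, rfl⟩
  have h1 : quad ≤ C • (fun n => w.base ^ n) := fun n => by simpa using hC n
  calc w.mean quad j ≤ C * w.mean (fun n => w.base ^ n) j := by
        rw [← mean_smul]; exact w.mean_mono h1 j
    _ ≤ C * K := by gcongr; exact bound j

variable {w} in
/-- The limit of the mean queue length. The mean of `quad` increases and is bounded, so its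
increments, which are affine in the mean queue length, tend to `0`. -/
lemma tendsto_mean_len (h : w.up < w.down) :
    Tendsto (w.mean len) atTop (𝓝 (w.up / (w.down - w.up))) := by
  obtain ⟨L, hL⟩ : ∃ L, Tendsto (w.mean quad) atTop (𝓝 L) :=
    ⟨_, tendsto_atTop_ciSup (w.monotone_mean quad_mono) (bddAbove_mean_quad h)⟩
  have h1 := (hL.comp (tendsto_add_atTop_nat 1)).sub hL
  have hd : w.down - w.up ≠ 0 := by linarith
  have h2 : Tendsto (fun j => (2 * w.up - (w.mean quad (j + 1) - w.mean quad j)) /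
      (2 * (w.down - w.up))) atTop (𝓝 ((2 * w.up - (L - L)) / (2 * (w.down - w.up)))) :=
    (h1.const_sub _).div_const _
  have e : (2 * w.up - (L - L)) / (2 * (w.down - w.up)) = w.up / (w.down - w.up) := by
    rw [sub_self, sub_zero, mul_div_mul_left _ _ two_ne_zero]
  rw [e] at h2
  refine h2.congr fun j => ?_
  rw [mean_quad_succ]
  field_simp
  ring

variable {w} in
/-- The increments of the mean queue length, which are affine in the probability of a nonempty
queue, tend to `0`. -/
lemma tendsto_mean_busy_of_lt (h : w.up < w.down) :
    Tendsto (w.mean busy) atTop (𝓝 (w.up / w.down)) := by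
  have h0 := tendsto_mean_len h
  have h1 := (h0.comp (tendsto_add_atTop_nat 1)).sub h0
  have h2 : Tendsto (fun j => (w.up - (w.mean len (j + 1) - w.mean len j)) / w.down) atTop
      (𝓝 ((w.up - 0) / w.down)) := by
    rw [← sub_self (w.up / (w.down - w.up))]
    exact (h1.const_sub _).div_const _
  rw [sub_zero] at h2
  refine h2.congr fun j => ?_
  have := w.down_pos.ne'
  rw [mean_len_succ]
  field_simp
  ring

/-- The walk with the same downward probability and a smaller upward probability `a`. -/
def lower (a : ℝ) (h0 : 0 ≤ a) (h1 : a ≤ w.up) : LazyWalk where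
  up := a
  down := w.down
  stay := w.stay + (w.up - a)
  up_nonneg := h0
  down_pos := w.down_pos
  stay_nonneg := by linarith [w.stay_nonneg]
  sum_eq := by linarith [w.sum_eq]
  up_le_down := h1.trans w.up_le_down

lemma mean_lower_le (a : ℝ) (h0 : 0 ≤ a) (h1 : a ≤ w.up) {f : ℕ → ℝ} (hf : Monotone f) (j : ℕ) :
    (w.lower a h0 h1).mean f j ≤ w.mean f j := by
  suffices ((w.lower a h0 h1).refl ^ j) f ≤ (w.refl ^ j) f from this 0
  induction j with
  | zero => simp
  | succ j ih =>
    rw [pow_succ', pow_succ']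
    refine ((w.lower a h0 h1).refl_mono ih).trans fun n => ?_
    have := w.monotone_refl_pow hf j (Nat.le_succ n)
    rw [refl_apply, Module.End.mul_apply, refl_apply]
    simp only [lower]
    simp only [Nat.succ_eq_add_one] at this
    nlinarith

lemma mean_busy_le_one (j : ℕ) : w.mean busy j ≤ 1 := by
  rw [← w.mean_const 1 j]
  refine w.mean_mono (fun n => ?_) j
  unfold busy; split_ifs <;> norm_num

lemma mean_busy_nonneg (j : ℕ) : 0 ≤ w.mean busy j := by
  rw [← w.mean_const 0 j]
  refine w.mean_mono (fun n => ?_) j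
  unfold busy; split_ifs <;> norm_num

lemma mean_len_nonneg (j : ℕ) : 0 ≤ w.mean len j := by
  rw [← w.mean_const 0 j]
  exact w.mean_mono (fun n => Nat.cast_nonneg n) j

/-- The long-run probability of a nonempty queue is the ratio of the rates, also in the null
recurrent case, where it follows by comparison with the positive recurrent walks below. -/
lemma tendsto_mean_busy : Tendsto (w.mean busy) atTop (𝓝 (w.up / w.down)) := by
  rcases w.up_le_down.lt_or_eq with h | h
  · exact tendsto_mean_busy_of_lt h
  · have hd := w.down_pos
    rw [h, div_self hd.ne']
    refine tendsto_order.mpr ⟨fun c hc => ?_, fun c hc => Eventually.of_forall fun j =>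
      (w.mean_busy_le_one j).trans_lt hc⟩
    obtain ⟨a, ha, ha1⟩ := exists_between (max_lt hc one_pos)
    have ha0 : 0 < a := (le_max_right _ _).trans_lt ha
    have hlt : a * w.down < w.up := by nlinarith
    have hnn : 0 ≤ a * w.down := by positivity
    have t := tendsto_mean_busy_of_lt (w := w.lower (a * w.down) hnn hlt.le)
      (by simp only [lower]; nlinarith)
    have e : (w.lower (a * w.down) hnn hlt.le).up / (w.lower (a * w.down) hnn hlt.le).down = a := by
      simp only [lower]; field_simp
    rw [e] at t
    filter_upwards [t.eventually (lt_mem_nhds ((le_max_left _ _).trans_lt ha))] with j hj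
    exact hj.trans_le (w.mean_lower_le _ hnn hlt.le busy_mono j)

/-- In the null recurrent case the mean queue length diverges. -/
lemma tendsto_mean_len_atTop (h : w.up = w.down) : Tendsto (w.mean len) atTop atTop := by
  refine tendsto_atTop.mpr fun c => ?_
  have hd := w.down_pos
  -- the ratio `a` of rates whose stationary mean `a / (1 - a)` is `|c| + 1`
  set a : ℝ := (|c| + 1) / (|c| + 2) with ha
  have hc : (0 : ℝ) < |c| + 2 := by positivity
  have ha0 : 0 < a := by positivity
  have ha1 : a < 1 := by rw [ha, div_lt_one hc]; linarith
  have hlt : a * w.down < w.up := by nlinarith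
  have hnn : 0 ≤ a * w.down := by positivity
  have t := tendsto_mean_len (w := w.lower (a * w.down) hnn hlt.le)
    (by simp only [lower]; nlinarith)
  have e : (w.lower (a * w.down) hnn hlt.le).up /
      ((w.lower (a * w.down) hnn hlt.le).down - (w.lower (a * w.down) hnn hlt.le).up) =
      |c| + 1 := by
    simp only [lower]
    have e1 : w.down - a * w.down = w.down / (|c| + 2) := by rw [ha]; field_simp; ring
    rw [e1, ha]; field_simp
  rw [e] at t
  filter_upwards [t.eventually (lt_mem_nhds (show c < |c| + 1 by linarith [le_abs_self c]))]
    with j hj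
  exact hj.le.trans (w.mean_lower_le _ hnn hlt.le len_mono j)

lemma absorb_len : w.absorb len = len + (-(w.down - w.up)) • busy := by
  ext n
  simp only [absorb_apply, Pi.add_apply, Pi.smul_apply, smul_eq_mul, len, busy]
  have := w.sum_eq
  rcases n with _ | n
  · simp
  · simp only [Nat.add_sub_cancel, Nat.succ_ne_zero, if_false]
    push_cast
    linear_combination ((n : ℝ) + 1) * this

variable {w} in
/-- The mean absorption time of the walk started at `n`. -/
lemma hasSum_absorb_busy (h : w.up < w.down) (n : ℕ) :
    HasSum (fun i => (w.absorb ^ i) busy n) (n / (w.down - w.up)) := by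
  have hz := one_lt_base h
  have hφ := factor_lt_one h
  have hφ0 := w.factor_nonneg
  have hd : 0 < w.down - w.up := by linarith
  have hbusy : (0 : ℕ → ℝ) ≤ busy := fun n => by unfold busy; split_ifs <;> norm_num
  have partialSum : ∀ I, ∑ i ∈ Finset.range I, (w.absorb ^ i) busy n =
      (n - (w.absorb ^ I) len n) / (w.down - w.up) := by
    intro I
    induction I with
    | zero => simp [len]
    | succ I ih =>
      rw [Finset.sum_range_succ, ih, pow_succ, Module.End.mul_apply, absorb_len, map_add,
        map_smul]
      simp only [Pi.add_apply, Pi.smul_apply, smul_eq_mul]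
      field_simp
      ring
  -- `n ↦ base ^ n - 1` vanishes at the absorbing state and is contracted elsewhere
  set V : ℕ → ℝ := fun n => w.base ^ n - 1 with hV
  have step : w.absorb V ≤ w.factor • V := by
    intro n
    simp only [absorb_apply, Pi.smul_apply, smul_eq_mul, hV]
    rcases n with _ | n
    · simp
    · simp only [Nat.add_sub_cancel, Nat.succ_ne_zero, if_false]
      have hb : w.base ≠ 0 := by linarith
      have e : w.up * (w.base ^ (n + 1 + 1) - 1) + w.down * (w.base ^ n - 1) +
          w.stay * (w.base ^ (n + 1) - 1) = w.factor * w.base ^ (n + 1) - 1 := by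
        have := w.sum_eq
        unfold factor
        field_simp
        linear_combination (-w.base) * this
      rw [e]
      linarith
  have iter : ∀ I, (w.absorb ^ I) V ≤ w.factor ^ I • V := by
    intro I
    induction I with
    | zero => simp
    | succ I ih =>
      rw [pow_succ, Module.End.mul_apply]
      refine (w.absorb_pow_mono step I).trans ?_
      rw [map_smul, pow_succ', mul_smul]
      intro n
      have := mul_le_mul_of_nonneg_left (ih n) hφ0
      simpa using this
  have lenV : len ≤ (w.base - 1)⁻¹ • V := by
    intro n
    have := one_add_mul_sub_le_pow (show -1 ≤ w.base by linarith) n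
    have hb : 0 < w.base - 1 := by linarith
    simp only [Pi.smul_apply, smul_eq_mul, hV, len]
    rw [inv_mul_eq_div, le_div_iff₀ hb]
    linarith
  have hlen0 : ∀ I, 0 ≤ (w.absorb ^ I) len n := by
    intro I
    have := w.absorb_pow_mono (f := 0) (g := len) (fun n => Nat.cast_nonneg n) I n
    simpa using this
  have hlim : Tendsto (fun I => (w.absorb ^ I) len n) atTop (𝓝 0) := by
    refine squeeze_zero hlen0 (g := fun I => w.factor ^ I * ((w.base - 1)⁻¹ * V n)) (fun I => ?_) ?_
    · refine (w.absorb_pow_mono lenV I n).trans ?_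
      rw [map_smul]
      have hb : 0 ≤ (w.base - 1)⁻¹ := inv_nonneg.mpr (by linarith)
      have := mul_le_mul_of_nonneg_left (iter I n) hb
      simp only [Pi.smul_apply, smul_eq_mul] at this ⊢
      linarith
    · simpa using (tendsto_pow_atTop_nhds_zero_of_lt_one hφ0 hφ).mul_const
        ((w.base - 1)⁻¹ * V n)
  refine (hasSum_iff_tendsto_nat_of_nonneg (fun i => ?_) _).mpr ?_
  · have := w.absorb_pow_mono hbusy i n
    simpa using this
  · simp only [partialSum]
    simpa using (hlim.const_sub (n : ℝ)).div_const (w.down - w.up)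

end LazyWalk

/-! ### Sequences of independent variables -/

/-- Under a product measure, a function of the first `k` coordinates is independent of the
coordinate `k`. -/
lemma indepFun_of_dependsOn {Y β : Type*} [MeasurableSpace Y] [MeasurableSpace β]
    (ν : Measure Y) [IsProbabilityMeasure ν] {k : ℕ} {X : (ℕ → Y) → β} (hX : Measurable X)
    (hd : DependsOn X (Set.Iio k)) :
    IndepFun X (fun y => y k) (Measure.infinitePi fun _ : ℕ => ν) := by
  have hY : Nonempty Y := nonempty_of_isProbabilityMeasure ν
  have y₀ : Y := Classical.arbitrary Y
  have hi : iIndepFun (fun (i : ℕ) (y : ℕ → Y) => y i) (Measure.infinitePi fun _ : ℕ => ν) :=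
    iIndepFun_infinitePi (P := fun _ : ℕ => ν) (X := fun _ => id) fun _ => measurable_id
  have h := hi.indepFun_finset (Finset.range k) {k} (by simp) fun i => measurable_pi_apply i
  let extend : (Finset.range k → Y) → ℕ → Y :=
    fun u i => if hi : i ∈ Finset.range k then u ⟨i, hi⟩ else y₀
  have he : Measurable extend := by
    refine measurable_pi_lambda _ fun i => ?_
    by_cases hi : i ∈ Finset.range k
    · simp only [extend, hi, dite_true]; exact measurable_pi_apply _
    · simp only [extend, hi, dite_false]; exact measurable_const
  have hk : Measurable fun u : ({k} : Finset ℕ) → Y => u ⟨k, by simp⟩ := by fun_prop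
  have h2 := h.comp (hX.comp he) hk
  convert h2 using 1
  · ext y
    refine hd fun i hi => ?_
    simp [extend, Set.mem_Iio.mp hi]
  · rfl

lemma lintegral_of_dependsOn {Y β : Type*} [MeasurableSpace Y] [MeasurableSpace β]
    (ν : Measure Y) [IsProbabilityMeasure ν] {k : ℕ} {X : (ℕ → Y) → β} (hX : Measurable X)
    (hd : DependsOn X (Set.Iio k)) {F : β × Y → ENNReal} (hF : Measurable F) :
    ∫⁻ y, F (X y, y k) ∂(Measure.infinitePi fun _ : ℕ => ν) =
      ∫⁻ y, ∫⁻ v, F (X y, v) ∂ν ∂(Measure.infinitePi fun _ : ℕ => ν) := by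
  have hk : Measurable fun y : ℕ → Y => y k := measurable_pi_apply k
  have h := (indepFun_iff_map_prod_eq_prod_map_map hX.aemeasurable hk.aemeasurable).mp
    (indepFun_of_dependsOn ν hX hd)
  rw [Measure.infinitePi_map_eval] at h
  have e1 : ∫⁻ y, F (X y, y k) ∂(Measure.infinitePi fun _ : ℕ => ν) =
      ∫⁻ z, F z ∂((Measure.infinitePi fun _ : ℕ => ν).map fun y => (X y, y k)) :=
    (lintegral_map hF (hX.prodMk hk)).symm
  have : IsProbabilityMeasure ((Measure.infinitePi fun _ : ℕ => ν).map X) :=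
    Measure.isProbabilityMeasure_map hX.aemeasurable
  rw [e1, h, lintegral_prod _ hF.aemeasurable,
    lintegral_map hF.lintegral_prod_right' hX]

/-! ### Exponential gaps and the expected number of events -/

lemma expMeasure_eq (r : ℝ) :
    expMeasure r = (volume : Measure ℝ).withDensity (exponentialPDF r) := rfl

lemma measurable_exponentialPDF (r : ℝ) : Measurable (exponentialPDF r) :=
  (measurable_exponentialPDFReal r).ennreal_ofReal

lemma lintegral_expMeasure {r : ℝ} (f : ℝ → ENNReal) (hf : Measurable f) :
    ∫⁻ v, f v ∂expMeasure r =
      ∫⁻ v in Set.Ici 0, ENNReal.ofReal (r * Real.exp (-(r * v))) * f v := by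
  rw [expMeasure_eq, lintegral_withDensity_eq_lintegral_mul _ (measurable_exponentialPDF r) hf,
    ← lintegral_indicator measurableSet_Ici]
  refine lintegral_congr fun v => ?_
  by_cases hv : 0 ≤ v
  · simp [hv, exponentialPDF_of_nonneg hv]
  · simp [hv, exponentialPDF_of_neg (not_le.mp hv)]

lemma ae_nonneg_expMeasure (r : ℝ) : ∀ᵐ v ∂expMeasure r, 0 ≤ v := by
  rw [ae_iff]
  have : MeasurableSet {v : ℝ | ¬ 0 ≤ v} := (measurableSet_le measurable_const measurable_id).compl
  rw [← lintegral_indicator_one this, lintegral_expMeasure _ (measurable_one.indicator this)]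
  refine (setLIntegral_congr_fun measurableSet_Ici fun v hv => ?_).trans lintegral_zero
  have : ¬ v < 0 := not_lt.mpr hv
  simp [this]

/-- The mean gap, as the value of the Gamma integral at `2`. -/
lemma lintegral_id_expMeasure {r : ℝ} (hr : 0 < r) :
    ∫⁻ v, ENNReal.ofReal v ∂expMeasure r = ENNReal.ofReal (1 / r) := by
  rw [lintegral_expMeasure _ ENNReal.measurable_ofReal, setLIntegral_congr Ioi_ae_eq_Ici.symm]
  have h := Real.integral_rpow_mul_exp_neg_mul_Ioi (a := 2) (r := r) two_pos hr
  have h2 : ∫ v in Set.Ioi (0 : ℝ), r * Real.exp (-(r * v)) * v = 1 / r := by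
    have : ∀ v : ℝ, r * Real.exp (-(r * v)) * v =
        r * (v ^ ((2 : ℝ) - 1) * Real.exp (-(r * v))) := by
      intro v; norm_num; ring
    simp_rw [this]
    rw [integral_const_mul, h, Real.Gamma_two]
    have e : ((1 : ℝ) / r) ^ (2 : ℝ) = (1 / r) ^ (2 : ℕ) := by
      rw [← Real.rpow_natCast]; norm_num
    rw [e]
    field_simp
  rw [← h2, ofReal_integral_eq_lintegral_ofReal]
  · refine setLIntegral_congr_fun measurableSet_Ioi fun v hv => ?_
    have : 0 ≤ r * Real.exp (-(r * v)) := by positivity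
    rw [ENNReal.ofReal_mul this]
  · by_contra hn
    rw [integral_undef hn] at h2
    have : 0 < 1 / r := by positivity
    linarith
  · refine (ae_restrict_mem measurableSet_Ioi).mono fun v hv => ?_
    have : 0 < v := hv
    simp only [Pi.zero_apply]
    positivity

/-- The compensator identity behind the renewal equation: the function `v ↦ θ (a - v)⁺` loses in
one exponential gap exactly the probability that the gap ends before `a`. -/
lemma lintegral_expMeasure_compensator {r : ℝ} (hr : 0 < r) (a : ℝ) :
    ∫⁻ v, (ENNReal.ofReal (r * (a - v)) + (Set.Iic a).indicator 1 v) ∂expMeasure r =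
      ENNReal.ofReal (r * a) := by
  have hmeas : Measurable fun v : ℝ =>
      ENNReal.ofReal (r * (a - v)) + (Set.Iic a).indicator (1 : ℝ → ENNReal) v := by
    exact Measurable.add (f := fun v : ℝ => ENNReal.ofReal (r * (a - v))) (by fun_prop)
      (measurable_one.indicator measurableSet_Iic)
  rw [lintegral_expMeasure _ hmeas]
  rcases lt_or_ge a 0 with ha | ha
  · rw [ENNReal.ofReal_of_nonpos (mul_nonpos_of_nonneg_of_nonpos hr.le ha.le)]
    refine (setLIntegral_congr_fun measurableSet_Ici fun v hv => ?_).trans lintegral_zero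
    have hv : 0 ≤ v := hv
    have h1 : ¬ v ≤ a := by linarith
    have h2 : r * (a - v) ≤ 0 := mul_nonpos_of_nonneg_of_nonpos hr.le (by linarith)
    simp [h1, ENNReal.ofReal_of_nonpos h2]
  have hder : ∀ v ∈ Set.uIcc 0 a, HasDerivAt (fun v => -(r * (a - v) * Real.exp (-(r * v))))
      (r * Real.exp (-(r * v)) * (r * (a - v) + 1)) v := by
    intro v _
    have h1 : HasDerivAt (fun v => r * (a - v)) (r * (0 - 1)) v :=
      (((hasDerivAt_const v a).sub (hasDerivAt_id v)).const_mul r)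
    have h2 : HasDerivAt (fun v => Real.exp (-(r * v))) (Real.exp (-(r * v)) * (-(r * 1))) v :=
      (((hasDerivAt_id v).const_mul r).neg).exp
    exact (h1.mul h2).neg.congr_deriv (by ring)
  have hcont : Continuous fun v : ℝ => r * Real.exp (-(r * v)) * (r * (a - v) + 1) := by fun_prop
  have hint := intervalIntegral.integral_eq_sub_of_hasDerivAt hder
    (hcont.intervalIntegrable 0 a)
  have hval : ∫ v in (0 : ℝ)..a, r * Real.exp (-(r * v)) * (r * (a - v) + 1) = r * a := by
    rw [hint]; simp
  rw [intervalIntegral.integral_of_le ha, ← integral_Icc_eq_integral_Ioc] at hval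
  rw [← hval, ofReal_integral_eq_lintegral_ofReal
    (hcont.integrableOn_Icc) ((ae_restrict_mem measurableSet_Icc).mono fun v hv => ?_)]
  · rw [← lintegral_indicator measurableSet_Icc, ← lintegral_indicator measurableSet_Ici]
    refine lintegral_congr fun v => ?_
    by_cases h0 : 0 ≤ v
    · by_cases h1 : v ≤ a
      · have h2 : 0 ≤ r * (a - v) := mul_nonneg hr.le (by linarith)
        have h3 : 0 ≤ r * Real.exp (-(r * v)) := by positivity
        simp only [Set.indicator, Set.mem_Ici, h0, Set.mem_Iic, h1, Set.mem_Icc, and_self,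
          if_true, Pi.one_apply]
        rw [ENNReal.ofReal_mul h3, ENNReal.ofReal_add h2 zero_le_one, ENNReal.ofReal_one]
      · have h2 : r * (a - v) ≤ 0 := mul_nonpos_of_nonneg_of_nonpos hr.le (by linarith)
        simp [h0, h1, ENNReal.ofReal_of_nonpos h2]
    · simp [h0]
  · have : 0 ≤ a - v := by linarith [hv.2]
    simp only [Pi.zero_apply]
    positivity

/-- Law of the sequence of gaps between events. -/
def gapLaw (r : ℝ) : Measure (ℕ → ℝ) := Measure.infinitePi fun _ : ℕ => expMeasure r

/-- Time of event `j`, from the sequence of gaps. -/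
def arrival (g : ℕ → ℝ) (j : ℕ) : ℝ := ∑ i ∈ Finset.range (j + 1), g i

/-- Probability that event `j` happens in `[0, t]`. -/
def arrivalProb (r t : ℝ) (j : ℕ) : ENNReal := gapLaw r {g | arrival g j ≤ t}

lemma measurable_partialSum (j : ℕ) : Measurable fun g : ℕ → ℝ => ∑ i ∈ Finset.range j, g i :=
  Finset.measurable_sum _ fun i _ => measurable_pi_apply i

lemma measurable_arrival (j : ℕ) : Measurable fun g => arrival g j := measurable_partialSum _

lemma measurableSet_arrival_le (j : ℕ) (t : ℝ) : MeasurableSet {g | arrival g j ≤ t} :=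
  measurableSet_le (measurable_arrival j) measurable_const

lemma dependsOn_partialSum (j : ℕ) :
    DependsOn (fun g : ℕ → ℝ => ∑ i ∈ Finset.range j, g i) (Set.Iio j) := fun _ _ h =>
  Finset.sum_congr rfl fun i hi => h i (Finset.mem_range.mp hi)

lemma isProbabilityMeasure_gapLaw {r : ℝ} (hr : 0 < r) : IsProbabilityMeasure (gapLaw r) := by
  have := isProbabilityMeasure_expMeasure hr
  unfold gapLaw
  infer_instance

lemma ae_nonneg_gap {r : ℝ} (hr : 0 < r) : ∀ᵐ g ∂gapLaw r, ∀ i, 0 ≤ g i := by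
  have := isProbabilityMeasure_expMeasure hr
  rw [ae_all_iff]
  intro i
  have h := ae_nonneg_expMeasure r
  rw [← Measure.infinitePi_map_eval (fun _ : ℕ => expMeasure r) i] at h
  exact ae_of_ae_map (measurable_pi_apply i).aemeasurable h

lemma arrivalProb_le_one {r : ℝ} (hr : 0 < r) (t : ℝ) (j : ℕ) : arrivalProb r t j ≤ 1 := by
  have := isProbabilityMeasure_gapLaw hr
  exact prob_le_one

/-- The expected number of events in `[0, t]` is `r t`: with `S` the time of the last of the first
`j` events, the mean of `r (t - S)⁺` plus the expected number of them in `[0, t]` does not depend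
on `j`, and the first term vanishes as `j → ∞`. -/
lemma tsum_arrivalProb {r : ℝ} (hr : 0 < r) (t : ℝ) :
    ∑' j, arrivalProb r t j = ENNReal.ofReal (r * t) := by
  have := isProbabilityMeasure_expMeasure hr
  have := isProbabilityMeasure_gapLaw hr
  set e : ℕ → ENNReal := fun j =>
    ∫⁻ g, ENNReal.ofReal (r * (t - ∑ i ∈ Finset.range j, g i)) ∂gapLaw r with he
  have step : ∀ j, e (j + 1) + arrivalProb r t j = e j := by
    intro j
    have hF : Measurable fun z : ℝ × ℝ => ENNReal.ofReal (r * (t - z.1 - z.2)) +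
        (Set.Iic (t - z.1)).indicator (1 : ℝ → ENNReal) z.2 := by
      refine Measurable.add (f := fun z : ℝ × ℝ => ENNReal.ofReal (r * (t - z.1 - z.2)))
        (by fun_prop) ?_
      have : (fun z : ℝ × ℝ => (Set.Iic (t - z.1)).indicator (1 : ℝ → ENNReal) z.2) =
          {z : ℝ × ℝ | z.2 ≤ t - z.1}.indicator 1 := by
        ext z; simp [Set.indicator]
      rw [this]
      exact measurable_one.indicator (measurableSet_le (by fun_prop) (by fun_prop))
    have h := lintegral_of_dependsOn (expMeasure r) (measurable_partialSum j)
      (dependsOn_partialSum j) hF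
    simp only [lintegral_expMeasure_compensator hr] at h
    simp only [he, gapLaw]
    rw [← h, lintegral_add_left (by fun_prop)]
    congr 1
    · refine lintegral_congr fun g => ?_
      rw [Finset.sum_range_succ, sub_sub]
    · rw [arrivalProb, ← lintegral_indicator_one (measurableSet_arrival_le j t), gapLaw]
      refine lintegral_congr fun g => ?_
      simp only [Set.indicator, Set.mem_ofPred_eq, Set.mem_Iic, arrival, Finset.sum_range_succ,
        le_sub_iff_add_le']
      rfl
  have sums : ∀ J, e J + ∑ j ∈ Finset.range J, arrivalProb r t j = ENNReal.ofReal (r * t) := by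
    intro J
    induction J with
    | zero => simp [he]
    | succ J ih => rw [Finset.sum_range_succ, add_comm (∑ j ∈ Finset.range J, _), ← add_assoc,
        step, ih]
  have hfin : ∑' j, arrivalProb r t j ≠ ⊤ := by
    refine ne_top_of_le_ne_top (ENNReal.ofReal_ne_top (r := r * t)) ?_
    rw [ENNReal.tsum_eq_iSup_nat]
    exact iSup_le fun J => (le_add_left le_rfl).trans (sums J).le
  have hb : Tendsto (arrivalProb r t) atTop (𝓝 0) := ENNReal.tendsto_atTop_zero_of_tsum_ne_top hfin
  have hle : ∀ J, e (J + 1) ≤ ENNReal.ofReal (r * t) * arrivalProb r t J := by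
    intro J
    rw [arrivalProb, ← lintegral_indicator_one (measurableSet_arrival_le J t),
      ← lintegral_const_mul _ (measurable_one.indicator (measurableSet_arrival_le J t))]
    refine lintegral_mono_ae ?_
    filter_upwards [ae_nonneg_gap hr] with g hg
    have h0 : 0 ≤ ∑ i ∈ Finset.range (J + 1), g i := Finset.sum_nonneg fun i _ => hg i
    by_cases h : arrival g J ≤ t
    · simp only [Set.indicator, Set.mem_ofPred_eq, h, if_true, Pi.one_apply, mul_one]
      exact ENNReal.ofReal_le_ofReal (mul_le_mul_of_nonneg_left (by linarith) hr.le)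
    · have h' : t < ∑ i ∈ Finset.range (J + 1), g i := not_le.mp h
      rw [ENNReal.ofReal_of_nonpos (mul_nonpos_of_nonneg_of_nonpos hr.le (by linarith))]
      exact zero_le
  have he0 : Tendsto (fun J => e (J + 1)) atTop (𝓝 0) := by
    refine tendsto_of_tendsto_of_tendsto_of_le_of_le tendsto_const_nhds ?_
      (fun _ => zero_le) hle
    simpa using ENNReal.Tendsto.const_mul hb (Or.inr ENNReal.ofReal_ne_top)
  have hs := (ENNReal.tendsto_nat_tsum (arrivalProb r t)).comp (tendsto_add_atTop_nat 1)
  have h2 := he0.add hs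
  rw [zero_add] at h2
  refine tendsto_nhds_unique h2 ?_
  simp only [Function.comp_def, sums]
  exact tendsto_const_nhds

/-- Long-run time averages: when event `j` contributes `a j` on average, the rate of contribution
is the event rate times the limit of `a`, which may be infinite. -/
lemma tendsto_timeAverage {r : ℝ} (hr : 0 < r) {a : ℕ → ENNReal} (ha : Monotone a) {L : ENNReal}
    (hL : Tendsto a atTop (𝓝 L)) :
    Tendsto (fun t : ℝ => ENNReal.ofReal (1 / t) * ∑' j, arrivalProb r t j * a j) atTop
      (𝓝 (ENNReal.ofReal r * L)) := by
  have hr0 : ENNReal.ofReal r ≠ 0 := by simpa using hr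
  have inv : ∀ t : ℝ, 0 < t → ENNReal.ofReal (1 / t) * ENNReal.ofReal (r * t) =
      ENNReal.ofReal r := by
    intro t ht
    rw [← ENNReal.ofReal_mul (by positivity)]
    congr 1
    field_simp
  refine tendsto_order.mpr ⟨fun l hl => ?_, fun l hl => ?_⟩
  · have h1 : l / ENNReal.ofReal r < L := ENNReal.div_lt_of_lt_mul' hl
    obtain ⟨c, hc, hcL⟩ := exists_between h1
    have hctop : c ≠ ⊤ := hcL.ne_top
    have hlc : l < ENNReal.ofReal r * c := by
      rw [mul_comm]
      exact (ENNReal.div_lt_iff (Or.inl hr0) (Or.inl ENNReal.ofReal_ne_top)).mp hc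
    obtain ⟨J, hJ⟩ := eventually_atTop.mp (hL.eventually (lt_mem_nhds hcL))
    have key : ∀ t : ℝ, 0 < t → ENNReal.ofReal r * c - ENNReal.ofReal (1 / t) * (J * c) ≤
        ENNReal.ofReal (1 / t) * ∑' j, arrivalProb r t j * a j := by
      intro t ht
      rw [tsub_le_iff_right, ← inv t ht, ← tsum_arrivalProb hr t, mul_assoc, ← mul_add,
        ← ENNReal.tsum_mul_right]
      gcongr
      have e : (J : ENNReal) * c = ∑' j, if j < J then c else 0 := by
        rw [tsum_eq_sum (s := Finset.range J) (by intro j hj; simp at hj; simp [hj]),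
          Finset.sum_congr rfl (g := fun _ => c) (by intro j hj; simp at hj; simp [hj])]
        simp
      rw [e, ← ENNReal.tsum_add]
      refine ENNReal.tsum_le_tsum fun j => ?_
      by_cases hj : j < J
      · simp only [hj, if_true]
        exact (mul_le_of_le_one_left zero_le (arrivalProb_le_one hr t j)).trans
          (le_add_left le_rfl)
      · simp only [hj, if_false, add_zero]
        gcongr
        exact (hJ j (not_lt.mp hj)).le
    have hinv : Tendsto (fun t : ℝ => ENNReal.ofReal (1 / t)) atTop (𝓝 0) := by
      have : Tendsto (fun t : ℝ => 1 / t) atTop (𝓝 0) := by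
        simpa using tendsto_inv_atTop_zero (𝕜 := ℝ)
      simpa using ENNReal.tendsto_ofReal this
    have hlim : Tendsto (fun t : ℝ => ENNReal.ofReal r * c - ENNReal.ofReal (1 / t) * (J * c))
        atTop (𝓝 (ENNReal.ofReal r * c - 0 * (J * c))) := by
      refine ENNReal.Tendsto.sub tendsto_const_nhds (ENNReal.Tendsto.mul_const hinv (Or.inr ?_))
        (Or.inl (ENNReal.mul_ne_top ENNReal.ofReal_ne_top hctop))
      exact ENNReal.mul_ne_top (ENNReal.natCast_ne_top J) hctop
    rw [zero_mul, tsub_zero] at hlim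
    filter_upwards [hlim.eventually (lt_mem_nhds hlc), eventually_gt_atTop 0] with t h1 h2
    exact h1.trans_le (key t h2)
  · filter_upwards [eventually_gt_atTop 0] with t ht
    refine lt_of_le_of_lt ?_ hl
    calc ENNReal.ofReal (1 / t) * ∑' j, arrivalProb r t j * a j
        ≤ ENNReal.ofReal (1 / t) * ∑' j, arrivalProb r t j * L := by
          gcongr with j
          exact ha.ge_of_tendsto hL j
      _ = ENNReal.ofReal r * L := by
          rw [ENNReal.tsum_mul_right, tsum_arrivalProb hr t, ← mul_assoc, inv t ht]

/-! ### Independence of gaps, sizes and kinds of events -/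

/-- A sequence of independent pairs with independent components is a pair of independent
sequences. -/
lemma map_zip_infinitePi {α β : Type*} [MeasurableSpace α] [MeasurableSpace β]
    (μ : Measure α) (ν : Measure β) [IsProbabilityMeasure μ] [IsProbabilityMeasure ν] :
    ((Measure.infinitePi fun _ : ℕ => μ).prod (Measure.infinitePi fun _ : ℕ => ν)).map
      (fun z i => (z.1 i, z.2 i)) = Measure.infinitePi fun _ : ℕ => μ.prod ν := by
  have hzip : Measurable fun (z : (ℕ → α) × (ℕ → β)) (i : ℕ) => (z.1 i, z.2 i) := by fun_prop
  refine Measure.eq_infinitePi _ fun s t ht => ?_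
  have hs : MeasurableSet (Set.pi (s : Set ℕ) t) :=
    MeasurableSet.pi s.countable_toSet fun i _ => ht i
  rw [Measure.map_apply hzip hs]
  let r : (ℕ → α) × (ℕ → β) → (s → α) × (s → β) := Prod.map s.restrict s.restrict
  have hr : ((Measure.infinitePi fun _ : ℕ => μ).prod (Measure.infinitePi fun _ : ℕ => ν)).map r =
      (Measure.pi fun _ : s => μ).prod (Measure.pi fun _ : s => ν) := by
    rw [← Measure.map_prod_map _ _ (Finset.measurable_restrict s) (Finset.measurable_restrict s),
      Measure.infinitePi_map_restrict, Measure.infinitePi_map_restrict]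
  have hr_meas : Measurable r :=
    (Finset.measurable_restrict s).prodMap (Finset.measurable_restrict s)
  have hT : MeasurableSet (Set.univ.pi fun i : s => t i) :=
    MeasurableSet.univ_pi fun i => ht i
  have mp := measurePreserving_arrowProdEquivProdArrow α β s (fun _ => μ) (fun _ => ν)
  have e : (fun (z : (ℕ → α) × (ℕ → β)) (i : ℕ) => (z.1 i, z.2 i)) ⁻¹' Set.pi (s : Set ℕ) t =
      r ⁻¹' ((MeasurableEquiv.arrowProdEquivProdArrow α β s).symm ⁻¹'
        (Set.univ.pi fun i : s => t i)) := by
    ext z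
    simp only [Set.mem_preimage, Set.mem_pi, Set.mem_univ, true_imp_iff, Subtype.forall]
    rfl
  rw [e, ← Measure.map_apply hr_meas ((MeasurableEquiv.measurable _) hT), hr,
    mp.symm.measure_preimage hT.nullMeasurableSet, Measure.pi_pi,
    ← Finset.prod_coe_sort s fun i => (μ.prod ν) (t i)]

/-- A function of finitely many coordinates with values in a finite set is measurable. -/
lemma measurable_of_dependsOn {A β : Type*} [Finite A] [MeasurableSpace A]
    [DiscreteMeasurableSpace A] [MeasurableSpace β] [Nonempty β] {k : ℕ} {f : (ℕ → A) → β}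
    (h : DependsOn f (Set.Iio k)) : Measurable f := by
  obtain ⟨g, rfl⟩ := dependsOn_iff_exists_comp.mp h
  exact (Measurable.of_discrete (f := g)).comp (measurable_pi_lambda _ fun i =>
    measurable_pi_apply _)

lemma integrable_of_dependsOn {A : Type*} [Finite A] [MeasurableSpace A]
    [DiscreteMeasurableSpace A] {k : ℕ} {f : (ℕ → A) → ℝ} (h : DependsOn f (Set.Iio k))
    (P : Measure (ℕ → A)) [IsProbabilityMeasure P] : Integrable f P := by
  have hm := measurable_of_dependsOn h
  obtain ⟨g, rfl⟩ := dependsOn_iff_exists_comp.mp h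
  obtain ⟨C, hC⟩ := (Set.finite_range fun u => ‖g u‖).bddAbove
  exact Integrable.of_bound hm.aestronglyMeasurable C
    (Eventually.of_forall fun y => hC ⟨_, rfl⟩)

/-- Averaging over the coordinate `k` of a function that otherwise depends on the first `k`
coordinates only. -/
lemma integral_of_dependsOn {A : Type*} [Fintype A] [MeasurableSpace A]
    [DiscreteMeasurableSpace A] (ν : Measure A) [IsProbabilityMeasure ν] {k : ℕ}
    {f : (ℕ → A) → A → ℝ} (h : ∀ a, DependsOn (fun y => f y a) (Set.Iio k)) :
    ∫ y, f y (y k) ∂(Measure.infinitePi fun _ : ℕ => ν) =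
      ∑ a, ν.real {a} * ∫ y, f y a ∂(Measure.infinitePi fun _ : ℕ => ν) := by
  classical
  set P : Measure (ℕ → A) := Measure.infinitePi fun _ : ℕ => ν
  have e : ∀ y : ℕ → A, f y (y k) = ∑ a, f y a * ({a} : Set A).indicator 1 (y k) := by
    intro y
    rw [Finset.sum_eq_single (y k)]
    · simp
    · intro a _ ha
      simp [ha.symm]
    · simp
  have hk : Measurable fun y : ℕ → A => y k := measurable_pi_apply k
  have hind : ∀ a, Measurable (({a} : Set A).indicator (1 : A → ℝ)) :=
    fun a => Measurable.of_discrete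
  have key : ∀ a, ∫ y, f y a * ({a} : Set A).indicator 1 (y k) ∂P =
      ν.real {a} * ∫ y, f y a ∂P := by
    intro a
    have hi := (indepFun_of_dependsOn ν (measurable_of_dependsOn (h a)) (h a)).comp
      measurable_id (hind a)
    have := hi.integral_fun_mul_eq_mul_integral
      (measurable_of_dependsOn (h a)).aestronglyMeasurable
      ((hind a).comp hk).aestronglyMeasurable
    simp only [Function.comp_def, id_eq] at this
    rw [this, mul_comm]
    congr 1
    have h2 : ∫ y, ({a} : Set A).indicator (1 : A → ℝ) (y k) ∂P =
        ∫ v, ({a} : Set A).indicator (1 : A → ℝ) v ∂(P.map fun y => y k) :=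
      (integral_map hk.aemeasurable (hind a).aestronglyMeasurable).symm
    rw [h2, Measure.infinitePi_map_eval, integral_indicator_one (measurableSet_singleton a)]
  simp_rw [e]
  rw [integral_finsetSum]
  · exact Finset.sum_congr rfl fun a _ => key a
  · intro a _
    refine Integrable.mul_bdd (c := 1) (integrable_of_dependsOn (h a) P)
      ((hind a).comp hk).aestronglyMeasurable (Eventually.of_forall fun y => ?_)
    simp only [Set.indicator]
    split_ifs <;> simp

variable {NH NL M : ℕ}

instance : DiscreteMeasurableSpace (User NH NL) :=
  ⟨fun _ => measurableSet_sum_iff.mpr ⟨.of_discrete, .of_discrete⟩⟩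

instance : DiscreteMeasurableSpace (Mark NH NL M) :=
  ⟨fun _ => measurableSet_sum_iff.mpr ⟨.of_discrete, .of_discrete⟩⟩

/-- The gaps between successive events. -/
def gaps (ω : Sample NH NL M) (i : ℕ) : ℝ := (ω i).1

lemma measurable_gaps : Measurable (gaps : Sample NH NL M → ℕ → ℝ) := by
  unfold gaps; fun_prop

lemma measurable_size : Measurable (size : Sample NH NL M → ℕ → ℝ) := by
  unfold size; fun_prop

lemma measurable_mark : Measurable (mark : Sample NH NL M → ℕ → Mark NH NL M) := by
  unfold mark; fun_prop

section Law

variable (B : Blockchain NH NL M) {x : Profile NH NL}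

/-- Law of the sequence of sizes. -/
def sizeSeqLaw : Measure (ℕ → ℝ) := Measure.infinitePi fun _ : ℕ => B.sizeLaw

/-- Law of the sequence of kinds of events. -/
def markSeqLaw (x : Profile NH NL) : Measure (ℕ → Mark NH NL M) :=
  Measure.infinitePi fun _ : ℕ => markLaw B x

lemma sum_rate_blocks : ∑ m, B.μ * B.α m = B.μ := by
  rw [← Finset.mul_sum, B.α_sum, mul_one]

lemma totalRate_eq (x : Profile NH NL) : totalRate B x = ∑ n, ∑ c, x n c + B.μ := by
  rw [totalRate, Fintype.sum_sum_type]
  simp only [rate]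
  rw [sum_rate_blocks, Fintype.sum_prod_type]

lemma rate_nonneg (hx : ∀ n c, 0 ≤ x n c) (a : Mark NH NL M) : 0 ≤ rate B x a := by
  rcases a with ⟨n, c⟩ | m
  · exact hx n c
  · exact mul_nonneg B.μ_pos.le (B.α_pos m).le

lemma totalRate_pos (hx : ∀ n c, 0 ≤ x n c) : 0 < totalRate B x := by
  rw [totalRate_eq]
  have : 0 ≤ ∑ n, ∑ c, x n c := Finset.sum_nonneg fun n _ => Finset.sum_nonneg fun c _ => hx n c
  linarith [B.μ_pos]

lemma markLaw_apply (hx : ∀ n c, 0 ≤ x n c) (s : Set (Mark NH NL M)) [DecidablePred (· ∈ s)] :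
    markLaw B x s = ENNReal.ofReal (∑ a, if a ∈ s then rate B x a / totalRate B x else 0) := by
  rw [markLaw, Measure.finsetSum_apply,
    ENNReal.ofReal_sum_of_nonneg]
  · refine Finset.sum_congr rfl fun a _ => ?_
    by_cases h : a ∈ s <;> simp [h]
  · intro a _
    split_ifs
    · exact div_nonneg (rate_nonneg B hx a) (totalRate_pos B hx).le
    · exact le_rfl

lemma isProbabilityMeasure_markLaw (hx : ∀ n c, 0 ≤ x n c) :
    IsProbabilityMeasure (markLaw B x) := by
  refine ⟨?_⟩
  rw [markLaw_apply B hx]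
  simp only [Set.mem_univ, if_true]
  rw [← Finset.sum_div, ← totalRate, div_self (totalRate_pos B hx).ne', ENNReal.ofReal_one]

lemma markLaw_real_singleton (hx : ∀ n c, 0 ≤ x n c) (a : Mark NH NL M) :
    (markLaw B x).real {a} = rate B x a / totalRate B x := by
  classical
  rw [Measure.real, markLaw_apply B hx, ENNReal.toReal_ofReal]
  · simp
  · simp only [Set.mem_singleton_iff, Finset.sum_ite_eq', Finset.mem_univ, if_true]
    exact div_nonneg (rate_nonneg B hx a) (totalRate_pos B hx).le

lemma isProbabilityMeasure_markSeqLaw (hx : ∀ n c, 0 ≤ x n c) :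
    IsProbabilityMeasure (markSeqLaw B x) := by
  have := isProbabilityMeasure_markLaw B hx
  unfold markSeqLaw
  infer_instance

lemma isProbabilityMeasure_sizeSeqLaw : IsProbabilityMeasure (sizeSeqLaw B) := by
  have := B.sizeLaw_prob
  unfold sizeSeqLaw
  infer_instance

/-- The process is built from independent sequences of gaps, sizes, and kinds of events. -/
lemma law_eq_map (hx : ∀ n c, 0 ≤ x n c) :
    law B x = ((gapLaw (totalRate B x)).prod ((sizeSeqLaw B).prod (markSeqLaw B x))).map
      (fun z i => (z.1 i, z.2.1 i, z.2.2 i)) := by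
  have := isProbabilityMeasure_markLaw B hx
  have := isProbabilityMeasure_expMeasure (totalRate_pos B hx)
  have := B.sizeLaw_prob
  rw [law, ← map_zip_infinitePi, ← map_zip_infinitePi]
  nth_rewrite 1 [← Measure.map_id (μ := Measure.infinitePi fun _ : ℕ => expMeasure (totalRate B x))]
  rw [Measure.map_prod_map _ _ measurable_id (by fun_prop), Measure.map_map (by fun_prop)
    (Measurable.prodMap measurable_id (by fun_prop))]
  rfl

lemma lintegral_law_mul (hx : ∀ n c, 0 ≤ x n c) {F G : (ℕ → ℝ) → ENNReal}
    {H : (ℕ → Mark NH NL M) → ENNReal} (hF : Measurable F) (hG : Measurable G)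
    (hH : Measurable H) :
    ∫⁻ ω, F (gaps ω) * (G (size ω) * H (mark ω)) ∂law B x =
      (∫⁻ g, F g ∂gapLaw (totalRate B x)) *
        ((∫⁻ s, G s ∂sizeSeqLaw B) * ∫⁻ κ, H κ ∂markSeqLaw B x) := by
  have := isProbabilityMeasure_gapLaw (totalRate_pos B hx)
  have := isProbabilityMeasure_sizeSeqLaw B
  have := isProbabilityMeasure_markSeqLaw B hx
  have h1 := hF.comp (measurable_gaps (NH := NH) (NL := NL) (M := M))
  have h2 := hG.comp (measurable_size (NH := NH) (NL := NL) (M := M))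
  have h3 := hH.comp (measurable_mark (NH := NH) (NL := NL) (M := M))
  have h4 : Measurable fun ω : Sample NH NL M => F (gaps ω) * (G (size ω) * H (mark ω)) :=
    h1.mul (h2.mul h3)
  rw [law_eq_map B hx, lintegral_map h4 (by fun_prop)]
  rw [← lintegral_prod_mul hG.aemeasurable hH.aemeasurable,
    ← lintegral_prod_mul hF.aemeasurable (by fun_prop)]
  rfl

lemma integral_law_mul (hx : ∀ n c, 0 ≤ x n c) {F G : (ℕ → ℝ) → ℝ}
    {H : (ℕ → Mark NH NL M) → ℝ} (hF : Measurable F) (hG : Measurable G)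
    (hH : Measurable H) :
    ∫ ω, F (gaps ω) * (G (size ω) * H (mark ω)) ∂law B x =
      (∫ g, F g ∂gapLaw (totalRate B x)) *
        ((∫ s, G s ∂sizeSeqLaw B) * ∫ κ, H κ ∂markSeqLaw B x) := by
  have := isProbabilityMeasure_gapLaw (totalRate_pos B hx)
  have := isProbabilityMeasure_sizeSeqLaw B
  have := isProbabilityMeasure_markSeqLaw B hx
  have h1 := hF.comp (measurable_gaps (NH := NH) (NL := NL) (M := M))
  have h2 := hG.comp (measurable_size (NH := NH) (NL := NL) (M := M))
  have h3 := hH.comp (measurable_mark (NH := NH) (NL := NL) (M := M))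
  have h4 : Measurable fun ω : Sample NH NL M => F (gaps ω) * (G (size ω) * H (mark ω)) :=
    h1.mul (h2.mul h3)
  rw [law_eq_map B hx, integral_map (Measurable.aemeasurable (by fun_prop))
    h4.aestronglyMeasurable]
  rw [← integral_prod_mul, ← integral_prod_mul]
  rfl

lemma map_gaps_law (hx : ∀ n c, 0 ≤ x n c) :
    (law B x).map gaps = gapLaw (totalRate B x) := by
  have := isProbabilityMeasure_gapLaw (totalRate_pos B hx)
  have := isProbabilityMeasure_sizeSeqLaw B
  have := isProbabilityMeasure_markSeqLaw B hx
  rw [law_eq_map B hx, Measure.map_map measurable_gaps (by fun_prop)]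
  exact measurePreserving_fst.map_eq

lemma map_size_law (hx : ∀ n c, 0 ≤ x n c) : (law B x).map size = sizeSeqLaw B := by
  have := isProbabilityMeasure_gapLaw (totalRate_pos B hx)
  have := isProbabilityMeasure_sizeSeqLaw B
  have := isProbabilityMeasure_markSeqLaw B hx
  rw [law_eq_map B hx, Measure.map_map measurable_size (by fun_prop)]
  exact (measurePreserving_fst.comp measurePreserving_snd).map_eq

lemma map_mark_law (hx : ∀ n c, 0 ≤ x n c) : (law B x).map mark = markSeqLaw B x := by
  have := isProbabilityMeasure_gapLaw (totalRate_pos B hx)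
  have := isProbabilityMeasure_sizeSeqLaw B
  have := isProbabilityMeasure_markSeqLaw B hx
  rw [law_eq_map B hx, Measure.map_map measurable_mark (by fun_prop)]
  exact (measurePreserving_snd.comp measurePreserving_snd).map_eq

lemma ae_gaps_nonneg (hx : ∀ n c, 0 ≤ x n c) : ∀ᵐ ω ∂law B x, ∀ i, 0 ≤ gaps ω i := by
  have h := ae_nonneg_gap (totalRate_pos B hx)
  rw [← map_gaps_law B hx] at h
  exact ae_of_ae_map measurable_gaps.aemeasurable h

lemma ae_size_pos (hx : ∀ n c, 0 ≤ x n c) : ∀ᵐ ω ∂law B x, ∀ j, 0 < size ω j := by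
  have := B.sizeLaw_prob
  have h : ∀ᵐ s ∂sizeSeqLaw B, ∀ j, 0 < s j := by
    rw [ae_all_iff]
    intro j
    have h := B.sizeLaw_pos
    rw [← Measure.infinitePi_map_eval (fun _ : ℕ => B.sizeLaw) j] at h
    exact ae_of_ae_map (measurable_pi_apply j).aemeasurable h
  rw [← map_size_law B hx] at h
  exact ae_of_ae_map measurable_size.aemeasurable h

/-- Almost surely only kinds of events with a positive rate occur. -/
lemma ae_rate_pos (hx : ∀ n c, 0 ≤ x n c) : ∀ᵐ κ ∂markSeqLaw B x, ∀ j, 0 < rate B x (κ j) := by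
  classical
  have := isProbabilityMeasure_markLaw B hx
  have h0 : ∀ᵐ a ∂markLaw B x, 0 < rate B x a := by
    rw [ae_iff, markLaw_apply B hx, ENNReal.ofReal_eq_zero]
    refine Finset.sum_nonpos fun a _ => ?_
    split_ifs with h
    · have : rate B x a ≤ 0 := not_lt.mp h
      exact div_nonpos_of_nonpos_of_nonneg this (totalRate_pos B hx).le
    · exact le_rfl
  rw [ae_all_iff]
  intro j
  rw [← Measure.infinitePi_map_eval (fun _ : ℕ => markLaw B x) j] at h0
  exact ae_of_ae_map (measurable_pi_apply j).aemeasurable h0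

lemma ae_law_of_ae_markSeqLaw (hx : ∀ n c, 0 ≤ x n c) {p : (ℕ → Mark NH NL M) → Prop}
    (h : ∀ᵐ κ ∂markSeqLaw B x, p κ) : ∀ᵐ ω ∂law B x, p (mark ω) := by
  rw [← map_mark_law B hx] at h
  exact ae_of_ae_map measurable_mark.aemeasurable h

/-- Mean size of a transaction. -/
def meanSize : ℝ := ∫ s, s ∂B.sizeLaw

lemma integrable_size_coord (j : ℕ) : Integrable (fun s : ℕ → ℝ => s j) (sizeSeqLaw B) := by
  have := B.sizeLaw_prob
  have h := B.sizeLaw_integrable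
  rw [← Measure.infinitePi_map_eval (fun _ : ℕ => B.sizeLaw) j] at h
  exact h.comp_measurable (measurable_pi_apply j)

lemma integral_size_coord (j : ℕ) : ∫ s, s j ∂sizeSeqLaw B = meanSize B := by
  have := B.sizeLaw_prob
  have h : Measure.map (fun s : ℕ → ℝ => s j) (sizeSeqLaw B) = B.sizeLaw :=
    Measure.infinitePi_map_eval (fun _ : ℕ => B.sizeLaw) j
  rw [meanSize]
  conv_rhs => rw [← h]
  have hm : Measurable fun s : ℕ → ℝ => s j := measurable_pi_apply j
  exact (integral_map hm.aemeasurable aestronglyMeasurable_id).symm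

lemma meanSize_pos : 0 < meanSize B := by
  have := B.sizeLaw_prob
  have h := B.sizeLaw_pos
  rw [meanSize, integral_pos_iff_support_of_nonneg_ae (h.mono fun s hs => hs.le)
    B.sizeLaw_integrable]
  have e : B.sizeLaw (Function.support fun s : ℝ => s) = 1 := by
    have hs : MeasurableSet (Function.support fun s : ℝ => s) := measurableSet_support measurable_id
    rw [← prob_compl_eq_zero_iff hs]
    refine measure_mono_null (fun s hs => ?_) (ae_iff.mp h)
    have : s = 0 := by simpa using hs
    simp [this]
  rw [e]
  exact one_pos

end Law

/-! ### The pool as a function of the kinds of events -/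

/-- The transaction that a block includes, from the identifiers and fee classes in the pool: the
head of the pool, if its fee per byte covers the storage cost per byte of one miner. -/
def served (D : Mechanism) (Cs : ℝ) (l : List (ℕ × FeeClass)) : Option (ℕ × FeeClass) :=
  (l.argmax fun r => D.fee r.2).filter fun r => decide (Cs ≤ D.fee r.2)

/-- Identifiers and fee classes of the transactions in the pool before event `j`, when the miners
play their equilibrium. In contrast to `pool`, this depends on the kinds of events only. -/
def classPool (D : Mechanism) (Cs : ℝ) (κ : ℕ → Mark NH NL M) : ℕ → List (ℕ × FeeClass)
  | 0 => []
  | j + 1 =>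
    match κ j with
    | .inl (_, c) => classPool D Cs κ j ++ [(j, c)]
    | .inr _ =>
      match served D Cs (classPool D Cs κ j) with
      | none => classPool D Cs κ j
      | some q => (classPool D Cs κ j).filter fun r => r.1 ≠ q.1

/-- Number of transactions in the pool whose class belongs to `s`. -/
def queueLen (s : Finset FeeClass) (l : List (ℕ × FeeClass)) : ℕ :=
  l.countP fun r => decide (r.2 ∈ s)

/-- If the transaction `j` of class `c` is in the pool, the number of transactions that are served
no later than it: those of a higher class, and those of its class generated no later. -/
def position (c : FeeClass) (j : ℕ) (l : List (ℕ × FeeClass)) : ℕ :=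
  if (j, c) ∈ l then l.countP fun r => decide (c < r.2 ∨ r.2 = c ∧ r.1 ≤ j) else 0

/-- Effect of an event on the number of transactions with class in `s`, if all of them are served
before all others. -/
def queueStep (s : Finset FeeClass) (n : ℕ) : Mark NH NL M → ℕ
  | .inl (_, c) => if c ∈ s then n + 1 else n
  | .inr _ => n - 1

section ClassPool

variable {D : Mechanism} {Cs : ℝ} {κ : ℕ → Mark NH NL M}

lemma dependsOn_classPool (D : Mechanism) (Cs : ℝ) (k : ℕ) :
    DependsOn (fun κ : ℕ → Mark NH NL M => classPool D Cs κ k) (Set.Iio k) := by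
  induction k with
  | zero => intro _ _ _; rfl
  | succ k ih =>
    intro κ κ' h
    have h1 : classPool D Cs κ k = classPool D Cs κ' k :=
      ih fun i hi => h i (Set.mem_Iio.mpr ((Set.mem_Iio.mp hi).trans (Nat.lt_succ_self k)))
    have h2 : κ k = κ' k := h k (Set.mem_Iio.mpr (Nat.lt_succ_self k))
    simp only [classPool, h1, h2]

lemma id_lt_of_mem_classPool {k : ℕ} {r : ℕ × FeeClass} (h : r ∈ classPool D Cs κ k) :
    r.1 < k := by
  induction k with
  | zero => simp [classPool] at h
  | succ k ih =>
    rw [classPool] at h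
    split at h
    · rcases List.mem_append.mp h with h | h
      · exact (ih h).trans (Nat.lt_succ_self k)
      · simp at h; simp [h]
    · split at h
      · exact (ih h).trans (Nat.lt_succ_self k)
      · exact (ih (List.mem_of_mem_filter h)).trans (Nat.lt_succ_self k)

lemma mark_of_mem_classPool {k : ℕ} {r : ℕ × FeeClass} (h : r ∈ classPool D Cs κ k) :
    ∃ n, κ r.1 = .inl (n, r.2) := by
  induction k with
  | zero => simp [classPool] at h
  | succ k ih =>
    rw [classPool] at h
    split at h
    next n c hc =>
      rcases List.mem_append.mp h with h | h
      · exact ih h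
      · simp only [List.mem_singleton] at h
        exact ⟨n, by rw [h, hc]⟩
    next =>
      split at h
      · exact ih h
      · exact ih (List.mem_of_mem_filter h)

lemma pairwise_classPool (k : ℕ) : (classPool D Cs κ k).Pairwise fun r r' => r.1 < r'.1 := by
  induction k with
  | zero => simp [classPool]
  | succ k ih =>
    rw [classPool]
    split
    · refine List.pairwise_append.mpr ⟨ih, List.pairwise_singleton _ _, fun r hr r' hr' => ?_⟩
      simp only [List.mem_singleton] at hr'
      rw [hr']
      exact id_lt_of_mem_classPool hr
    · split
      · exact ih
      · exact ih.filter _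

/-- The head of a pool listed in the order of generation: highest fee first, then earliest. -/
lemma argmax_spec {l : List (ℕ × FeeClass)} (hl : l.Pairwise fun r r' => r.1 < r'.1)
    {f : ℕ × FeeClass → ℝ} {q : ℕ × FeeClass} (hq : l.argmax f = some q) :
    q ∈ l ∧ ∀ r ∈ l, f r < f q ∨ f r = f q ∧ q.1 ≤ r.1 := by
  refine ⟨List.argmax_mem hq, ?_⟩
  induction l generalizing q with
  | nil => simp
  | cons a l ih =>
    rw [List.argmax_cons] at hq
    rw [List.pairwise_cons] at hl
    rcases h : l.argmax f with _ | b
    · rw [List.argmax_eq_none] at h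
      subst h
      simp only [List.argmax_nil, Option.some.injEq] at hq
      subst hq
      simp
    · have ihb := ih hl.2 h
      rw [h] at hq
      simp only at hq
      split_ifs at hq with hab
      · obtain rfl := Option.some.inj hq
        intro r hr
        rcases List.mem_cons.mp hr with rfl | hr
        · exact Or.inl hab
        · exact ihb r hr
      · obtain rfl := Option.some.inj hq
        intro r hr
        rcases List.mem_cons.mp hr with rfl | hr
        · exact Or.inr ⟨rfl, le_rfl⟩
        · have h1 := hl.1 r hr
          rcases ihb r hr with h2 | ⟨h2, -⟩
          · exact Or.inl (h2.trans_le (not_lt.mp hab))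
          · rcases (not_lt.mp hab).lt_or_eq with h3 | h3
            · exact Or.inl (h2 ▸ h3)
            · exact Or.inr ⟨h2.trans h3, h1.le⟩

lemma countP_filter_ne {l : List (ℕ × FeeClass)} (hl : l.Pairwise fun r r' => r.1 < r'.1)
    {q : ℕ × FeeClass} (hq : q ∈ l) (P : ℕ × FeeClass → Bool) :
    (l.filter fun r => r.1 ≠ q.1).countP P + (if P q then 1 else 0) = l.countP P := by
  induction l with
  | nil => simp at hq
  | cons a l ih =>
    rw [List.pairwise_cons] at hl
    rcases List.mem_cons.mp hq with rfl | hq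
    · have e : l.filter (fun r => r.1 ≠ q.1) = l :=
        List.filter_eq_self.mpr fun r hr => by simpa using (hl.1 r hr).ne'
      rw [List.filter_cons_of_neg (by simp), e, List.countP_cons]
    · have hne : a.1 ≠ q.1 := (hl.1 q hq).ne
      rw [List.filter_cons_of_pos (by simpa using hne), List.countP_cons, List.countP_cons,
        ← ih hl.2 hq]
      omega

lemma Mechanism.Feasible.fee_strictMono (hD : D.Feasible) : StrictMono D.fee := by
  intro a b h
  cases a <;> cases b <;> first | exact hD.1 | exact absurd h (by decide)

lemma served_eq_some {l : List (ℕ × FeeClass)} {q : ℕ × FeeClass} :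
    served D Cs l = some q ↔ l.argmax (fun r => D.fee r.2) = some q ∧ Cs ≤ D.fee q.2 := by
  simp [served, Option.filter_eq_some_iff]

lemma served_spec (hD : D.Feasible) {l : List (ℕ × FeeClass)}
    (hl : l.Pairwise fun r r' => r.1 < r'.1) {q : ℕ × FeeClass} (hq : served D Cs l = some q) :
    q ∈ l ∧ Cs ≤ D.fee q.2 ∧ ∀ r ∈ l, r.2 < q.2 ∨ r.2 = q.2 ∧ q.1 ≤ r.1 := by
  rw [served_eq_some] at hq
  obtain ⟨h1, h2⟩ := argmax_spec hl hq.1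
  refine ⟨h1, hq.2, fun r hr => ?_⟩
  have := h2 r hr
  rwa [hD.fee_strictMono.lt_iff_lt, hD.fee_strictMono.injective.eq_iff] at this

/-- A pool with an includable transaction has a head that is includable. -/
lemma exists_served (hD : D.Feasible) {l : List (ℕ × FeeClass)}
    {r : ℕ × FeeClass} (hr : r ∈ l) (hc : Cs ≤ D.fee r.2) :
    ∃ q, served D Cs l = some q ∧ r.2 ≤ q.2 := by
  rcases h : l.argmax (fun r => D.fee r.2) with _ | q
  · rw [List.argmax_eq_none] at h
    simp [h] at hr
  · have h1 := List.le_of_mem_argmax hr h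
    exact ⟨q, served_eq_some.mpr ⟨h, hc.trans h1⟩, hD.fee_strictMono.le_iff_le.mp h1⟩

lemma queueLen_pos_iff {s : Finset FeeClass} {l : List (ℕ × FeeClass)} :
    0 < queueLen s l ↔ ∃ r ∈ l, r.2 ∈ s := by
  simp [queueLen, List.countP_pos_iff]

/-- The number of transactions with class in an upper set of includable classes is a queue. -/
lemma queueLen_classPool_succ (hD : D.Feasible) {s : Finset FeeClass}
    (hs : IsUpperSet (s : Set FeeClass)) (hsC : ∀ c ∈ s, Cs ≤ D.fee c) (k : ℕ) :
    queueLen s (classPool D Cs κ (k + 1)) = queueStep s (queueLen s (classPool D Cs κ k)) (κ k) := by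
  have hl := pairwise_classPool (D := D) (Cs := Cs) (κ := κ) k
  rw [classPool]
  split
  next n c hc =>
    rw [hc]
    simp only [queueLen, List.countP_append, queueStep, List.countP_singleton, decide_eq_true_eq]
    split_ifs <;> simp
  next m hm =>
    rw [hm]
    simp only [queueStep]
    split
    next h =>
      have : queueLen s (classPool D Cs κ k) = 0 := by
        by_contra hne
        obtain ⟨r, hr, hrs⟩ := queueLen_pos_iff.mp (Nat.pos_of_ne_zero hne)
        obtain ⟨q, hq, -⟩ := exists_served hD hr (hsC _ hrs)
        simp [hq] at h
      omega
    next q hq =>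
      obtain ⟨hql, -, hmax⟩ := served_spec hD hl hq
      have hcount := countP_filter_ne hl hql fun r => decide (r.2 ∈ s)
      simp only [queueLen]
      by_cases hqs : q.2 ∈ s
      · simp only [hqs, decide_true, if_true] at hcount
        omega
      · have h0 : queueLen s (classPool D Cs κ k) = 0 := by
          by_contra hne
          obtain ⟨r, hr, hrs⟩ := queueLen_pos_iff.mp (Nat.pos_of_ne_zero hne)
          refine hqs (hs (a := r.2) ?_ hrs)
          rcases hmax r hr with h | h
          · exact h.le
          · exact h.1.le
        simp only [queueLen] at h0
        omega

lemma position_pos_iff {c : FeeClass} {j : ℕ} {l : List (ℕ × FeeClass)} :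
    0 < position c j l ↔ (j, c) ∈ l := by
  unfold position
  split_ifs with h
  · simp only [h, iff_true, List.countP_pos_iff]
    exact ⟨(j, c), h, by simp⟩
  · simp [h]

lemma mem_classPool_generated {j : ℕ} {n : User NH NL} {c : FeeClass} (h : κ j = .inl (n, c)) :
    (j, c) ∈ classPool D Cs κ (j + 1) := by
  rw [classPool]
  split
  next n' c' hc =>
    rw [h] at hc
    simp_all
  next hm => simp [h] at hm

lemma position_generated {j : ℕ} {n : User NH NL} {c : FeeClass} (h : κ j = .inl (n, c)) :
    position c j (classPool D Cs κ (j + 1)) =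
      queueLen (Finset.univ.filter (c ≤ ·)) (classPool D Cs κ j) + 1 := by
  have hmem := mem_classPool_generated (D := D) (Cs := Cs) h
  rw [position, if_pos hmem]
  have e : classPool D Cs κ (j + 1) = classPool D Cs κ j ++ [(j, c)] := by
    rw [classPool]
    split
    next n' c' hc => rw [h] at hc; simp_all
    next hm => simp [h] at hm
  rw [e, List.countP_append, queueLen, List.countP_singleton]
  simp only [true_and, le_refl, or_true, decide_true, if_true, Nat.add_right_cancel_iff]
  refine List.countP_congr fun r hr => ?_
  have := id_lt_of_mem_classPool hr
  simp only [decide_eq_true_eq, Finset.mem_filter, Finset.mem_univ, true_and]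
  rw [le_iff_lt_or_eq (a := c)]
  constructor
  · rintro (h | h)
    · exact Or.inl h
    · exact Or.inr h.1.symm
  · rintro (h | h)
    · exact Or.inl h
    · exact Or.inr ⟨h.symm, this.le⟩

/-- The position of an includable transaction is a walk absorbed at `0`: it moves down at every
block, and up at every generation of a transaction of a higher class. -/
lemma position_classPool_succ (hD : D.Feasible) {c : FeeClass} (hc : Cs ≤ D.fee c) {j k : ℕ}
    (hjk : j < k) :
    position c j (classPool D Cs κ (k + 1)) =
      if position c j (classPool D Cs κ k) = 0 then 0
      else queueStep (Finset.univ.filter (c < ·)) (position c j (classPool D Cs κ k)) (κ k) := by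
  have hl := pairwise_classPool (D := D) (Cs := Cs) (κ := κ) k
  by_cases hj : (j, c) ∈ classPool D Cs κ k
  · have hpos := position_pos_iff.mpr hj
    rw [if_neg hpos.ne']
    rw [classPool]
    split
    next n c' hm =>
      have : (j, c) ∈ classPool D Cs κ k ++ [(k, c')] := List.mem_append_left _ hj
      rw [hm]
      simp only [position, hj, this, if_true, queueStep, List.countP_append,
        List.countP_singleton, decide_eq_true_eq, Finset.mem_filter, Finset.mem_univ, true_and,
        not_le.mpr hjk, and_false, or_false]
      split_ifs <;> simp
    next m hm =>
      rw [hm]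
      obtain ⟨q, hq, -⟩ := exists_served hD hj hc
      obtain ⟨hql, -, hmax⟩ := served_spec hD hl hq
      rw [hq]
      simp only [queueStep]
      have hcount := countP_filter_ne hl hql fun r => decide (c < r.2 ∨ r.2 = c ∧ r.1 ≤ j)
      have hPq : c < q.2 ∨ q.2 = c ∧ q.1 ≤ j := by
        rcases hmax _ hj with h | h
        · exact Or.inl h
        · exact Or.inr ⟨h.1.symm, h.2⟩
      simp only [hPq, decide_true, if_true] at hcount
      by_cases hjq : j = q.1
      · -- the tagged transaction is the head of the pool, so nothing is ahead of it
        have hnot : (j, c) ∉ (classPool D Cs κ k).filter fun r => r.1 ≠ q.1 := by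
          simp [hjq]
        have hqc : q.2 = c := by
          obtain ⟨n, h1⟩ := mark_of_mem_classPool hj
          obtain ⟨n', h2⟩ := mark_of_mem_classPool hql
          simp only [← hjq] at h2
          rw [h1] at h2
          simpa using (congrArg (fun p => Sum.elim Prod.snd (fun _ => c) p) h2).symm
        have h0 : ((classPool D Cs κ k).filter fun r => r.1 ≠ q.1).countP
            (fun r => decide (c < r.2 ∨ r.2 = c ∧ r.1 ≤ j)) = 0 := by
          rw [List.countP_eq_zero]
          intro r hr
          rw [List.mem_filter] at hr
          have hne : r.1 ≠ q.1 := by simpa using hr.2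
          simp only [decide_eq_true_eq, not_or, not_and, not_le]
          rcases hmax r hr.1 with h | h
          · rw [hqc] at h
            exact ⟨h.not_gt, fun h' => absurd h' h.ne⟩
          · rw [hqc] at h
            exact ⟨h.1.not_gt, fun _ => by omega⟩
        rw [position, if_neg hnot, position, if_pos hj]
        omega
      · have hmem : (j, c) ∈ (classPool D Cs κ k).filter fun r => r.1 ≠ q.1 := by
          simp [hj, hjq]
        rw [position, if_pos hmem, position, if_pos hj]
        omega
  · have hpos : position c j (classPool D Cs κ k) = 0 := by
      simp [position, hj]
    rw [hpos, if_pos rfl]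
    have hnot : (j, c) ∉ classPool D Cs κ (k + 1) := by
      rw [classPool]
      split
      · simp [hj, hjk.ne]
      · split
        · exact hj
        · exact fun h => hj (List.mem_of_mem_filter h)
    simp [position, hnot]

open Classical in
/-- A block includes a transaction of the class `c` if there is one of class `c` or higher, but none
of a higher class. -/
lemma served_class (hD : D.Feasible) (c : FeeClass) (k : ℕ) :
    (if ∃ j, served D Cs (classPool D Cs κ k) = some (j, c) then (1 : ℝ) else 0) =
      if Cs ≤ D.fee c then
        LazyWalk.busy (queueLen (Finset.univ.filter (c ≤ ·)) (classPool D Cs κ k)) -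
          LazyWalk.busy (queueLen (Finset.univ.filter (c < ·)) (classPool D Cs κ k))
      else 0 := by
  have hl := pairwise_classPool (D := D) (Cs := Cs) (κ := κ) k
  set l := classPool D Cs κ k
  have hb : ∀ n, LazyWalk.busy n = if 0 < n then 1 else 0 := by
    intro n
    simp only [LazyWalk.busy, Nat.pos_iff_ne_zero]
    split_ifs <;> simp_all
  by_cases hc : Cs ≤ D.fee c
  · rw [if_pos hc, hb, hb]
    simp only [queueLen_pos_iff, Finset.mem_filter, Finset.mem_univ, true_and]
    by_cases h1 : ∃ r ∈ l, c < r.2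
    · obtain ⟨r, hr, hrc⟩ := h1
      have h2 : ∃ r ∈ l, c ≤ r.2 := ⟨r, hr, hrc.le⟩
      have h3 : ¬ ∃ j, served D Cs l = some (j, c) := by
        rintro ⟨j, hj⟩
        rcases (served_spec hD hl hj).2.2 r hr with h | h
        · exact absurd h hrc.not_gt
        · exact absurd h.1 hrc.ne'
      rw [if_neg h3, if_pos h2, if_pos ⟨r, hr, hrc⟩, sub_self]
    · rw [if_neg h1, sub_zero]
      congr 1
      refine propext ⟨?_, ?_⟩
      · rintro ⟨j, hj⟩
        exact ⟨(j, c), (served_spec hD hl hj).1, le_rfl⟩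
      · rintro ⟨r, hr, hrc⟩
        obtain ⟨q, hq, hqr⟩ := exists_served hD hr
          (hc.trans (hD.fee_strictMono.monotone hrc))
        have : q.2 = c := le_antisymm
          (not_lt.mp fun h => h1 ⟨q, (served_spec hD hl hq).1, h⟩) (hrc.trans hqr)
        exact ⟨q.1, by rw [hq, ← this]⟩
  · rw [if_neg hc, if_neg]
    rintro ⟨j, hj⟩
    exact hc (served_spec hD hl hj).2.1

end ClassPool

/-! ### The equilibrium of the miners -/

lemma roundPayoff_update_sub (B : Blockchain NH NL M) (m : Miner M) (X : Miner M → Option Tx)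
    (Y Z : Option Tx) :
    roundPayoff B m (Function.update X m Y) - roundPayoff B m (Function.update X m Z) =
      B.α m * ((selFee Y - selSize Y * B.Cs) - (selFee Z - selSize Z * B.Cs)) := by
  have h : ∀ W : Option Tx, ∑ j, B.α j * (selSize (Function.update X m W j) * B.Cs) =
      B.α m * (selSize W * B.Cs) +
        ∑ j ∈ Finset.univ.erase m, B.α j * (selSize (X j) * B.Cs) := by
    intro W
    rw [← Finset.add_sum_erase _ _ (Finset.mem_univ m), Function.update_self]
    congr 1
    refine Finset.sum_congr rfl fun j hj => ?_
    rw [Function.update_of_ne (Finset.ne_of_mem_erase hj)]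
  simp only [roundPayoff, h, Function.update_self]
  ring

/-- In equilibrium every miner selects the head of the pool exactly if its fee per byte is at
least the storage cost per byte. -/
lemma IsMinerEquilibrium.eq_filter {B : Blockchain NH NL M} {σ : MinerStrategy M}
    (hσ : IsMinerEquilibrium B σ) {Q : Pool} (hQ : ∀ q ∈ Q, 0 < q.size) (m : Miner M) :
    σ m Q = Q.head.filter fun q => decide (B.Cs ≤ q.fee) := by
  obtain ⟨⟨hsel, hnash⟩, htie⟩ := hσ Q hQ
  have hα := B.α_pos m
  rcases hh : Q.head with _ | q
  · rcases hsel m with h | h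
    · simpa using h
    · rw [hh] at h; simpa using h
  have hq : 0 < q.size := hQ q (List.argmax_mem hh)
  have self : Function.update (fun m => σ m Q) m (σ m Q) = fun m => σ m Q :=
    Function.update_eq_self m _
  have hdiff := roundPayoff_update_sub B m (fun m => σ m Q)
  by_cases hc : B.Cs ≤ q.fee
  · rw [Option.filter_some_pos (by simpa using hc)]
    rcases hsel m with h | h
    · -- selecting nothing is a best reply only if the miner is indifferent
      have h1 := hnash m Q.head (Or.inr rfl)
      have h2 := hdiff Q.head none
      have h0 : σ m Q = none := h
      have h3 : Function.update (fun m => σ m Q) m none = fun m => σ m Q := by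
        rw [← h0, self]
      have h4 : 0 ≤ B.α m * ((selFee Q.head - selSize Q.head * B.Cs) -
          (selFee none - selSize none * B.Cs)) := by
        simp only [hh, selFee, selSize, Option.elim]
        have : 0 ≤ q.size * (q.fee - B.Cs) := mul_nonneg hq.le (by linarith)
        refine mul_nonneg hα.le ?_
        linarith
      have h5 := htie m (by rw [h3] at h2 ⊢; linarith)
      rw [h5, hh]
    · exact h.trans hh
  · rw [Option.filter_some_neg (by simpa using hc)]
    rcases hsel m with h | h
    · exact h
    · exfalso
      have h1 := hnash m none (Or.inl rfl)
      have h2 := hdiff none Q.head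
      have h3 : Function.update (fun m => σ m Q) m Q.head = fun m => σ m Q := by
        rw [← show σ m Q = Q.head from h, self]
      rw [h3] at h2
      have h4 : 0 < B.α m * ((selFee none - selSize none * B.Cs) -
          (selFee Q.head - selSize Q.head * B.Cs)) := by
        simp only [hh, selFee, selSize, Option.elim]
        have : 0 < q.size * (B.Cs - q.fee) := mul_pos hq (by linarith [not_le.mp hc])
        refine mul_pos hα ?_
        linarith
      linarith

/-- The strategies in which every miner selects the head of the pool exactly if its fee per byte
is at least the storage cost per byte form an equilibrium. -/
lemma exists_isMinerEquilibrium (B : Blockchain NH NL M) :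
    ∃ σ : MinerStrategy M, IsMinerEquilibrium B σ := by
  refine ⟨fun _ Q => Q.head.filter fun q => decide (B.Cs ≤ q.fee), fun Q hQ => ?_⟩
  set S : Option Tx := Q.head.filter fun q => decide (B.Cs ≤ q.fee) with hS
  have hself : ∀ m : Miner M, Function.update (fun _ : Miner M => S) m S = fun _ => S :=
    fun m => Function.update_eq_self m _
  rcases hh : Q.head with _ | q
  · have hS0 : S = none := by rw [hS, hh]; rfl
    refine ⟨⟨fun m => Or.inl hS0, fun m Y hY => ?_⟩, fun m _ => hS0⟩
    have : Y = S := by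
      rw [hS0]
      rcases hY with h | h
      · exact h
      · rw [h, hh]
    rw [this, hself]
  have hq : 0 < q.size := hQ q (List.argmax_mem hh)
  have hval : selFee (some q) - selSize (some q) * B.Cs = q.size * (q.fee - B.Cs) := by
    simp only [selFee, selSize, Option.elim]; ring
  have hval0 : selFee none - selSize none * B.Cs = 0 := by simp [selFee, selSize]
  by_cases hc : B.Cs ≤ q.fee
  · have hS1 : S = some q := by rw [hS, hh, Option.filter_some_pos (by simpa using hc)]
    refine ⟨⟨fun m => Or.inr (hS1.trans hh.symm), fun m Y hY => ?_⟩, fun m _ => hS1⟩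
    have h := roundPayoff_update_sub B m (fun _ => S) Y S
    rw [hself] at h
    have : B.α m * ((selFee Y - selSize Y * B.Cs) - (selFee S - selSize S * B.Cs)) ≤ 0 := by
      refine mul_nonpos_of_nonneg_of_nonpos (B.α_pos m).le ?_
      rw [hS1, hval]
      rcases hY with h | h
      · rw [h, hval0]
        have : 0 ≤ q.size * (q.fee - B.Cs) := mul_nonneg hq.le (by linarith)
        linarith
      · rw [h, hh, hval]; linarith
    linarith
  · have hS1 : S = none := by rw [hS, hh, Option.filter_some_neg (by simpa using hc)]
    have hneg : q.size * (q.fee - B.Cs) < 0 :=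
      mul_neg_of_pos_of_neg hq (by linarith [not_le.mp hc])
    refine ⟨⟨fun m => Or.inl hS1, fun m Y hY => ?_⟩, fun m hm => ?_⟩
    · have h := roundPayoff_update_sub B m (fun _ => S) Y S
      rw [hself] at h
      have : B.α m * ((selFee Y - selSize Y * B.Cs) - (selFee S - selSize S * B.Cs)) ≤ 0 := by
        refine mul_nonpos_of_nonneg_of_nonpos (B.α_pos m).le ?_
        rw [hS1, hval0]
        rcases hY with h | h
        · rw [h, hval0]; linarith
        · rw [h, hh, hval]; linarith
      linarith
    · exfalso
      have h := roundPayoff_update_sub B m (fun _ => S) none (some q)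
      rw [hval0, hval] at h
      have : 0 < B.α m * (0 - q.size * (q.fee - B.Cs)) :=
        mul_pos (B.α_pos m) (by linarith)
      have hm' : roundPayoff B m (Function.update (fun _ => S) m none) =
          roundPayoff B m (Function.update (fun _ => S) m (some q)) := by
        rw [hS]; exact hm
      linarith

lemma argmax_map {α β : Type*} (f : β → ℝ) (g : α → β) (l : List α) :
    (l.map g).argmax f = (l.argmax (f ∘ g)).map g := by
  induction l with
  | nil => rfl
  | cons a l ih =>
    rw [List.map_cons, List.argmax_cons, List.argmax_cons, ih]
    rcases l.argmax (f ∘ g) with _ | b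
    · rfl
    · simp only [Option.map_some, Function.comp_apply]
      split_ifs <;> rfl

/-- The transaction with a given identifier and fee class. -/
def toTx (D : Mechanism) (ω : Sample NH NL M) (r : ℕ × FeeClass) : Tx :=
  ⟨r.1, size ω r.1, D.fee r.2⟩

section Pool

variable {B : Blockchain NH NL M} {D : Mechanism} {σ : MinerStrategy M} {ω : Sample NH NL M}

lemma IsMinerEquilibrium.apply_map (hσ : IsMinerEquilibrium B σ) (hω : ∀ j, 0 < size ω j)
    (m : Miner M) (l : List (ℕ × FeeClass)) :
    σ m (l.map (toTx D ω)) = (served D B.Cs l).map (toTx D ω) := by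
  have key : ∀ o : Option (ℕ × FeeClass), (o.map (toTx D ω)).filter
      (fun q => decide (B.Cs ≤ q.fee)) =
      (o.filter fun r => decide (B.Cs ≤ D.fee r.2)).map (toTx D ω) := by
    rintro (_ | q)
    · rfl
    · simp only [Option.map_some, Option.filter_some, toTx]
      split_ifs <;> rfl
  rw [hσ.eq_filter (fun q hq => ?_), Pool.head, argmax_map, served]
  · exact key _
  · obtain ⟨r, -, rfl⟩ := List.mem_map.mp hq
    exact hω r.1

lemma pool_eq_map (hσ : IsMinerEquilibrium B σ) (hω : ∀ j, 0 < size ω j) (k : ℕ) :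
    pool D σ ω k = (classPool D B.Cs (mark ω) k).map (toTx D ω) := by
  induction k with
  | zero => rfl
  | succ k ih =>
    rw [pool, classPool]
    rcases hm : mark ω k with ⟨n, c⟩ | m
    · simp [ih, toTx]
    · simp only
      rw [ih, hσ.apply_map hω]
      rcases served D B.Cs (classPool D B.Cs (mark ω) k) with _ | q
      · rfl
      · simp only [Option.map_some, List.filter_map]
        rfl

lemma select_eq (hσ : IsMinerEquilibrium B σ) (hω : ∀ j, 0 < size ω j) (m : Miner M) (k : ℕ) :
    σ m (pool D σ ω k) = (served D B.Cs (classPool D B.Cs (mark ω) k)).map (toTx D ω) := by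
  rw [pool_eq_map hσ hω, hσ.apply_map hω]

lemma includedAt_iff (hσ : IsMinerEquilibrium B σ) (hω : ∀ j, 0 < size ω j) {j k : ℕ} :
    IncludedAt D σ ω j k ↔ (∃ m, mark ω k = .inr m) ∧
      ∃ c, served D B.Cs (classPool D B.Cs (mark ω) k) = some (j, c) := by
  unfold IncludedAt
  simp only [select_eq hσ hω]
  constructor
  · rintro ⟨m, q, hm, hq, rfl⟩
    obtain ⟨r, hr, rfl⟩ := Option.map_eq_some_iff.mp hq
    exact ⟨⟨m, hm⟩, r.2, hr⟩
  · rintro ⟨⟨m, hm⟩, c, hc⟩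
    exact ⟨m, _, hm, by rw [hc]; rfl, rfl⟩

variable (hσ : IsMinerEquilibrium B σ) (hω : ∀ j, 0 < size ω j)
include hσ hω

lemma mem_of_includedAt (hD : D.Feasible) {j k : ℕ} {n : User NH NL} {c : FeeClass}
    (hj : mark ω j = .inl (n, c)) (h : IncludedAt D σ ω j k) :
    (j, c) ∈ classPool D B.Cs (mark ω) k ∧ B.Cs ≤ D.fee c ∧
      (j, c) ∉ classPool D B.Cs (mark ω) (k + 1) := by
  obtain ⟨⟨m, hm⟩, c', hc'⟩ := (includedAt_iff hσ hω).mp h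
  have hs := served_spec hD (pairwise_classPool k) hc'
  obtain ⟨n', hn'⟩ := mark_of_mem_classPool hs.1
  simp only [hj, Sum.inl.injEq, Prod.mk.injEq] at hn'
  obtain ⟨-, rfl⟩ := hn'
  refine ⟨hs.1, hs.2.1, ?_⟩
  rw [classPool, hm]
  simp only [hc']
  simp

lemma mem_classPool_succ_iff {j k : ℕ} (hjk : j < k) {c : FeeClass} :
    (j, c) ∈ classPool D B.Cs (mark ω) (k + 1) ↔
      (j, c) ∈ classPool D B.Cs (mark ω) k ∧ ¬ IncludedAt D σ ω j k := by
  rw [includedAt_iff hσ hω, classPool]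
  rcases hm : mark ω k with ⟨n, c'⟩ | m
  · simp [hjk.ne]
  · rcases hs : served D B.Cs (classPool D B.Cs (mark ω) k) with _ | q
    · simp
    · obtain ⟨i, d⟩ := q
      simp only [List.mem_filter, Sum.inr.injEq, exists_eq', true_and, Option.some.injEq,
        Prod.mk.injEq, exists_eq_right', decide_eq_true_eq, and_congr_right_iff]
      intro _
      exact ne_comm.trans (by simp [eq_comm])

lemma mem_classPool_of_not_included {j : ℕ} {n : User NH NL} {c : FeeClass}
    (hj : mark ω j = .inl (n, c)) (i : ℕ) (h : ∀ k, k < j + 1 + i → ¬ IncludedAt D σ ω j k) :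
    (j, c) ∈ classPool D B.Cs (mark ω) (j + 1 + i) := by
  induction i with
  | zero => exact mem_classPool_generated hj
  | succ i ih =>
    rw [← add_assoc, mem_classPool_succ_iff hσ hω (by omega)]
    exact ⟨ih fun k hk => h k (by omega), h _ (by omega)⟩

lemma not_mem_classPool_mono {j : ℕ} {c : FeeClass} {k i : ℕ} (hjk : j < k) (hki : k ≤ i)
    (h : (j, c) ∉ classPool D B.Cs (mark ω) k) : (j, c) ∉ classPool D B.Cs (mark ω) i := by
  induction i, hki using Nat.le_induction with
  | base => exact h
  | succ i hi ih =>
    rw [mem_classPool_succ_iff hσ hω (by omega)]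
    exact fun h' => ih h'.1

lemma included_iff (hD : D.Feasible) {j : ℕ} {n : User NH NL} {c : FeeClass}
    (hj : mark ω j = .inl (n, c)) :
    Included D σ ω j ↔ ∃ i, (j, c) ∉ classPool D B.Cs (mark ω) (j + 1 + i) := by
  constructor
  · rintro ⟨k, hk⟩
    have h := mem_of_includedAt hσ hω hD hj hk
    have hlt : j < k := id_lt_of_mem_classPool h.1
    exact ⟨k - j, by rw [show j + 1 + (k - j) = k + 1 by omega]; exact h.2.2⟩
  · rintro ⟨i, hi⟩
    by_contra hn
    exact hi (mem_classPool_of_not_included hσ hω hj i fun k _ hk => hn ⟨k, hk⟩)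

/-- The waiting time of an included transaction, as the sum of the gaps that end while it is in
the pool. -/
lemma waiting_eq_tsum (hD : D.Feasible) (hg : ∀ i, 0 ≤ gaps ω i) {j : ℕ} {n : User NH NL}
    {c : FeeClass} (hj : mark ω j = .inl (n, c)) (h : Included D σ ω j) :
    waiting D σ ω j = ∑' i, if (j, c) ∈ classPool D B.Cs (mark ω) (j + 1 + i) then
      ENNReal.ofReal (gaps ω (j + 1 + i)) else 0 := by
  obtain ⟨k, hk⟩ := h
  have hmem := mem_of_includedAt hσ hω hD hj hk
  have hlt : j < k := id_lt_of_mem_classPool hmem.1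
  have huniq : ∀ k', IncludedAt D σ ω j k' → k' = k := by
    intro k' hk'
    have hmem' := mem_of_includedAt hσ hω hD hj hk'
    have hlt' : j < k' := id_lt_of_mem_classPool hmem'.1
    by_contra hne
    rcases lt_or_gt_of_ne hne with h | h
    · exact not_mem_classPool_mono hσ hω (by omega) (Nat.succ_le_of_lt h) hmem'.2.2 hmem.1
    · exact not_mem_classPool_mono hσ hω (by omega) (Nat.succ_le_of_lt h) hmem.2.2 hmem'.1
  have hw : waiting D σ ω j = ENNReal.ofReal (time ω k - time ω j) := by
    unfold waiting
    refine le_antisymm (iInf₂_le k hk) (le_iInf₂ fun k' hk' => ?_)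
    rw [huniq k' hk']
  have hiff : ∀ i, (j, c) ∈ classPool D B.Cs (mark ω) (j + 1 + i) ↔ i < k - j := by
    intro i
    constructor
    · intro hi
      by_contra hge
      exact not_mem_classPool_mono hσ hω (k := k + 1) (by omega) (by omega) hmem.2.2 hi
    · intro hi
      refine mem_classPool_of_not_included hσ hω hj i fun k' hk' hinc => ?_
      have := huniq k' hinc
      omega
  have hsum : time ω k - time ω j = ∑ i ∈ Finset.range (k - j), gaps ω (j + 1 + i) := by
    have e : k + 1 = (j + 1) + (k - j) := by omega
    rw [time, time, e, Finset.sum_range_add]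
    simp only [add_sub_cancel_left]
    rfl
  rw [hw, hsum, ENNReal.ofReal_sum_of_nonneg fun i _ => hg _,
    tsum_eq_sum (s := Finset.range (k - j))]
  · refine Finset.sum_congr rfl fun i hi => ?_
    rw [if_pos ((hiff i).mpr (Finset.mem_range.mp hi))]
  · intro i hi
    rw [if_neg]
    rw [hiff]
    simpa using hi

end Pool

/-! ### Queue lengths and positions in the queue as random walks -/

/-- Total rate at which transactions with class in `s` are generated. -/
def classRate (x : Profile NH NL) (s : Finset FeeClass) : ℝ := ∑ n, ∑ c ∈ s, x n c

/-- The classes that are served no later than `c`. -/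
abbrev classesFrom (c : FeeClass) : Finset FeeClass := Finset.univ.filter (c ≤ ·)

/-- The classes that are served before `c`. -/
abbrev classesAbove (c : FeeClass) : Finset FeeClass := Finset.univ.filter (c < ·)

section Rates

variable {B : Blockchain NH NL M} {x : Profile NH NL} (hx : ∀ n, x n ∈ userStrategies B)
include hx

lemma rates_nonneg (n : User NH NL) (c : FeeClass) : 0 ≤ x n c := (hx n).2 c

lemma classRate_nonneg (s : Finset FeeClass) : 0 ≤ classRate x s :=
  Finset.sum_nonneg fun n _ => Finset.sum_nonneg fun c _ => rates_nonneg hx n c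

lemma classRate_mono {s s' : Finset FeeClass} (h : s ⊆ s') : classRate x s ≤ classRate x s' :=
  Finset.sum_le_sum fun n _ => Finset.sum_le_sum_of_subset_of_nonneg h
    fun c _ _ => rates_nonneg hx n c

lemma classRate_le (s : Finset FeeClass) : classRate x s ≤ B.μ := by
  refine (classRate_mono hx (Finset.subset_univ s)).trans ?_
  have h1 : ∀ n, ∑ c, x n c ≤ B.μ / ((NH : ℝ) + NL) := fun n => by
    rw [Fintype.sum_bool]; exact (hx n).1
  have h2 : classRate x Finset.univ ≤ ∑ _n : User NH NL, B.μ / ((NH : ℝ) + NL) :=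
    Finset.sum_le_sum fun n _ => h1 n
  refine h2.trans ?_
  simp only [Finset.sum_const, Finset.card_univ, Fintype.card_sum, Fintype.card_fin, nsmul_eq_mul,
    Nat.cast_add]
  rcases eq_or_ne ((NH : ℝ) + NL) 0 with h | h
  · rw [h, zero_mul]; exact B.μ_pos.le
  · rw [mul_div_cancel₀ _ h]

omit hx in
lemma totalRate_eq_classRate : totalRate B x = classRate x Finset.univ + B.μ := totalRate_eq B x

lemma classRate_above_add_le (n : User NH NL) (c : FeeClass) :
    classRate x (classesAbove c) + x n c ≤ B.μ := by
  refine le_trans ?_ (classRate_le hx (classesFrom c))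
  have e : classesFrom c = insert c (classesAbove c) := by
    ext d; simp [le_iff_eq_or_lt, eq_comm]
  have e2 : classRate x (classesFrom c) = ∑ n, x n c + classRate x (classesAbove c) := by
    rw [classRate, e, classRate, ← Finset.sum_add_distrib]
    refine Finset.sum_congr rfl fun n _ => Finset.sum_insert (by simp)
  rw [e2]
  have := Finset.single_le_sum (f := fun n => x n c) (fun n _ => rates_nonneg hx n c)
    (Finset.mem_univ n)
  linarith

variable (B) in
/-- The random walk of the number of transactions with class in `s`, observed at the events. -/
def walk (s : Finset FeeClass) : LazyWalk where
  up := classRate x s / totalRate B x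
  down := B.μ / totalRate B x
  stay := 1 - classRate x s / totalRate B x - B.μ / totalRate B x
  up_nonneg := div_nonneg (classRate_nonneg hx s) (totalRate_pos B (rates_nonneg hx)).le
  down_pos := div_pos B.μ_pos (totalRate_pos B (rates_nonneg hx))
  stay_nonneg := by
    have h := totalRate_pos B (rates_nonneg hx)
    rw [sub_sub, ← add_div, sub_nonneg, div_le_one h, totalRate_eq_classRate]
    linarith [classRate_mono hx (Finset.subset_univ s)]
  sum_eq := by ring
  up_le_down := by
    have h := totalRate_pos B (rates_nonneg hx)
    exact (div_le_div_iff_of_pos_right h).mpr (classRate_le hx s)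

lemma sum_rate_queueStep (s : Finset FeeClass) (f : ℕ → ℝ) (n : ℕ) :
    ∑ a : Mark NH NL M, rate B x a / totalRate B x * f (queueStep s n a) =
      (walk B hx s).refl f n := by
  have hθ := (totalRate_pos B (rates_nonneg hx)).ne'
  rw [Fintype.sum_sum_type, Fintype.sum_prod_type]
  have h1 : ∑ m, rate B x (.inr m : Mark NH NL M) / totalRate B x *
      f (queueStep s n (.inr m : Mark NH NL M)) = B.μ / totalRate B x * f (n - 1) := by
    simp only [rate, queueStep]
    rw [← Finset.sum_mul, ← Finset.sum_div, sum_rate_blocks]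
  have h2 : ∀ u : User NH NL, ∑ c, rate B x (.inl (u, c) : Mark NH NL M) / totalRate B x *
      f (queueStep s n (.inl (u, c) : Mark NH NL M)) =
      (∑ c ∈ s, x u c) / totalRate B x * f (n + 1) +
        (∑ c, x u c - ∑ c ∈ s, x u c) / totalRate B x * f n := by
    intro u
    have e : ∑ c ∈ s, x u c = ∑ c, if c ∈ s then x u c else 0 := by
      rw [Finset.sum_ite_mem, Finset.univ_inter]
    rw [e, ← Finset.sum_sub_distrib, Finset.sum_div, Finset.sum_div, Finset.sum_mul,
      Finset.sum_mul, ← Finset.sum_add_distrib]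
    refine Finset.sum_congr rfl fun c _ => ?_
    simp only [rate, queueStep]
    split_ifs <;> simp
  rw [h1, Finset.sum_congr rfl fun u _ => h2 u, Finset.sum_add_distrib, ← Finset.sum_mul,
    ← Finset.sum_mul, ← Finset.sum_div, ← Finset.sum_div, Finset.sum_sub_distrib,
    LazyWalk.refl_apply]
  have e := totalRate_eq_classRate (B := B) (x := x)
  simp only [walk]
  have e3 : ∑ u, ∑ c, x u c = totalRate B x - B.μ := by rw [e]; simp [classRate]
  rw [e3]
  simp only [classRate]
  field_simp
  ring

lemma sum_rate_eq_one : ∑ a : Mark NH NL M, rate B x a / totalRate B x = 1 := by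
  rw [← Finset.sum_div]
  exact div_self (totalRate_pos B (rates_nonneg hx)).ne'

end Rates

lemma LazyWalk.hasSum_mean (w : LazyWalk) {g : ℕ → ℕ → ℝ} {G : ℕ → ℝ}
    (h : ∀ n, HasSum (fun i => g i n) (G n)) (j : ℕ) :
    HasSum (fun i => w.mean (g i) j) (w.mean G j) := by
  induction j generalizing g G with
  | zero => simpa only [mean_zero] using h 0
  | succ j ih =>
    simp only [mean_succ]
    exact ih fun n =>
      (((h (n + 1)).mul_left _).add ((h (n - 1)).mul_left _)).add ((h n).mul_left _)

section Expectations

variable {B : Blockchain NH NL M} {D : Mechanism} {x : Profile NH NL}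
  (hx : ∀ n, x n ∈ userStrategies B)
include hx

lemma integral_markSeq {k : ℕ} {f : (ℕ → Mark NH NL M) → Mark NH NL M → ℝ}
    (h : ∀ a, DependsOn (fun y => f y a) (Set.Iio k)) :
    ∫ κ, f κ (κ k) ∂markSeqLaw B x =
      ∫ κ, ∑ a, rate B x a / totalRate B x * f κ a ∂markSeqLaw B x := by
  have := isProbabilityMeasure_markLaw B (rates_nonneg hx)
  have := isProbabilityMeasure_markSeqLaw B (rates_nonneg hx)
  rw [markSeqLaw, integral_of_dependsOn _ h, ← markSeqLaw, integral_finsetSum]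
  · refine Finset.sum_congr rfl fun a _ => ?_
    rw [integral_const_mul, markLaw_real_singleton B (rates_nonneg hx)]
  · exact fun a _ => (integrable_of_dependsOn (h a) _).const_mul _

lemma integral_queueLen (hD : D.Feasible) {s : Finset FeeClass}
    (hs : IsUpperSet (s : Set FeeClass)) (hsC : ∀ c ∈ s, B.Cs ≤ D.fee c) (f : ℕ → ℝ) (k : ℕ) :
    ∫ κ, f (queueLen s (classPool D B.Cs κ k)) ∂markSeqLaw B x = (walk B hx s).mean f k := by
  have := isProbabilityMeasure_markSeqLaw B (rates_nonneg hx)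
  induction k generalizing f with
  | zero => simp [classPool, queueLen, LazyWalk.mean_zero]
  | succ k ih =>
    simp only [queueLen_classPool_succ hD hs hsC]
    rw [integral_markSeq hx (f := fun κ a => f (queueStep s (queueLen s (classPool D B.Cs κ k)) a))]
    · simp only [sum_rate_queueStep hx]
      rw [ih, LazyWalk.mean_succ]
    · intro a κ κ' h
      simp only [dependsOn_classPool D B.Cs k h]

omit hx in
lemma isUpperSet_classesFrom (c : FeeClass) : IsUpperSet (classesFrom c : Set FeeClass) := by
  intro a b hab ha
  simp only [Finset.coe_filter, Finset.mem_univ, true_and] at ha ⊢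
  exact le_trans ha hab

omit hx in
lemma isUpperSet_classesAbove (c : FeeClass) : IsUpperSet (classesAbove c : Set FeeClass) := by
  intro a b hab ha
  simp only [Finset.coe_filter, Finset.mem_univ, true_and] at ha ⊢
  exact lt_of_lt_of_le ha hab

/-- Probability that the event `j` is the generation of a transaction of user `n` with class `c`
that is still in the pool `i` events later. -/
lemma hasSum_prob_mem_classPool (hD : D.Feasible) {c : FeeClass} (hc : B.Cs ≤ D.fee c)
    (n : User NH NL) (j : ℕ) (hν : classRate x (classesAbove c) < B.μ) :
    HasSum (fun i => ∫ κ, (if κ j = .inl (n, c) ∧ (j, c) ∈ classPool D B.Cs κ (j + 1 + i)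
        then (1 : ℝ) else 0) ∂markSeqLaw B x)
      (x n c * ((walk B hx (classesFrom c)).mean LazyWalk.len j + 1) /
        (B.μ - classRate x (classesAbove c))) := by
  classical
  have := isProbabilityMeasure_markSeqLaw B (rates_nonneg hx)
  have hθ := totalRate_pos B (rates_nonneg hx)
  set wA := walk B hx (classesAbove c)
  set wF := walk B hx (classesFrom c)
  set e : ℕ → (ℕ → ℝ) → ℝ := fun i f => ∫ κ, (if κ j = .inl (n, c) then
    f (position c j (classPool D B.Cs κ (j + 1 + i))) else 0) ∂markSeqLaw B x with he
  have step : ∀ i f, e (i + 1) f = e i (wA.absorb f) := by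
    intro i f
    have hdep : ∀ a : Mark NH NL M, DependsOn (fun κ : ℕ → Mark NH NL M => if κ j = .inl (n, c) then
        f (if position c j (classPool D B.Cs κ (j + 1 + i)) = 0 then 0 else
          queueStep (classesAbove c) (position c j (classPool D B.Cs κ (j + 1 + i))) a) else 0)
        (Set.Iio (j + 1 + i)) := by
      intro a κ κ' h
      simp only [dependsOn_classPool D B.Cs (j + 1 + i) h, h j (Set.mem_Iio.mpr (by omega))]
    have h1 : e (i + 1) f = ∫ κ, (if κ j = .inl (n, c) then
        f (if position c j (classPool D B.Cs κ (j + 1 + i)) = 0 then 0 else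
          queueStep (classesAbove c) (position c j (classPool D B.Cs κ (j + 1 + i)))
            (κ (j + 1 + i))) else 0) ∂markSeqLaw B x := by
      refine integral_congr_ae (Eventually.of_forall fun κ => ?_)
      simp only [← add_assoc]
      rw [position_classPool_succ hD hc (by omega)]
    rw [h1, integral_markSeq hx hdep]
    refine integral_congr_ae (Eventually.of_forall fun κ => ?_)
    simp only
    split_ifs with h2 h3
    · rw [← Finset.sum_mul, sum_rate_eq_one hx, one_mul, LazyWalk.absorb_apply, if_pos h3]
    · rw [LazyWalk.absorb_apply, if_neg h3, ← LazyWalk.refl_apply, ← sum_rate_queueStep hx]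
    · simp
  have iter : ∀ i f, e i f = e 0 ((wA.absorb ^ i) f) := by
    intro i
    induction i with
    | zero => simp
    | succ i ih => intro f; rw [step, ih, pow_succ]; rfl
  have start : ∀ f, e 0 f = x n c / totalRate B x * wF.mean (fun m => f (m + 1)) j := by
    intro f
    have h1 : e 0 f = ∫ κ, (if κ j = .inl (n, c) then
        f (queueLen (classesFrom c) (classPool D B.Cs κ j) + 1) else 0) ∂markSeqLaw B x := by
      refine integral_congr_ae (Eventually.of_forall fun κ => ?_)
      simp only
      split_ifs with h
      · rw [add_zero, position_generated h]
      · rfl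
    rw [h1, integral_markSeq hx (f := fun κ a => if a = .inl (n, c) then
      f (queueLen (classesFrom c) (classPool D B.Cs κ j) + 1) else 0)]
    · simp only [mul_ite, mul_zero, Finset.sum_ite_eq', Finset.mem_univ, if_true]
      rw [integral_const_mul, integral_queueLen hx hD (isUpperSet_classesFrom c)
        (fun d hd => hc.trans (hD.fee_strictMono.monotone (by simpa using hd)))
        (fun m => f (m + 1))]
      rfl
    · intro a κ κ' h
      simp only [dependsOn_classPool D B.Cs j h]
  have hlt : wA.up < wA.down := (div_lt_div_iff_of_pos_right hθ).mpr hν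
  have hsum := (wF.hasSum_mean (g := fun i m => (wA.absorb ^ i) LazyWalk.busy (m + 1))
    (fun m => LazyWalk.hasSum_absorb_busy hlt (m + 1)) j).mul_left (x n c / totalRate B x)
  have hfun : (fun i => ∫ κ, (if κ j = .inl (n, c) ∧ (j, c) ∈ classPool D B.Cs κ (j + 1 + i)
      then (1 : ℝ) else 0) ∂markSeqLaw B x) = fun i =>
      x n c / totalRate B x * wF.mean (fun m => (wA.absorb ^ i) LazyWalk.busy (m + 1)) j := by
    ext i
    rw [← start (f := (wA.absorb ^ i) LazyWalk.busy), ← iter]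
    refine integral_congr_ae (Eventually.of_forall fun κ => ?_)
    simp only [← position_pos_iff, LazyWalk.busy, Nat.pos_iff_ne_zero]
    split_ifs <;> simp_all
  have hval : x n c * (wF.mean LazyWalk.len j + 1) / (B.μ - classRate x (classesAbove c)) =
      x n c / totalRate B x * wF.mean (fun m => ((m + 1 : ℕ) : ℝ) / (wA.down - wA.up)) j := by
    have e1 : (fun m : ℕ => ((m + 1 : ℕ) : ℝ) / (wA.down - wA.up)) =
        (wA.down - wA.up)⁻¹ • (LazyWalk.len + fun _ => (1 : ℝ)) := by
      ext m
      simp only [Pi.smul_apply, Pi.add_apply, smul_eq_mul, LazyWalk.len]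
      push_cast
      rw [div_eq_inv_mul]
    rw [e1, LazyWalk.mean_smul, LazyWalk.mean_add, LazyWalk.mean_const]
    have e2 : wA.down - wA.up = (B.μ - classRate x (classesAbove c)) / totalRate B x := by
      simp only [wA, walk]; ring
    have : B.μ - classRate x (classesAbove c) ≠ 0 := by linarith
    rw [e2]
    field_simp
  rw [hfun, hval]
  exact hsum

/-- Every transaction of a class that can be served is almost surely included. -/
lemma ae_exists_not_mem_classPool (hD : D.Feasible) {c : FeeClass} (hc : B.Cs ≤ D.fee c)
    (n : User NH NL) (j : ℕ) (hν : classRate x (classesAbove c) < B.μ) :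
    ∀ᵐ κ ∂markSeqLaw B x, κ j = .inl (n, c) →
      ∃ i, (j, c) ∉ classPool D B.Cs κ (j + 1 + i) := by
  classical
  have := isProbabilityMeasure_markSeqLaw B (rates_nonneg hx)
  have hsum := hasSum_prob_mem_classPool hx hD hc n j hν
  set f : ℕ → (ℕ → Mark NH NL M) → ℝ := fun i κ =>
    if κ j = .inl (n, c) ∧ (j, c) ∈ classPool D B.Cs κ (j + 1 + i) then (1 : ℝ) else 0 with hf
  have hdep : ∀ i, DependsOn (f i) (Set.Iio (j + 1 + i)) := by
    intro i κ κ' h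
    simp only [hf, dependsOn_classPool D B.Cs (j + 1 + i) h, h j (Set.mem_Iio.mpr (by omega))]
  have h0 : Tendsto (fun i => ∫ κ, f i κ ∂markSeqLaw B x) atTop (𝓝 0) :=
    hsum.summable.tendsto_atTop_zero
  -- the event that the transaction is never included is contained in all the events summed above
  rw [ae_iff]
  set N : Set (ℕ → Mark NH NL M) :=
    {κ | ¬(κ j = .inl (n, c) → ∃ i, (j, c) ∉ classPool D B.Cs κ (j + 1 + i))} with hN
  have hle : ∀ i, (markSeqLaw B x).real N ≤ ∫ κ, f i κ ∂markSeqLaw B x := by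
    intro i
    have hfi : f i = ({κ | κ j = .inl (n, c) ∧ (j, c) ∈ classPool D B.Cs κ (j + 1 + i)} :
        Set (ℕ → Mark NH NL M)).indicator 1 := by
      ext κ; simp [hf, Set.indicator]
    have hm : MeasurableSet
        {κ : ℕ → Mark NH NL M | κ j = .inl (n, c) ∧ (j, c) ∈ classPool D B.Cs κ (j + 1 + i)} := by
      have := measurable_of_dependsOn (hdep i) (measurableSet_singleton (1 : ℝ))
      convert this using 1
      ext κ
      simp [hf]
    rw [hfi, integral_indicator_one hm]
    refine measureReal_mono fun κ hκ => ?_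
    simp only [hN, Set.mem_ofPred_eq, Classical.not_imp, not_exists, not_not] at hκ
    exact ⟨hκ.1, hκ.2 i⟩
  have h1 : (markSeqLaw B x).real N ≤ 0 := ge_of_tendsto' h0 hle
  exact (measureReal_eq_zero_iff).mp (le_antisymm h1 measureReal_nonneg)

end Expectations

/-! ### Long-run waiting times -/

lemma lintegral_arrival_mul_gap {r : ℝ} (hr : 0 < r) (t : ℝ) (j i : ℕ) :
    ∫⁻ g, (Set.Iic t).indicator 1 (arrival g j) * ENNReal.ofReal (g (j + 1 + i)) ∂gapLaw r =
      arrivalProb r t j * ENNReal.ofReal (1 / r) := by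
  have := isProbabilityMeasure_expMeasure hr
  have hd : DependsOn (fun g : ℕ → ℝ => arrival g j) (Set.Iio (j + 1 + i)) := fun _ _ h =>
    dependsOn_partialSum (j + 1) fun k hk => h k (by simp only [Set.mem_Iio] at hk ⊢; omega)
  have hind : Measurable ((Set.Iic t).indicator (1 : ℝ → ENNReal)) :=
    measurable_one.indicator measurableSet_Iic
  have hF : Measurable fun z : ℝ × ℝ =>
      (Set.Iic t).indicator (1 : ℝ → ENNReal) z.1 * ENNReal.ofReal z.2 :=
    (hind.comp measurable_fst).mul (ENNReal.measurable_ofReal.comp measurable_snd)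
  have h := lintegral_of_dependsOn (expMeasure r) (measurable_arrival j) hd hF
  simp only at h
  rw [gapLaw, h]
  have e : ∀ g : ℕ → ℝ, ∫⁻ v, (Set.Iic t).indicator (1 : ℝ → ENNReal) (arrival g j) *
      ENNReal.ofReal v ∂expMeasure r =
      {g | arrival g j ≤ t}.indicator 1 g * ENNReal.ofReal (1 / r) := by
    intro g
    rw [lintegral_const_mul _ ENNReal.measurable_ofReal, lintegral_id_expMeasure hr]
    rfl
  simp only [e]
  rw [lintegral_mul_const _ (measurable_one.indicator (measurableSet_arrival_le j t)),
    lintegral_indicator_one (measurableSet_arrival_le j t)]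
  rfl

lemma lintegral_arrival {r : ℝ} (t : ℝ) (j : ℕ) :
    ∫⁻ g, (Set.Iic t).indicator 1 (arrival g j) ∂gapLaw r = arrivalProb r t j :=
  lintegral_indicator_one (measurableSet_arrival_le j t)

lemma measurable_arrival_indicator (t : ℝ) (j : ℕ) :
    Measurable fun g => (Set.Iic t).indicator (1 : ℝ → ENNReal) (arrival g j) :=
  (measurable_one.indicator measurableSet_Iic).comp (measurable_arrival j)

section

variable {B : Blockchain NH NL M} {D : Mechanism} {σ : MinerStrategy M} {x : Profile NH NL}

/-- Limit of the mean waiting cost per unit of time of user `n`: the sum over the classes of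
`γ x W`, where `W = μ / ((μ - Λ) (μ - ν))` is the mean waiting time in a queue with preemptive
priority, `Λ` and `ν` being the rates of the classes served no later and served before; it is
infinite if `Λ` reaches the block rate. -/
def waitLimit (B : Blockchain NH NL M) (x : Profile NH NL) (n : User NH NL) : ENNReal :=
  ∑ c, ENNReal.ofReal (B.γ * x n c / (B.μ - classRate x (classesAbove c))) *
    if classRate x (classesFrom c) < B.μ then
      ENNReal.ofReal (B.μ / (B.μ - classRate x (classesFrom c))) else ⊤

open Classical in
/-- Indicator of the event that user `n` generates a transaction of class `c` at event `j` which
is still in the pool `i` events later. -/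
def stays (D : Mechanism) (Cs : ℝ) (n : User NH NL) (c : FeeClass) (j i : ℕ)
    (κ : ℕ → Mark NH NL M) : ℝ :=
  if κ j = .inl (n, c) ∧ (j, c) ∈ classPool D Cs κ (j + 1 + i) then 1 else 0

lemma dependsOn_stays (D : Mechanism) (Cs : ℝ) (n : User NH NL) (c : FeeClass) (j i : ℕ) :
    DependsOn (stays (M := M) D Cs n c j i) (Set.Iio (j + 1 + i)) := by
  intro κ κ' h
  simp only [stays, dependsOn_classPool D Cs (j + 1 + i) h, h j (Set.mem_Iio.mpr (by omega))]

lemma stays_nonneg (D : Mechanism) (Cs : ℝ) (n : User NH NL) (c : FeeClass) (j i : ℕ)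
    (κ : ℕ → Mark NH NL M) : 0 ≤ stays D Cs n c j i κ := by
  unfold stays; split_ifs <;> norm_num

variable (hx : ∀ n, x n ∈ userStrategies B)
include hx

lemma tsum_lintegral_stays (hD : D.Feasible) (n : User NH NL) (c : FeeClass)
    (hc : 0 < x n c → B.Cs ≤ D.fee c) (j : ℕ) :
    ∑' i, ∫⁻ κ, ENNReal.ofReal (stays D B.Cs n c j i κ) ∂markSeqLaw B x =
      ENNReal.ofReal (x n c * ((walk B hx (classesFrom c)).mean LazyWalk.len j + 1) /
        (B.μ - classRate x (classesAbove c))) := by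
  have := isProbabilityMeasure_markSeqLaw B (rates_nonneg hx)
  have h1 : ∀ i, ∫⁻ κ, ENNReal.ofReal (stays D B.Cs n c j i κ) ∂markSeqLaw B x =
      ENNReal.ofReal (∫ κ, stays D B.Cs n c j i κ ∂markSeqLaw B x) := fun i =>
    (ofReal_integral_eq_lintegral_ofReal (integrable_of_dependsOn (dependsOn_stays D B.Cs n c j i) _)
      (Eventually.of_forall fun κ => stays_nonneg D B.Cs n c j i κ)).symm
  simp only [h1]
  rcases (rates_nonneg hx n c).eq_or_lt with h0 | hpos
  · have h2 : ∀ i, ∫ κ, stays D B.Cs n c j i κ ∂markSeqLaw B x = 0 := by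
      intro i
      refine integral_eq_zero_of_ae ?_
      filter_upwards [ae_rate_pos B (rates_nonneg hx)] with κ hκ
      have : κ j ≠ .inl (n, c) := by
        intro h
        have := hκ j
        rw [h] at this
        simp only [rate] at this
        exact this.ne h0
      simp [stays, this]
    simp [h2, ← h0]
  · have hν : classRate x (classesAbove c) < B.μ := by
      linarith [classRate_above_add_le hx n c]
    have hsum := hasSum_prob_mem_classPool hx hD (hc hpos) n j hν
    rw [← hsum.tsum_eq, ENNReal.ofReal_tsum_of_nonneg _ hsum.summable]
    · refine tsum_congr fun i => ?_
      congr 2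
    · intro i
      exact integral_nonneg fun κ => by dsimp only [Pi.zero_apply]; split_ifs <;> norm_num

lemma lintegral_totalWaiting (hσ : IsMinerEquilibrium B σ) (hD : D.Feasible) (n : User NH NL)
    (hc : ∀ c, 0 < x n c → B.Cs ≤ D.fee c) (t : ℝ) :
    ∫⁻ ω, totalWaiting D σ n t ω ∂law B x =
      ∑' j, ∑ c, arrivalProb (totalRate B x) t j * ENNReal.ofReal (1 / totalRate B x) *
        ENNReal.ofReal (x n c * ((walk B hx (classesFrom c)).mean LazyWalk.len j + 1) /
          (B.μ - classRate x (classesAbove c))) := by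
  classical
  have hx0 := rates_nonneg hx
  have hθ := totalRate_pos B hx0
  have : IsProbabilityMeasure (sizeSeqLaw B) := isProbabilityMeasure_sizeSeqLaw B
  set T : ℕ → FeeClass → ℕ → Sample NH NL M → ENNReal := fun j c i ω =>
    ((Set.Iic t).indicator 1 (arrival (gaps ω) j) * ENNReal.ofReal (gaps ω (j + 1 + i))) *
      (1 * ENNReal.ofReal (stays D B.Cs n c j i (mark ω))) with hT
  have hmF : ∀ j i, Measurable fun g : ℕ → ℝ =>
      (Set.Iic t).indicator (1 : ℝ → ENNReal) (arrival g j) * ENNReal.ofReal (g (j + 1 + i)) :=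
    fun j i => (measurable_arrival_indicator t j).mul
      (ENNReal.measurable_ofReal.comp (measurable_pi_apply _))
  have hmH : ∀ j c i, Measurable fun κ : ℕ → Mark NH NL M =>
      ENNReal.ofReal (stays D B.Cs n c j i κ) := fun j c i =>
    (measurable_of_dependsOn (dependsOn_stays D B.Cs n c j i)).ennreal_ofReal
  have hmT : ∀ j c i, Measurable (T j c i) := fun j c i =>
    ((hmF j i).comp measurable_gaps).mul (measurable_const.mul ((hmH j c i).comp measurable_mark))
  have hint : ∀ j c i, ∫⁻ ω, T j c i ω ∂law B x =
      arrivalProb (totalRate B x) t j * ENNReal.ofReal (1 / totalRate B x) *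
        ∫⁻ κ, ENNReal.ofReal (stays D B.Cs n c j i κ) ∂markSeqLaw B x := by
    intro j c i
    rw [hT, lintegral_law_mul B hx0 (hmF j i) measurable_const (hmH j c i),
      lintegral_arrival_mul_gap hθ]
    simp
  have hae : ∀ᵐ ω ∂law B x, totalWaiting D σ n t ω = ∑' j, ∑ c, ∑' i, T j c i ω := by
    have hinc : ∀ᵐ κ ∂markSeqLaw B x, ∀ j c, 0 < x n c → κ j = .inl (n, c) →
        ∃ i, (j, c) ∉ classPool D B.Cs κ (j + 1 + i) := by
      rw [ae_all_iff]
      intro j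
      rw [ae_all_iff]
      intro c
      by_cases hpos : 0 < x n c
      · filter_upwards [ae_exists_not_mem_classPool hx hD (hc c hpos) n j
          (by linarith [classRate_above_add_le hx n c])] with κ hκ _ using hκ
      · exact Eventually.of_forall fun κ h => absurd h hpos
    filter_upwards [ae_gaps_nonneg B hx0, ae_size_pos B hx0,
      ae_law_of_ae_markSeqLaw B hx0 (ae_rate_pos B hx0),
      ae_law_of_ae_markSeqLaw B hx0 hinc] with ω hg hs hr hi
    unfold totalWaiting
    refine tsum_congr fun j => ?_
    by_cases hcond : time ω j ≤ t ∧ ∃ c, mark ω j = .inl (n, c)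
    · obtain ⟨htime, c, hm⟩ := hcond
      have hpos : 0 < x n c := by
        have := hr j
        rw [hm] at this
        exact this
      rw [if_pos ⟨htime, c, hm⟩, waiting_eq_tsum hσ hs hD hg hm
        ((included_iff hσ hs hD hm).mpr (hi j c hpos hm)), Finset.sum_eq_single c]
      · refine tsum_congr fun i => ?_
        have h1 : (Set.Iic t).indicator (1 : ℝ → ENNReal) (arrival (gaps ω) j) = 1 :=
          Set.indicator_of_mem (show arrival (gaps ω) j ∈ Set.Iic t from htime) _
        simp only [hT, h1, stays, hm, true_and]
        split_ifs <;> simp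
      · intro c' _ hc'
        have : ∀ i, T j c' i ω = 0 := by
          intro i
          have : mark ω j ≠ .inl (n, c') := by rw [hm]; simpa using hc'.symm
          simp [hT, stays, this]
        simp [this]
      · simp
    · rw [if_neg hcond]
      symm
      refine Finset.sum_eq_zero fun c _ => ?_
      have : ∀ i, T j c i ω = 0 := by
        intro i
        by_cases hm : mark ω j = .inl (n, c)
        · have ht : ¬ time ω j ≤ t := fun h => hcond ⟨h, c, hm⟩
          have h1 : (Set.Iic t).indicator (1 : ℝ → ENNReal) (arrival (gaps ω) j) = 0 :=
            Set.indicator_of_notMem (show arrival (gaps ω) j ∉ Set.Iic t from ht) _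
          simp [hT, h1]
        · simp [hT, stays, hm]
      simp [this]
  rw [lintegral_congr_ae hae, lintegral_tsum fun j =>
    (Finset.measurable_sum _ fun c _ => Measurable.tsum fun i => hmT j c i).aemeasurable]
  refine tsum_congr fun j => ?_
  rw [lintegral_finsetSum _ fun c _ => Measurable.tsum fun i => hmT j c i]
  refine Finset.sum_congr rfl fun c _ => ?_
  rw [lintegral_tsum fun i => (hmT j c i).aemeasurable]
  simp only [hint]
  rw [ENNReal.tsum_mul_left, tsum_lintegral_stays hx hD n c (hc c)]

lemma tendsto_mean_len_add_one (s : Finset FeeClass) :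
    Tendsto (fun j => ENNReal.ofReal ((walk B hx s).mean LazyWalk.len j + 1)) atTop
      (𝓝 (if classRate x s < B.μ then ENNReal.ofReal (B.μ / (B.μ - classRate x s)) else ⊤)) := by
  have hθ := totalRate_pos B (rates_nonneg hx)
  split_ifs with h
  · have hlt : (walk B hx s).up < (walk B hx s).down := (div_lt_div_iff_of_pos_right hθ).mpr h
    have h1 := (LazyWalk.tendsto_mean_len hlt).add_const 1
    have e : (walk B hx s).up / ((walk B hx s).down - (walk B hx s).up) + 1 =
        B.μ / (B.μ - classRate x s) := by
      simp only [walk]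
      have : B.μ - classRate x s ≠ 0 := by linarith
      rw [← sub_div, div_div_div_cancel_right₀ hθ.ne']
      field_simp
      ring
    rw [e] at h1
    exact ENNReal.tendsto_ofReal h1
  · have heq : (walk B hx s).up = (walk B hx s).down := by
      simp only [walk]
      rw [le_antisymm (classRate_le hx s) (not_lt.mp h)]
    exact ENNReal.tendsto_ofReal_atTop.comp
      (tendsto_atTop_add_const_right _ _ (LazyWalk.tendsto_mean_len_atTop _ heq))

/-- The waiting cost per unit of time of a user whose transactions are all includable. -/
lemma tendsto_waitingCost (hσ : IsMinerEquilibrium B σ) (hD : D.Feasible) (n : User NH NL)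
    (hc : ∀ c, 0 < x n c → B.Cs ≤ D.fee c) :
    Tendsto (fun t : ℝ => ENNReal.ofReal (B.γ / t) * ∫⁻ ω, totalWaiting D σ n t ω ∂law B x)
      atTop (𝓝 (waitLimit B x n)) := by
  have hx0 := rates_nonneg hx
  have hθ := totalRate_pos B hx0
  have hν : ∀ c, 0 ≤ B.μ - classRate x (classesAbove c) := fun c => by
    linarith [classRate_le hx (classesAbove c)]
  -- a transaction generated at event `j` starts at the position queue length plus one, and the mean
  -- number of events until its position is `0` is this position divided by the drift
  have hlim : Tendsto (fun t : ℝ => ∑ c, ENNReal.ofReal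
      (B.γ * x n c / (B.μ - classRate x (classesAbove c)) / totalRate B x) *
      (ENNReal.ofReal (1 / t) * ∑' j, arrivalProb (totalRate B x) t j *
        ENNReal.ofReal ((walk B hx (classesFrom c)).mean LazyWalk.len j + 1))) atTop
      (𝓝 (waitLimit B x n)) := by
    have e : waitLimit B x n = ∑ c, ENNReal.ofReal
        (B.γ * x n c / (B.μ - classRate x (classesAbove c)) / totalRate B x) *
        (ENNReal.ofReal (totalRate B x) * if classRate x (classesFrom c) < B.μ then
          ENNReal.ofReal (B.μ / (B.μ - classRate x (classesFrom c))) else ⊤) := by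
      refine Finset.sum_congr rfl fun c _ => ?_
      rw [← mul_assoc, ← ENNReal.ofReal_mul' hθ.le, div_mul_cancel₀ _ hθ.ne']
    rw [e]
    refine tendsto_finsetSum _ fun c _ => ?_
    refine ENNReal.Tendsto.const_mul (tendsto_timeAverage hθ ?_ (tendsto_mean_len_add_one hx _))
      (Or.inr ENNReal.ofReal_ne_top)
    intro i j hij
    exact ENNReal.ofReal_le_ofReal (by
      linarith [(walk B hx (classesFrom c)).monotone_mean LazyWalk.len_mono hij])
  refine hlim.congr' ?_
  filter_upwards [eventually_gt_atTop 0] with t ht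
  rw [lintegral_totalWaiting hx hσ hD n hc, Summable.tsum_finsetSum fun c _ => ENNReal.summable,
    Finset.mul_sum]
  refine Finset.sum_congr rfl fun c _ => ?_
  rw [← ENNReal.tsum_mul_left, ← ENNReal.tsum_mul_left, ← ENNReal.tsum_mul_left]
  refine tsum_congr fun j => ?_
  have h1 : 0 ≤ (walk B hx (classesFrom c)).mean LazyWalk.len j + 1 := by
    linarith [(walk B hx (classesFrom c)).mean_len_nonneg j]
  have h2 : ENNReal.ofReal (B.γ * x n c / (B.μ - classRate x (classesAbove c)) / totalRate B x) *
      ENNReal.ofReal (1 / t) *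
        ENNReal.ofReal ((walk B hx (classesFrom c)).mean LazyWalk.len j + 1) =
      ENNReal.ofReal (B.γ / t) * ENNReal.ofReal (1 / totalRate B x) *
        ENNReal.ofReal (x n c * ((walk B hx (classesFrom c)).mean LazyWalk.len j + 1) /
          (B.μ - classRate x (classesAbove c))) := by
    have hγ := B.γ_pos
    rw [← ENNReal.ofReal_mul' (by positivity), ← ENNReal.ofReal_mul' h1,
      ← ENNReal.ofReal_mul' (by positivity),
      ← ENNReal.ofReal_mul' (div_nonneg (mul_nonneg (hx0 n c) h1) (hν c))]
    congr 1
    simp only [div_eq_mul_inv]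
    ring
  calc _ = arrivalProb (totalRate B x) t j *
        (ENNReal.ofReal (B.γ * x n c / (B.μ - classRate x (classesAbove c)) / totalRate B x) *
        ENNReal.ofReal (1 / t) *
        ENNReal.ofReal ((walk B hx (classesFrom c)).mean LazyWalk.len j + 1)) := by ring
    _ = _ := by rw [h2]; ring

/-- A user who generates transactions that miners refuse has an infinite waiting cost. -/
lemma lintegral_totalWaiting_eq_top (hσ : IsMinerEquilibrium B σ) (hD : D.Feasible)
    {n : User NH NL} {c : FeeClass} (hpos : 0 < x n c) (hc : D.fee c < B.Cs) {t : ℝ}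
    (ht : 0 < t) : ∫⁻ ω, totalWaiting D σ n t ω ∂law B x = ⊤ := by
  classical
  have hx0 := rates_nonneg hx
  have hθ := totalRate_pos B hx0
  have hprobS : IsProbabilityMeasure (sizeSeqLaw B) := isProbabilityMeasure_sizeSeqLaw B
  have hprobK := isProbabilityMeasure_markLaw B hx0
  obtain ⟨j, hj⟩ : ∃ j, arrivalProb (totalRate B x) t j ≠ 0 := by
    by_contra! h
    have h1 := tsum_arrivalProb hθ t
    simp only [h, tsum_zero] at h1
    have : 0 < ENNReal.ofReal (totalRate B x * t) := by
      rw [ENNReal.ofReal_pos]; positivity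
    exact this.ne h1
  set H : (ℕ → Mark NH NL M) → ENNReal := fun κ => ({.inl (n, c)} : Set (Mark NH NL M)).indicator
    1 (κ j) with hH
  have hmH0 : Measurable (({.inl (n, c)} : Set (Mark NH NL M)).indicator (1 : Mark NH NL M → ENNReal)) :=
    Measurable.of_discrete
  have hmH : Measurable H := hmH0.comp (measurable_pi_apply j)
  have hHint : ∫⁻ κ, H κ ∂markSeqLaw B x = ENNReal.ofReal (x n c / totalRate B x) := by
    have h1 : ∫⁻ κ, H κ ∂markSeqLaw B x = ∫⁻ a, ({.inl (n, c)} : Set (Mark NH NL M)).indicator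
        (1 : Mark NH NL M → ENNReal) a ∂((markSeqLaw B x).map fun κ => κ j) :=
      (lintegral_map hmH0 (measurable_pi_apply j)).symm
    have h2 : (markSeqLaw B x).map (fun κ => κ j) = markLaw B x :=
      Measure.infinitePi_map_eval (fun _ : ℕ => markLaw B x) j
    rw [h1, h2, lintegral_indicator_one (measurableSet_singleton _), markLaw_apply B hx0]
    simp [rate]
  have hle : ∀ᵐ ω ∂law B x, ⊤ * ((Set.Iic t).indicator 1 (arrival (gaps ω) j) *
      (1 * H (mark ω))) ≤ totalWaiting D σ n t ω := by
    filter_upwards [ae_size_pos B hx0] with ω hs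
    by_cases h1 : time ω j ≤ t
    · by_cases h2 : mark ω j = .inl (n, c)
      · have hw : waiting D σ ω j = ⊤ := by
          unfold waiting
          simp only [iInf_eq_top]
          intro k hk
          exact absurd (mem_of_includedAt hσ hs hD h2 hk).2.1 (not_le.mpr hc)
        have : totalWaiting D σ n t ω = ⊤ := by
          unfold totalWaiting
          refine ENNReal.tsum_eq_top_of_eq_top ⟨j, ?_⟩
          rw [if_pos ⟨h1, c, h2⟩, hw]
        rw [this]
        exact le_top
      · simp [hH, h2]
    · have h3 : (Set.Iic t).indicator (1 : ℝ → ENNReal) (arrival (gaps ω) j) = 0 :=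
        Set.indicator_of_notMem (show arrival (gaps ω) j ∉ Set.Iic t from h1) _
      simp [h3]
  have hm : Measurable fun ω : Sample NH NL M =>
      (Set.Iic t).indicator (1 : ℝ → ENNReal) (arrival (gaps ω) j) * (1 * H (mark ω)) :=
    ((measurable_arrival_indicator t j).comp measurable_gaps).mul
      (measurable_const.mul (hmH.comp measurable_mark))
  refine eq_top_iff.mpr (le_trans ?_ (lintegral_mono_ae hle))
  rw [lintegral_const_mul _ hm, lintegral_law_mul B hx0 (measurable_arrival_indicator t j)
    measurable_const hmH, lintegral_arrival, hHint, ENNReal.top_mul]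
  simp only [lintegral_const, measure_univ, mul_one, one_mul]
  refine mul_ne_zero hj ?_
  rw [ENNReal.ofReal_ne_zero_iff]
  positivity

end

/-! ### Long-run monetary payoffs -/

lemma summable_arrivalProb {r : ℝ} (hr : 0 < r) (t : ℝ) :
    Summable fun k => (arrivalProb r t k).toReal :=
  ENNReal.summable_toReal (by rw [tsum_arrivalProb hr]; exact ENNReal.ofReal_ne_top)

lemma tsum_arrivalProb_toReal {r : ℝ} (hr : 0 < r) {t : ℝ} (ht : 0 ≤ t) :
    ∑' k, (arrivalProb r t k).toReal = r * t := by
  rw [← ENNReal.tsum_toReal_eq fun k => ne_top_of_le_ne_top ENNReal.one_ne_top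
    (arrivalProb_le_one hr t k), tsum_arrivalProb hr, ENNReal.toReal_ofReal (by positivity)]

lemma tendsto_timeAverage_real {r : ℝ} (hr : 0 < r) {a : ℕ → ℝ} (ha : Monotone a)
    (h0 : ∀ k, 0 ≤ a k) {L : ℝ} (hL : Tendsto a atTop (𝓝 L)) :
    Tendsto (fun t : ℝ => (∑' k, (arrivalProb r t k).toReal * a k) / t) atTop (𝓝 (r * L)) := by
  have hL0 : 0 ≤ L := ge_of_tendsto' hL h0
  have h := tendsto_timeAverage hr (fun i j hij => ENNReal.ofReal_le_ofReal (ha hij))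
    (ENNReal.tendsto_ofReal hL)
  rw [← ENNReal.ofReal_mul hr.le] at h
  have h2 := (ENNReal.tendsto_toReal ENNReal.ofReal_ne_top).comp h
  rw [ENNReal.toReal_ofReal (by positivity)] at h2
  refine h2.congr' ?_
  filter_upwards [eventually_gt_atTop 0] with t ht
  have hne : ∀ k, arrivalProb r t k * ENNReal.ofReal (a k) ≠ ⊤ := fun k =>
    ENNReal.mul_ne_top (ne_top_of_le_ne_top ENNReal.one_ne_top (arrivalProb_le_one hr t k))
      ENNReal.ofReal_ne_top
  simp only [Function.comp_apply]
  rw [ENNReal.toReal_mul, ENNReal.tsum_toReal_eq hne, ENNReal.toReal_ofReal (by positivity)]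
  simp only [ENNReal.toReal_mul, ENNReal.toReal_ofReal (h0 _)]
  ring

section

variable {B : Blockchain NH NL M} {D : Mechanism} {σ : MinerStrategy M} {x : Profile NH NL}

lemma integral_arrival (r t : ℝ) (k : ℕ) :
    ∫ g, (Set.Iic t).indicator (1 : ℝ → ℝ) (arrival g k) ∂gapLaw r = (arrivalProb r t k).toReal :=
  integral_indicator_one (measurableSet_arrival_le k t)

lemma measurable_arrival_indicator_real (t : ℝ) (k : ℕ) :
    Measurable fun g => (Set.Iic t).indicator (1 : ℝ → ℝ) (arrival g k) :=
  (measurable_one.indicator measurableSet_Iic).comp (measurable_arrival k)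

lemma integrable_arrival_indicator {r : ℝ} (hr : 0 < r) (t : ℝ) (k : ℕ) :
    Integrable (fun g => (Set.Iic t).indicator (1 : ℝ → ℝ) (arrival g k)) (gapLaw r) := by
  have := isProbabilityMeasure_gapLaw hr
  refine Integrable.of_bound (measurable_arrival_indicator_real t k).aestronglyMeasurable 1
    (Eventually.of_forall fun g => ?_)
  simp only [Set.indicator]
  split_ifs <;> simp

lemma integrable_law_mul (hx0 : ∀ n c, 0 ≤ x n c) {F G : (ℕ → ℝ) → ℝ}
    {H : (ℕ → Mark NH NL M) → ℝ} (hF : Measurable F) (hG : Measurable G) (hH : Measurable H)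
    (iF : Integrable F (gapLaw (totalRate B x))) (iG : Integrable G (sizeSeqLaw B))
    (iH : Integrable H (markSeqLaw B x)) :
    Integrable (fun ω => F (gaps ω) * (G (size ω) * H (mark ω))) (law B x) := by
  have := isProbabilityMeasure_gapLaw (totalRate_pos B hx0)
  have := isProbabilityMeasure_sizeSeqLaw B
  have := isProbabilityMeasure_markSeqLaw B hx0
  have h4 : Measurable fun ω : Sample NH NL M => F (gaps ω) * (G (size ω) * H (mark ω)) :=
    (hF.comp measurable_gaps).mul ((hG.comp measurable_size).mul (hH.comp measurable_mark))
  rw [law_eq_map B hx0, integrable_map_measure h4.aestronglyMeasurable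
    (Measurable.aemeasurable (by fun_prop))]
  exact iF.mul_prod (iG.mul_prod iH)

/-- Expected sum over the events in `[0, t]` of contributions that are affine in the sizes, with
uniformly bounded coefficients that depend on the kinds of events. -/
lemma integral_tsum_events (hx0 : ∀ n c, 0 ≤ x n c) {H0 : ℕ → (ℕ → Mark NH NL M) → ℝ}
    {H : ℕ → ℕ → (ℕ → Mark NH NL M) → ℝ} (hm0 : ∀ k, Measurable (H0 k))
    (hm : ∀ k i, Measurable (H k i)) {C : ℝ} (hC0 : ∀ k κ, |H0 k κ| ≤ C)
    (hC : ∀ k κ, ∑ i ∈ Finset.range (k + 1), |H k i κ| ≤ C) (t : ℝ) :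
    ∫ ω, ∑' k, (Set.Iic t).indicator 1 (arrival (gaps ω) k) *
        (H0 k (mark ω) + ∑ i ∈ Finset.range (k + 1), size ω i * H k i (mark ω)) ∂law B x =
      ∑' k, (arrivalProb (totalRate B x) t k).toReal *
        (∫ κ, H0 k κ ∂markSeqLaw B x +
          meanSize B * ∫ κ, ∑ i ∈ Finset.range (k + 1), H k i κ ∂markSeqLaw B x) := by
  have := isProbabilityMeasure_sizeSeqLaw B
  have := isProbabilityMeasure_markSeqLaw B hx0
  have hθ := totalRate_pos B hx0
  have iF := integrable_arrival_indicator hθ t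
  have mF := measurable_arrival_indicator_real t
  have i0 : ∀ k, Integrable (H0 k) (markSeqLaw B x) := fun k =>
    Integrable.of_bound (hm0 k).aestronglyMeasurable C (Eventually.of_forall fun κ => hC0 k κ)
  have iH : ∀ k, ∀ i ∈ Finset.range (k + 1), Integrable (H k i) (markSeqLaw B x) := fun k i hi =>
    Integrable.of_bound (hm k i).aestronglyMeasurable C (Eventually.of_forall fun κ =>
      (Finset.single_le_sum (f := fun i => |H k i κ|) (fun _ _ => abs_nonneg _) hi).trans (hC k κ))
  have ms : ∀ i : ℕ, Measurable fun s : ℕ → ℝ => s i := fun i => measurable_pi_apply i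
  set F : ℕ → Sample NH NL M → ℝ := fun k ω => (Set.Iic t).indicator 1 (arrival (gaps ω) k) *
    (H0 k (mark ω) + ∑ i ∈ Finset.range (k + 1), size ω i * H k i (mark ω)) with hF
  have split : ∀ k ω, F k ω =
      (Set.Iic t).indicator 1 (arrival (gaps ω) k) * ((fun _ => (1 : ℝ)) (size ω) * H0 k (mark ω)) +
      ∑ i ∈ Finset.range (k + 1), (Set.Iic t).indicator 1 (arrival (gaps ω) k) *
        (size ω i * H k i (mark ω)) := by
    intro k ω
    simp only [hF, one_mul, mul_add, Finset.mul_sum]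
  have iT0 : ∀ k, Integrable (fun ω => (Set.Iic t).indicator (1 : ℝ → ℝ) (arrival (gaps ω) k) *
      ((fun _ => (1 : ℝ)) (size ω) * H0 k (mark ω))) (law B x) := fun k =>
    integrable_law_mul hx0 (mF k) measurable_const (hm0 k) (iF k) (integrable_const _) (i0 k)
  have iT : ∀ k, ∀ i ∈ Finset.range (k + 1), Integrable (fun ω =>
      (Set.Iic t).indicator (1 : ℝ → ℝ) (arrival (gaps ω) k) *
      (size ω i * H k i (mark ω))) (law B x) := fun k i hi =>
    integrable_law_mul hx0 (mF k) (ms i) (hm k i) (iF k) (integrable_size_coord B i) (iH k i hi)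
  have iFk : ∀ k, Integrable (F k) (law B x) := by
    intro k
    simp only [funext (split k)]
    exact (iT0 k).add (integrable_finsetSum _ (iT k))
  have val : ∀ k, ∫ ω, F k ω ∂law B x = (arrivalProb (totalRate B x) t k).toReal *
      (∫ κ, H0 k κ ∂markSeqLaw B x +
        meanSize B * ∫ κ, ∑ i ∈ Finset.range (k + 1), H k i κ ∂markSeqLaw B x) := by
    intro k
    simp only [split]
    rw [integral_add (iT0 k) (integrable_finsetSum _ (iT k)), integral_finsetSum _ (iT k),
      integral_law_mul B hx0 (mF k) measurable_const (hm0 k), integral_arrival,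
      integral_finsetSum _ (iH k), mul_add, Finset.mul_sum, Finset.mul_sum]
    congr 1
    · simp
    · refine Finset.sum_congr rfl fun i _ => ?_
      rw [integral_law_mul B hx0 (mF k) (ms i) (hm k i), integral_arrival, integral_size_coord]
  have bound : ∀ k, ∫ ω, ‖F k ω‖ ∂law B x ≤
      (arrivalProb (totalRate B x) t k).toReal * (C + (∫ s, |s| ∂B.sizeLaw) * C) := by
    intro k
    have jT0 : Integrable (fun ω => (Set.Iic t).indicator (1 : ℝ → ℝ) (arrival (gaps ω) k) *
        ((fun _ => (1 : ℝ)) (size ω) * |H0 k (mark ω)|)) (law B x) :=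
      integrable_law_mul hx0 (mF k) measurable_const ((hm0 k).abs) (iF k) (integrable_const _)
        (i0 k).abs
    have jT : ∀ i ∈ Finset.range (k + 1), Integrable (fun ω =>
        (Set.Iic t).indicator (1 : ℝ → ℝ) (arrival (gaps ω) k) *
        (|size ω i| * |H k i (mark ω)|)) (law B x) := fun i hi =>
      integrable_law_mul hx0 (mF k) ((ms i).abs) ((hm k i).abs) (iF k)
        (integrable_size_coord B i).abs (iH k i hi).abs
    have hle : ∀ ω, ‖F k ω‖ ≤
        (Set.Iic t).indicator 1 (arrival (gaps ω) k) *
          ((fun _ => (1 : ℝ)) (size ω) * |H0 k (mark ω)|) +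
        ∑ i ∈ Finset.range (k + 1), (Set.Iic t).indicator 1 (arrival (gaps ω) k) *
          (|size ω i| * |H k i (mark ω)|) := by
      intro ω
      have hind : 0 ≤ (Set.Iic t).indicator (1 : ℝ → ℝ) (arrival (gaps ω) k) :=
        Set.indicator_nonneg (fun _ _ => zero_le_one) _
      rw [split]
      refine (norm_add_le _ _).trans (add_le_add ?_ ((norm_sum_le _ _).trans
        (Finset.sum_le_sum fun i _ => ?_)))
      · rw [Real.norm_eq_abs, abs_mul, abs_mul, abs_of_nonneg hind]; simp
      · rw [Real.norm_eq_abs, abs_mul, abs_mul, abs_of_nonneg hind]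
    have hsize : ∀ i : ℕ, ∫ s : ℕ → ℝ, |s i| ∂sizeSeqLaw B = ∫ s, |s| ∂B.sizeLaw := by
      intro i
      have := B.sizeLaw_prob
      have h : Measure.map (fun s : ℕ → ℝ => s i) (sizeSeqLaw B) = B.sizeLaw :=
        Measure.infinitePi_map_eval (fun _ : ℕ => B.sizeLaw) i
      conv_rhs => rw [← h]
      exact (integral_map (ms i).aemeasurable
        (measurable_id.abs : Measurable fun s : ℝ => |s|).aestronglyMeasurable).symm
    refine (integral_mono (iFk k).norm (jT0.add (integrable_finsetSum _ jT)) hle).trans ?_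
    simp only [Pi.add_apply]
    rw [integral_add jT0 (integrable_finsetSum _ jT), integral_finsetSum _ jT,
      integral_law_mul B hx0 (mF k) measurable_const ((hm0 k).abs), integral_arrival]
    have h1 : ∀ i ∈ Finset.range (k + 1), ∫ ω, (Set.Iic t).indicator (1 : ℝ → ℝ)
        (arrival (gaps ω) k) * (|size ω i| * |H k i (mark ω)|) ∂law B x =
        (arrivalProb (totalRate B x) t k).toReal * ((∫ s, |s| ∂B.sizeLaw) *
          ∫ κ, |H k i κ| ∂markSeqLaw B x) := fun i _ => by
      rw [integral_law_mul B hx0 (mF k) ((ms i).abs) ((hm k i).abs), integral_arrival, hsize]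
    rw [Finset.sum_congr rfl h1, ← Finset.mul_sum, ← Finset.mul_sum, ← mul_add,
      ← integral_finsetSum _ fun i hi => (iH k i hi).abs]
    have h2 : ∫ κ, |H0 k κ| ∂markSeqLaw B x ≤ C := by
      refine (integral_mono (i0 k).abs (integrable_const C) fun κ => hC0 k κ).trans ?_
      simp
    have h3 : ∫ κ, ∑ i ∈ Finset.range (k + 1), |H k i κ| ∂markSeqLaw B x ≤ C := by
      refine (integral_mono (integrable_finsetSum _ fun i hi => (iH k i hi).abs)
        (integrable_const C) fun κ => hC k κ).trans ?_
      simp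
    have h4 : 0 ≤ ∫ s, |s| ∂B.sizeLaw := integral_nonneg fun s => abs_nonneg s
    simp only [integral_const, probReal_univ, smul_eq_mul, mul_one, one_mul]
    gcongr
  have hsum : Summable fun k => ∫ ω, ‖F k ω‖ ∂law B x :=
    Summable.of_nonneg_of_le (fun k => integral_nonneg fun ω => norm_nonneg _) bound
      ((summable_arrivalProb hθ t).mul_right _)
  rw [← (hasSum_integral_of_summable_integral_norm iFk hsum).tsum_eq]
  exact tsum_congr val

/-- Monetary payoff of user `n` per unit of time. -/
def gain (B : Blockchain NH NL M) (D : Mechanism) (x : Profile NH NL) (n : User NH NL) : ℝ :=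
  ∑ l, ∑ c, if B.Cs ≤ D.fee c then x l c * (if l = n then
    utility B n - meanSize B * D.fee c - ∑ i ∈ Finset.univ.erase n, D.tax n i else D.tax l n) else 0

variable (hx : ∀ n, x n ∈ userStrategies B)
include hx

lemma integral_mark_apply (f : Mark NH NL M → ℝ) (k : ℕ) :
    ∫ κ, f (κ k) ∂markSeqLaw B x = ∑ a, rate B x a / totalRate B x * f a := by
  have := isProbabilityMeasure_markSeqLaw B (rates_nonneg hx)
  rw [integral_markSeq hx (f := fun _ a => f a) fun a _ _ _ => rfl]
  simp

lemma integral_money (hσ : IsMinerEquilibrium B σ) (hD : D.Feasible) (n : User NH NL)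
    {t : ℝ} (ht : 0 ≤ t) : ∫ ω, money B D σ n t ω ∂law B x = t * gain B D x n := by
  classical
  have hx0 := rates_nonneg hx
  have hθ := totalRate_pos B hx0
  -- the payoff from an included transaction of size `s` is `A + s * F`
  set A : Mark NH NL M → ℝ := fun a => Sum.elim (fun p => if B.Cs ≤ D.fee p.2 then
    (if p.1 = n then utility B n - ∑ i ∈ Finset.univ.erase n, D.tax n i else D.tax p.1 n) else 0)
    (fun _ => 0) a with hA
  set F : Mark NH NL M → ℝ := fun a => Sum.elim (fun p => if B.Cs ≤ D.fee p.2 then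
    (if p.1 = n then -D.fee p.2 else 0) else 0) (fun _ => 0) a with hF
  have hdet : ∀ᵐ κ ∂markSeqLaw B x, ∀ j l c, κ j = .inl (l, c) → B.Cs ≤ D.fee c →
      ∃ i, (j, c) ∉ classPool D B.Cs κ (j + 1 + i) := by
    have h : ∀ᵐ κ ∂markSeqLaw B x, ∀ j, ∀ (l : User NH NL) (c : FeeClass), 0 < x l c →
        B.Cs ≤ D.fee c → κ j = .inl (l, c) → ∃ i, (j, c) ∉ classPool D B.Cs κ (j + 1 + i) := by
      rw [ae_all_iff]; intro j
      rw [ae_all_iff]; intro l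
      rw [ae_all_iff]; intro c
      by_cases hpos : 0 < x l c
      · by_cases hc : B.Cs ≤ D.fee c
        · filter_upwards [ae_exists_not_mem_classPool hx hD hc l j
            (by linarith [classRate_above_add_le hx l c])] with κ hκ _ _ using hκ
        · exact Eventually.of_forall fun κ _ h => absurd h hc
      · exact Eventually.of_forall fun κ h => absurd h hpos
    filter_upwards [h, ae_rate_pos B hx0] with κ hκ hr j l c hm hc
    refine hκ j l c ?_ hc hm
    have := hr j
    rw [hm] at this
    exact this
  have hae : ∀ᵐ ω ∂law B x, money B D σ n t ω =
      ∑' k, (Set.Iic t).indicator 1 (arrival (gaps ω) k) *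
        (A (mark ω k) + ∑ i ∈ Finset.range (k + 1), size ω i *
          (if i = k then F (mark ω k) else 0)) := by
    filter_upwards [ae_size_pos B hx0, ae_law_of_ae_markSeqLaw B hx0 hdet] with ω hs hd
    unfold money
    refine tsum_congr fun k => ?_
    have e : ∑ i ∈ Finset.range (k + 1), size ω i * (if i = k then F (mark ω k) else 0) =
        size ω k * F (mark ω k) := by
      rw [Finset.sum_eq_single k (fun i _ hi => by simp [hi]) (fun h => by simp at h)]
      simp
    rw [e]
    by_cases htime : time ω k ≤ t
    · have h1 : (Set.Iic t).indicator (1 : ℝ → ℝ) (arrival (gaps ω) k) = 1 :=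
        Set.indicator_of_mem (show arrival (gaps ω) k ∈ Set.Iic t from htime) _
      rw [h1, one_mul]
      rcases hm : mark ω k with ⟨l, c⟩ | m
      · have hinc : Included D σ ω k ↔ B.Cs ≤ D.fee c := by
          constructor
          · rintro ⟨i, hi⟩
            exact (mem_of_includedAt hσ hs hD hm hi).2.1
          · intro hc
            exact (included_iff hσ hs hD hm).mpr (hd k l c hm hc)
        simp only [htime, true_and, hinc, transfer, hA, hF, Sum.elim_inl]
        split_ifs <;> ring
      · simp [transfer, hA, hF]
    · have h1 : (Set.Iic t).indicator (1 : ℝ → ℝ) (arrival (gaps ω) k) = 0 :=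
        Set.indicator_of_notMem (show arrival (gaps ω) k ∉ Set.Iic t from htime) _
      rw [h1, zero_mul, if_neg fun h => htime h.1]
  rw [integral_congr_ae hae]
  have hmeas : ∀ (f : Mark NH NL M → ℝ) (k : ℕ), Measurable fun κ : ℕ → Mark NH NL M => f (κ k) :=
    fun f k => (Measurable.of_discrete (f := f)).comp (measurable_pi_apply k)
  have hbd : ∀ f : Mark NH NL M → ℝ, ∀ a, |f a| ≤ ∑ a, |f a| := fun f a =>
    Finset.single_le_sum (f := fun a => |f a|) (fun _ _ => abs_nonneg _) (Finset.mem_univ a)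
  rw [integral_tsum_events hx0 (H0 := fun k κ => A (κ k))
    (H := fun k i κ => if i = k then F (κ k) else 0) (fun k => hmeas A k) (fun k i => ?_)
    (C := ∑ a, |A a| + ∑ a, |F a|) (fun k κ => ?_) (fun k κ => ?_) t]
  · have e : ∀ k, (∫ κ, A (κ k) ∂markSeqLaw B x + meanSize B *
        ∫ κ, ∑ i ∈ Finset.range (k + 1), (if i = k then F (κ k) else 0) ∂markSeqLaw B x) =
        gain B D x n / totalRate B x := by
      intro k
      have h1 : ∀ κ : ℕ → Mark NH NL M, ∑ i ∈ Finset.range (k + 1),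
          (if i = k then F (κ k) else 0) = F (κ k) := fun κ => by
        rw [Finset.sum_eq_single k (fun i _ hi => by simp [hi]) (fun h => by simp at h)]
        simp
      simp only [h1]
      rw [integral_mark_apply hx, integral_mark_apply hx, Finset.mul_sum, ← Finset.sum_add_distrib,
        gain, Finset.sum_div, Fintype.sum_sum_type, Fintype.sum_prod_type]
      have h2 : ∀ m : Miner M, rate B x (.inr m : Mark NH NL M) / totalRate B x *
          A (.inr m) + meanSize B * (rate B x (.inr m : Mark NH NL M) / totalRate B x *
          F (.inr m)) = 0 := fun m => by simp [hA, hF]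
      rw [Finset.sum_congr rfl fun m _ => h2 m, Finset.sum_const_zero, add_zero]
      refine Finset.sum_congr rfl fun l _ => ?_
      rw [Finset.sum_div]
      refine Finset.sum_congr rfl fun c _ => ?_
      simp only [rate, hA, hF, Sum.elim_inl]
      split_ifs <;> ring
    simp only [e]
    rw [tsum_mul_right, tsum_arrivalProb_toReal hθ ht]
    field_simp
  · by_cases h : i = k
    · simp only [h, if_true]; exact hmeas F k
    · simp only [h, if_false]; exact measurable_const
  · have h1 : 0 ≤ ∑ a, |F a| := Finset.sum_nonneg fun _ _ => abs_nonneg _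
    linarith [hbd A (κ k)]
  · have h0 : 0 ≤ ∑ a, |A a| := Finset.sum_nonneg fun _ _ => abs_nonneg _
    rw [Finset.sum_eq_single k (fun i _ hi => by simp [hi]) (fun h => by simp at h)]
    simp only [if_true]
    linarith [hbd F (κ k)]

/-- The long-run payoff of user `n`: his monetary payoff minus his waiting cost, which is infinite
if he generates transactions that the miners refuse. -/
def payoff (B : Blockchain NH NL M) (D : Mechanism) (x : Profile NH NL) (n : User NH NL) : EReal :=
  open Classical in
  if ∃ c, 0 < x n c ∧ D.fee c < B.Cs then ⊥ else (gain B D x n : EReal) - (waitLimit B x n : EReal)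

lemma tendsto_userAverage (hσ : IsMinerEquilibrium B σ) (hD : D.Feasible) (n : User NH NL) :
    Tendsto (userAverage B D σ x n) atTop (𝓝 (payoff B D x n)) := by
  have hmoney : ∀ t : ℝ, 0 < t → (∫ ω, money B D σ n t ω ∂law B x) / t = gain B D x n :=
    fun t ht => by rw [integral_money hx hσ hD n ht.le]; field_simp
  unfold payoff
  split_ifs with h
  · obtain ⟨c, hpos, hc⟩ := h
    refine tendsto_const_nhds.congr' ?_
    filter_upwards [eventually_gt_atTop 0] with t ht
    rw [userAverage, lintegral_totalWaiting_eq_top hx hσ hD hpos hc ht, ENNReal.mul_top]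
    · simp
    · rw [ENNReal.ofReal_ne_zero_iff]
      exact div_pos B.γ_pos ht
  · have hc : ∀ c, 0 < x n c → B.Cs ≤ D.fee c := fun c hpos =>
      not_lt.mp fun hlt => h ⟨c, hpos, hlt⟩
    have h1 := (continuous_coe_ennreal_ereal.tendsto _).comp (tendsto_waitingCost hx hσ hD n hc)
    have h2 : Tendsto (fun w : EReal => (gain B D x n : EReal) - w) (𝓝 (waitLimit B x n : EReal))
        (𝓝 ((gain B D x n : EReal) - (waitLimit B x n : EReal))) := by
      simp only [sub_eq_add_neg]
      have := (EReal.continuousAt_add (p := ((gain B D x n : EReal), -(waitLimit B x n : EReal)))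
        (Or.inl (EReal.coe_ne_top _)) (Or.inl (EReal.coe_ne_bot _)))
      exact Tendsto.comp (f := fun w : EReal => ((gain B D x n : EReal), -w)) this
        ((continuous_const.prodMk continuous_neg).tendsto _)
    refine (h2.comp h1).congr' ?_
    filter_upwards [eventually_gt_atTop 0] with t ht
    simp only [Function.comp_apply, userAverage, hmoney t ht]

lemma userPayoff_eq (hσ : IsMinerEquilibrium B σ) (hD : D.Feasible) (n : User NH NL) :
    userPayoff B D σ x n = payoff B D x n :=
  (tendsto_userAverage hx hσ hD n).limUnder_eq

end

/-! ### Long-run payoffs of the miners -/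

section

variable {B : Blockchain NH NL M} {D : Mechanism} {σ : MinerStrategy M} {x : Profile NH NL}

/-- The long-run payoff of miner `m`: every includable transaction is eventually included, whatever
the load, so the rate of inclusion is the rate of generation. -/
def minerLimit (B : Blockchain NH NL M) (D : Mechanism) (x : Profile NH NL) (m : Miner M) : ℝ :=
  meanSize B * ∑ c, if B.Cs ≤ D.fee c then (B.α m * D.fee c - B.Cs) * ∑ n, x n c else 0

lemma classRate_from_sub_above (x : Profile NH NL) (c : FeeClass) :
    classRate x (classesFrom c) - classRate x (classesAbove c) = ∑ n, x n c := by
  have e : classesFrom c = insert c (classesAbove c) := by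
    ext d; simp [le_iff_eq_or_lt, eq_comm]
  rw [sub_eq_iff_eq_add, e, classRate, classRate, ← Finset.sum_add_distrib]
  exact Finset.sum_congr rfl fun n _ => Finset.sum_insert (by simp)

lemma roundPayoff_const (m : Miner M) (X : Option Tx) :
    roundPayoff B m (fun _ => X) = B.α m * selFee X - selSize X * B.Cs := by
  rw [roundPayoff, ← Finset.sum_mul, B.α_sum, one_mul]

variable (hx : ∀ n, x n ∈ userStrategies B)
include hx

lemma tendsto_minerAverage (hσ : IsMinerEquilibrium B σ) (hD : D.Feasible) (m : Miner M) :
    Tendsto (minerAverage B D σ x m) atTop (𝓝 (minerLimit B D x m)) := by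
  classical
  have hx0 := rates_nonneg hx
  have hθ := totalRate_pos B hx0
  have := isProbabilityMeasure_markSeqLaw B hx0
  set β : FeeClass → ℝ := fun c => B.α m * D.fee c - B.Cs with hβ
  -- the payoff at event `k` per unit of size of the transaction `i`: nonzero only if event `k` is a
  -- block that includes `i`
  set H : ℕ → ℕ → (ℕ → Mark NH NL M) → ℝ := fun k i κ => if ∃ m', κ k = .inr m' then
    ∑ c, β c * (if served D B.Cs (classPool D B.Cs κ k) = some (i, c) then 1 else 0) else 0 with hH
  have hdep : ∀ k i, DependsOn (H k i) (Set.Iio (k + 1)) := by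
    intro k i κ κ' h
    have h1 : classPool D B.Cs κ k = classPool D B.Cs κ' k :=
      dependsOn_classPool D B.Cs k fun j hj => h j (Set.mem_Iio.mpr
        ((Set.mem_Iio.mp hj).trans (Nat.lt_succ_self k)))
    simp only [hH, h1, h k (Set.mem_Iio.mpr (Nat.lt_succ_self k))]
  have hlt : ∀ κ : ℕ → Mark NH NL M, ∀ k i c,
      served D B.Cs (classPool D B.Cs κ k) = some (i, c) → i < k := fun κ k i c h =>
    id_lt_of_mem_classPool (r := (i, c)) (served_spec hD (pairwise_classPool k) h).1
  have hone : ∀ κ : ℕ → Mark NH NL M, ∀ k c, ∑ i ∈ Finset.range (k + 1),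
      (if served D B.Cs (classPool D B.Cs κ k) = some (i, c) then (1 : ℝ) else 0) =
      if ∃ i, served D B.Cs (classPool D B.Cs κ k) = some (i, c) then 1 else 0 := by
    intro κ k c
    split_ifs with h
    · obtain ⟨i, hi⟩ := h
      rw [Finset.sum_eq_single i]
      · rw [if_pos hi]
      · intro i' _ hne
        rw [if_neg]
        rw [hi]
        simpa using hne.symm
      · intro hi'
        simp only [Finset.mem_range] at hi'
        have := hlt κ k i c hi
        omega
    · exact Finset.sum_eq_zero fun i _ => if_neg fun hi => h ⟨i, hi⟩
  have hbound : ∀ k κ, ∑ i ∈ Finset.range (k + 1), |H k i κ| ≤ ∑ c, |β c| := by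
    intro k κ
    have h1 : ∀ i, |H k i κ| ≤ ∑ c, |β c| *
        (if served D B.Cs (classPool D B.Cs κ k) = some (i, c) then 1 else 0) := by
      intro i
      simp only [hH]
      split_ifs
      · refine (Finset.abs_sum_le_sum_abs _ _).trans (Finset.sum_le_sum fun c _ => ?_)
        rw [abs_mul]
        split_ifs <;> simp
      · rw [abs_zero]
        exact Finset.sum_nonneg fun c _ => mul_nonneg (abs_nonneg _) (by split_ifs <;> norm_num)
    refine (Finset.sum_le_sum fun i _ => h1 i).trans ?_
    rw [Finset.sum_comm]
    refine Finset.sum_le_sum fun c _ => ?_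
    rw [← Finset.mul_sum, hone]
    refine mul_le_of_le_one_right (abs_nonneg _) ?_
    split_ifs <;> norm_num
  have hae : ∀ t, ∀ᵐ ω ∂law B x, (∑' k, (if time ω k ≤ t ∧ ∃ i, mark ω k = .inr i then
      roundPayoff B m (fun i => σ i (pool D σ ω k)) else 0)) =
      ∑' k, (Set.Iic t).indicator 1 (arrival (gaps ω) k) *
        ((fun _ _ => (0 : ℝ)) k (mark ω) +
          ∑ i ∈ Finset.range (k + 1), size ω i * H k i (mark ω)) := by
    intro t
    filter_upwards [ae_size_pos B hx0] with ω hs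
    refine tsum_congr fun k => ?_
    rw [zero_add]
    by_cases htime : time ω k ≤ t
    · have h1 : (Set.Iic t).indicator (1 : ℝ → ℝ) (arrival (gaps ω) k) = 1 :=
        Set.indicator_of_mem (show arrival (gaps ω) k ∈ Set.Iic t from htime) _
      rw [h1, one_mul]
      simp only [htime, true_and, select_eq hσ hs, hH]
      split_ifs with hblock
      · rw [roundPayoff_const]
        rcases hserved : served D B.Cs (classPool D B.Cs (mark ω) k) with _ | ⟨j, c⟩
        · simp [selFee, selSize]
        · have hj := hlt _ _ _ _ hserved
          rw [Finset.sum_eq_single j]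
          · rw [Finset.sum_eq_single c]
            · simp only [Option.map_some, selFee, selSize, toTx, Option.elim, hβ, if_true]
              ring
            · intro c' _ hc'
              rw [if_neg (by simpa using hc'.symm), mul_zero]
            · simp
          · intro i _ hi
            refine mul_eq_zero_of_right _ (Finset.sum_eq_zero fun c' _ => ?_)
            rw [if_neg (by simp [hi.symm]), mul_zero]
          · intro h
            simp only [Finset.mem_range] at h
            omega
      · simp
    · have h1 : (Set.Iic t).indicator (1 : ℝ → ℝ) (arrival (gaps ω) k) = 0 :=
        Set.indicator_of_notMem (show arrival (gaps ω) k ∉ Set.Iic t from htime) _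
      rw [h1, zero_mul, if_neg fun h => htime h.1]
  -- a block serves class `c` exactly if the queue of the classes from `c` on is nonempty, but that of
  -- the classes above `c` is empty
  set hF : FeeClass → ℕ → ℝ := fun c k => (walk B hx (classesFrom c)).mean LazyWalk.busy k with hhF
  set hA : FeeClass → ℕ → ℝ := fun c k => (walk B hx (classesAbove c)).mean LazyWalk.busy k with hhA
  have hser : ∀ c k, ∫ κ, (if ∃ i, served D B.Cs (classPool D B.Cs κ k) = some (i, c)
      then (1 : ℝ) else 0) ∂markSeqLaw B x = if B.Cs ≤ D.fee c then hF c k - hA c k else 0 := by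
    intro c k
    have e : ∀ κ : ℕ → Mark NH NL M,
        (if ∃ i, served D B.Cs (classPool D B.Cs κ k) = some (i, c) then (1 : ℝ) else 0) =
        if B.Cs ≤ D.fee c then
          LazyWalk.busy (queueLen (classesFrom c) (classPool D B.Cs κ k)) -
            LazyWalk.busy (queueLen (classesAbove c) (classPool D B.Cs κ k))
        else 0 := fun κ => by
      have := served_class (Cs := B.Cs) (κ := κ) hD c k
      convert this
    simp only [e]
    split_ifs with hc
    · have dep : ∀ s : Finset FeeClass, DependsOn (fun κ : ℕ → Mark NH NL M =>
          LazyWalk.busy (queueLen s (classPool D B.Cs κ k))) (Set.Iio k) := fun s κ κ' h => by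
        simp only [dependsOn_classPool D B.Cs k h]
      rw [integral_sub (integrable_of_dependsOn (dep _) _) (integrable_of_dependsOn (dep _) _),
        integral_queueLen hx hD (isUpperSet_classesFrom c), integral_queueLen hx hD
        (isUpperSet_classesAbove c)]
      · intro d hd
        exact hc.trans (hD.fee_strictMono.monotone (by simpa using le_of_lt (by simpa using hd)))
      · intro d hd
        exact hc.trans (hD.fee_strictMono.monotone (by simpa using hd))
    · simp
  have hval : ∀ k, ∫ κ, ∑ i ∈ Finset.range (k + 1), H k i κ ∂markSeqLaw B x =
      ∑ c, (if B.Cs ≤ D.fee c then B.μ / totalRate B x * β c else 0) * (hF c k - hA c k) := by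
    intro k
    have e : ∀ κ : ℕ → Mark NH NL M, ∑ i ∈ Finset.range (k + 1), H k i κ =
        (fun κ a => if ∃ m' : Miner M, a = (Sum.inr m' : Mark NH NL M) then ∑ c, β c *
          (if ∃ i, served D B.Cs (classPool D B.Cs κ k) = some (i, c) then 1 else 0) else 0)
          κ (κ k) := by
      intro κ
      simp only [hH]
      split_ifs
      · rw [Finset.sum_comm]
        exact Finset.sum_congr rfl fun c _ => by rw [← Finset.mul_sum, hone]
      · simp
    simp only [e]
    rw [integral_markSeq hx (f := fun κ a => if ∃ m' : Miner M, a = (Sum.inr m' : Mark NH NL M)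
      then ∑ c, β c * (if ∃ i, served D B.Cs (classPool D B.Cs κ k) = some (i, c) then 1 else 0)
      else 0)]
    · have e2 : ∀ κ : ℕ → Mark NH NL M, ∑ a, rate B x a / totalRate B x *
          (if ∃ m' : Miner M, a = (Sum.inr m' : Mark NH NL M) then ∑ c, β c *
          (if ∃ i, served D B.Cs (classPool D B.Cs κ k) = some (i, c) then 1 else 0) else 0) =
          ∑ c, B.μ / totalRate B x * β c *
          (if ∃ i, served D B.Cs (classPool D B.Cs κ k) = some (i, c) then 1 else 0) := by
        intro κ
        rw [Fintype.sum_sum_type]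
        simp only [reduceCtorEq, exists_false, if_false, mul_zero, Finset.sum_const_zero, zero_add,
          Sum.inr.injEq, exists_eq', if_true, rate]
        rw [← Finset.sum_mul, ← Finset.sum_div, sum_rate_blocks, Finset.mul_sum]
        exact Finset.sum_congr rfl fun c _ => by ring
      simp only [e2]
      rw [integral_finsetSum]
      · refine Finset.sum_congr rfl fun c _ => ?_
        rw [integral_const_mul, hser]
        split_ifs <;> simp
      · intro c _
        refine (integrable_of_dependsOn (k := k) (fun κ κ' h => ?_) _).const_mul _
        simp only [dependsOn_classPool D B.Cs k h]
    · intro a κ κ' h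
      simp only [dependsOn_classPool D B.Cs k h]
  have havg : ∀ t, minerAverage B D σ x m t = ∑ c, meanSize B *
      (if B.Cs ≤ D.fee c then B.μ / totalRate B x * β c else 0) *
      ((∑' k, (arrivalProb (totalRate B x) t k).toReal * hF c k) / t -
        (∑' k, (arrivalProb (totalRate B x) t k).toReal * hA c k) / t) := by
    intro t
    have h1 : minerAverage B D σ x m t = (∫ ω, ∑' k, (Set.Iic t).indicator 1
        (arrival (gaps ω) k) * ((fun _ _ => (0 : ℝ)) k (mark ω) +
          ∑ i ∈ Finset.range (k + 1), size ω i * H k i (mark ω)) ∂law B x) / t := by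
      rw [minerAverage, ← integral_congr_ae (hae t)]
    have hsm : ∀ s : Finset FeeClass, Summable fun k =>
        (arrivalProb (totalRate B x) t k).toReal * (walk B hx s).mean LazyWalk.busy k := fun s =>
      Summable.of_nonneg_of_le
        (fun k => mul_nonneg ENNReal.toReal_nonneg (LazyWalk.mean_busy_nonneg _ k))
        (fun k => mul_le_of_le_one_right ENNReal.toReal_nonneg (LazyWalk.mean_busy_le_one _ k))
        (summable_arrivalProb hθ t)
    rw [h1, integral_tsum_events hx0 (fun _ => measurable_const)
      (fun k i => measurable_of_dependsOn (hdep k i)) (C := ∑ c, |β c|) (fun _ _ => by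
        rw [abs_zero]; exact Finset.sum_nonneg fun _ _ => abs_nonneg _) hbound t]
    have h2 : ∀ k, (arrivalProb (totalRate B x) t k).toReal * (∫ _, (0 : ℝ) ∂markSeqLaw B x +
        meanSize B * ∫ κ, ∑ i ∈ Finset.range (k + 1), H k i κ ∂markSeqLaw B x) =
        ∑ c, meanSize B * (if B.Cs ≤ D.fee c then B.μ / totalRate B x * β c else 0) *
          ((arrivalProb (totalRate B x) t k).toReal * hF c k -
            (arrivalProb (totalRate B x) t k).toReal * hA c k) := by
      intro k
      rw [hval, integral_zero, zero_add, Finset.mul_sum, Finset.mul_sum]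
      exact Finset.sum_congr rfl fun c _ => by ring
    simp only [h2]
    rw [Summable.tsum_finsetSum fun c _ => ((hsm _).sub (hsm _)).mul_left _, Finset.sum_div]
    refine Finset.sum_congr rfl fun c _ => ?_
    rw [tsum_mul_left, (hsm _).tsum_sub (hsm _)]
    ring
  have hlim : ∀ s : Finset FeeClass, Tendsto (fun t : ℝ =>
      (∑' k, (arrivalProb (totalRate B x) t k).toReal * (walk B hx s).mean LazyWalk.busy k) / t)
      atTop (𝓝 (totalRate B x * (classRate x s / B.μ))) := by
    intro s
    have h := tendsto_timeAverage_real hθ ((walk B hx s).monotone_mean LazyWalk.busy_mono)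
      (walk B hx s).mean_busy_nonneg (walk B hx s).tendsto_mean_busy
    have e : (walk B hx s).up / (walk B hx s).down = classRate x s / B.μ := by
      simp only [walk]
      rw [div_div_div_cancel_right₀ hθ.ne']
    rwa [e] at h
  have e : minerLimit B D x m = ∑ c, meanSize B *
      (if B.Cs ≤ D.fee c then B.μ / totalRate B x * β c else 0) *
      (totalRate B x * (classRate x (classesFrom c) / B.μ) -
        totalRate B x * (classRate x (classesAbove c) / B.μ)) := by
    rw [minerLimit, Finset.mul_sum]
    refine Finset.sum_congr rfl fun c _ => ?_
    have hμ := B.μ_pos.ne'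
    split_ifs
    · rw [← classRate_from_sub_above]
      simp only [hβ]
      field_simp
    · ring
  rw [e]
  simp only [funext havg]
  exact tendsto_finsetSum _ fun c _ => ((hlim _).sub (hlim _)).const_mul _

lemma minerPayoff_eq (hσ : IsMinerEquilibrium B σ) (hD : D.Feasible) (m : Miner M) :
    minerPayoff B D σ x m = minerLimit B D x m :=
  (tendsto_minerAverage hx hσ hD m).limUnder_eq

end

/-! ### Payoffs and social welfare in closed form -/

/-- Total rate of transactions with the high fee. -/
def highLoad (x : Profile NH NL) : ℝ := ∑ n, x n true

/-- Total rate of transactions. -/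
def load (x : Profile NH NL) : ℝ := ∑ n, (x n true + x n false)

lemma classRate_from_true (x : Profile NH NL) : classRate x (classesFrom true) = highLoad x := by
  have : classesFrom true = {true} := by decide
  simp [classRate, highLoad, this]

lemma classRate_from_false (x : Profile NH NL) : classRate x (classesFrom false) = load x := by
  have : classesFrom false = Finset.univ := by decide
  rw [classRate, load, this]
  exact Finset.sum_congr rfl fun n _ => Fintype.sum_bool _

lemma classRate_above_true (x : Profile NH NL) : classRate x (classesAbove true) = 0 := by
  have : classesAbove true = ∅ := by decide
  simp [classRate, this]

lemma classRate_above_false (x : Profile NH NL) : classRate x (classesAbove false) = highLoad x := by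
  have : classesAbove false = {true} := by decide
  simp [classRate, highLoad, this]

/-- The transactions that user `n` generates are includable and have a finite mean waiting time. -/
def IsStable (B : Blockchain NH NL M) (D : Mechanism) (x : Profile NH NL) (n : User NH NL) : Prop :=
  (0 < x n true → B.Cs ≤ D.ρhigh ∧ highLoad x < B.μ) ∧
    (0 < x n false → B.Cs ≤ D.ρlow ∧ load x < B.μ)

/-- Waiting cost per unit of time of user `n`. -/
def waitCost (B : Blockchain NH NL M) (x : Profile NH NL) (n : User NH NL) : ℝ :=
  B.γ * (x n true / (B.μ - highLoad x) +
    x n false * (B.μ / ((B.μ - highLoad x) * (B.μ - load x))))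

/-- Social welfare as a function of the total rates of the users. -/
def welfare (B : Blockchain NH NL M) (r : User NH NL → ℝ) : ℝ :=
  ∑ n, (utility B n - M * B.Cs * meanSize B) * r n -
    B.γ * (∑ n, r n) / (B.μ - ∑ n, r n)

lemma coe_sum_ereal {ι : Type*} (s : Finset ι) (f : ι → ℝ) :
    ((∑ i ∈ s, f i : ℝ) : EReal) = ∑ i ∈ s, (f i : EReal) :=
  map_sum (⟨⟨Real.toEReal, EReal.coe_zero⟩, EReal.coe_add⟩ : ℝ →+ EReal) f s

section

variable {B : Blockchain NH NL M} {D : Mechanism} {σ : MinerStrategy M} {x : Profile NH NL}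
  (hx : ∀ n, x n ∈ userStrategies B)
include hx

lemma highLoad_le_load : highLoad x ≤ load x :=
  Finset.sum_le_sum fun n _ => by linarith [(hx n).2 false]

lemma load_le : load x ≤ B.μ := by
  rw [← classRate_from_false]; exact classRate_le hx _

lemma waitLimit_of_isStable {n : User NH NL} (h : IsStable B D x n) :
    waitLimit B x n = ENNReal.ofReal (waitCost B x n) := by
  have hμ := B.μ_pos
  have hγ := B.γ_pos
  have h1 := highLoad_le_load hx
  have h2 := load_le hx
  have x1 := (hx n).2 true
  have x0 := (hx n).2 false
  have t1 : ENNReal.ofReal (B.γ * x n true / (B.μ - 0)) *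
      (if highLoad x < B.μ then ENNReal.ofReal (B.μ / (B.μ - highLoad x)) else ⊤) =
      ENNReal.ofReal (B.γ * (x n true / (B.μ - highLoad x))) := by
    rcases x1.eq_or_lt with hz | hp
    · simp [← hz]
    · have hh := (h.1 hp).2
      rw [if_pos hh, ← ENNReal.ofReal_mul (by positivity)]
      congr 1
      have : B.μ - highLoad x ≠ 0 := by linarith
      have := hμ.ne'
      rw [sub_zero]
      field_simp
  have t0 : ENNReal.ofReal (B.γ * x n false / (B.μ - highLoad x)) *
      (if load x < B.μ then ENNReal.ofReal (B.μ / (B.μ - load x)) else ⊤) =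
      ENNReal.ofReal (B.γ * (x n false * (B.μ / ((B.μ - highLoad x) * (B.μ - load x))))) := by
    rcases x0.eq_or_lt with hz | hp
    · simp [← hz]
    · have hh := (h.2 hp).2
      have : 0 ≤ B.μ - highLoad x := by linarith
      rw [if_pos hh, ← ENNReal.ofReal_mul (by positivity)]
      congr 1
      have : B.μ - highLoad x ≠ 0 := by linarith
      have : B.μ - load x ≠ 0 := by linarith
      field_simp
  have n1 : 0 ≤ x n true / (B.μ - highLoad x) := div_nonneg x1 (by linarith)
  have n0 : 0 ≤ x n false * (B.μ / ((B.μ - highLoad x) * (B.μ - load x))) :=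
    mul_nonneg x0 (div_nonneg hμ.le (mul_nonneg (by linarith) (by linarith)))
  rw [waitLimit, Fintype.sum_bool, classRate_from_true, classRate_from_false,
    classRate_above_true, classRate_above_false, t1, t0, waitCost, mul_add,
    ENNReal.ofReal_add (by positivity) (by positivity)]

lemma waitCost_nonneg (n : User NH NL) : 0 ≤ waitCost B x n := by
  have hμ := B.μ_pos
  have hγ := B.γ_pos
  have h1 := highLoad_le_load hx
  have h2 := load_le hx
  have n1 : 0 ≤ x n true / (B.μ - highLoad x) := div_nonneg ((hx n).2 true) (by linarith)
  have n0 : 0 ≤ x n false * (B.μ / ((B.μ - highLoad x) * (B.μ - load x))) :=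
    mul_nonneg ((hx n).2 false) (div_nonneg hμ.le (mul_nonneg (by linarith) (by linarith)))
  unfold waitCost
  positivity

lemma payoff_of_isStable {n : User NH NL} (h : IsStable B D x n) :
    payoff B D x n = ((gain B D x n - waitCost B x n : ℝ) : EReal) := by
  have h1 : ¬ ∃ c, 0 < x n c ∧ D.fee c < B.Cs := by
    rintro ⟨_ | _, hp, hc⟩
    · exact (h.2 hp).1.not_gt hc
    · exact (h.1 hp).1.not_gt hc
  rw [payoff, if_neg h1, waitLimit_of_isStable hx h,
    EReal.coe_ennreal_ofReal, max_eq_left (waitCost_nonneg hx n), EReal.coe_sub]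

lemma payoff_of_not_isStable {n : User NH NL} (h : ¬ IsStable B D x n) :
    payoff B D x n = ⊥ := by
  have hμ := B.μ_pos
  have hγ := B.γ_pos
  unfold payoff
  split_ifs with h1
  · rfl
  have top : waitLimit B x n = ⊤ := by
    obtain ⟨c, hp, hc⟩ : ∃ c, 0 < x n c ∧ ¬ classRate x (classesFrom c) < B.μ := by
      by_contra! hcon
      refine h ⟨fun hp => ⟨?_, ?_⟩, fun hp => ⟨?_, ?_⟩⟩
      · exact not_lt.mp fun hlt => h1 ⟨true, hp, hlt⟩
      · rw [← classRate_from_true]; exact hcon true hp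
      · exact not_lt.mp fun hlt => h1 ⟨false, hp, hlt⟩
      · rw [← classRate_from_false]; exact hcon false hp
    rw [waitLimit, ENNReal.sum_eq_top]
    refine ⟨c, Finset.mem_univ c, ?_⟩
    rw [if_neg hc, ENNReal.mul_top]
    rw [ENNReal.ofReal_ne_zero_iff]
    have := classRate_above_add_le hx n c
    exact div_pos (by positivity) (by linarith)
  rw [top]
  simp

omit hx in
lemma sum_minerLimit (B : Blockchain NH NL M) (D : Mechanism) (x : Profile NH NL) :
    ∑ m, minerLimit B D x m =
      ∑ n, ∑ c, if B.Cs ≤ D.fee c then x n c * (meanSize B * (D.fee c - M * B.Cs)) else 0 := by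
  simp only [minerLimit]
  rw [← Finset.mul_sum, Finset.sum_comm, Finset.mul_sum, Finset.sum_comm (γ := User NH NL)]
  refine Finset.sum_congr rfl fun c _ => ?_
  split_ifs
  · rw [← Finset.sum_mul, Finset.sum_sub_distrib, ← Finset.sum_mul, B.α_sum, ← Finset.sum_mul]
    simp only [Finset.sum_const, Finset.card_univ, Fintype.card_fin, nsmul_eq_mul]
    ring
  · simp

omit hx in
/-- The waiting taxes cancel in the sum over all users. -/
lemma sum_gain (B : Blockchain NH NL M) (D : Mechanism) (x : Profile NH NL) :
    ∑ n, gain B D x n = ∑ n, ∑ c, if B.Cs ≤ D.fee c then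
      x n c * (utility B n - meanSize B * D.fee c) else 0 := by
  simp only [gain]
  rw [Finset.sum_comm]
  refine Finset.sum_congr rfl fun l _ => ?_
  rw [Finset.sum_comm]
  refine Finset.sum_congr rfl fun c _ => ?_
  split_ifs
  · rw [← Finset.mul_sum, ← Finset.add_sum_erase _ _ (Finset.mem_univ l), if_pos rfl]
    have : ∑ n ∈ Finset.univ.erase l, (if l = n then utility B n - meanSize B * D.fee c -
        ∑ i ∈ Finset.univ.erase n, D.tax n i else D.tax l n) =
        ∑ n ∈ Finset.univ.erase l, D.tax l n :=
      Finset.sum_congr rfl fun n hn => if_neg (Finset.ne_of_mem_erase hn).symm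
    rw [this]
    ring
  · simp

lemma load_lt_of_isStable (h : ∀ n, IsStable B D x n) : load x < B.μ := by
  have hμ := B.μ_pos
  by_cases h0 : ∃ n, 0 < x n false
  · obtain ⟨n, hn⟩ := h0
    exact ((h n).2 hn).2
  · push Not at h0
    have e0 : ∀ n, x n false = 0 := fun n => le_antisymm (h0 n) ((hx n).2 false)
    by_cases h1 : ∃ n, 0 < x n true
    · obtain ⟨n, hn⟩ := h1
      have := ((h n).1 hn).2
      simpa [load, highLoad, e0] using this
    · push Not at h1
      have e1 : ∀ n, x n true = 0 := fun n => le_antisymm (h1 n) ((hx n).2 true)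
      simpa [load, e0, e1] using hμ

/-- Fees and taxes are transfers, and the waiting costs of the two priority classes add up to those
of a single queue, so the social welfare depends on the total rates only. -/
lemma socialWelfare_of_isStable (hσ : IsMinerEquilibrium B σ) (hD : D.Feasible)
    (h : ∀ n, IsStable B D x n) :
    socialWelfare B D σ x = (welfare B (fun n => x n true + x n false) : EReal) := by
  have hhl := highLoad_le_load hx
  have hload := load_lt_of_isStable hx h
  have incl : ∀ n c, ∀ a : ℝ, (if B.Cs ≤ D.fee c then x n c * a else 0) = x n c * a := by
    intro n c a
    split_ifs with hc
    · rfl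
    · have : x n c = 0 := by
        refine le_antisymm (not_lt.mp fun hp => hc ?_) ((hx n).2 c)
        cases c
        · exact ((h n).2 hp).1
        · exact ((h n).1 hp).1
      rw [this, zero_mul]
  have hwait : ∑ n, waitCost B x n = B.γ * load x / (B.μ - load x) := by
    have e0 : ∑ n, x n false = load x - highLoad x := by
      simp [load, highLoad, Finset.sum_add_distrib]
    simp only [waitCost]
    rw [← Finset.mul_sum, Finset.sum_add_distrib, ← Finset.sum_div, ← Finset.sum_mul, e0,
      ← highLoad]
    have : B.μ - load x ≠ 0 := by linarith
    have : B.μ - highLoad x ≠ 0 := by linarith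
    field_simp
    ring
  have hu : ∑ n, userPayoff B D σ x n = ((∑ n, (gain B D x n - waitCost B x n) : ℝ) : EReal) := by
    rw [coe_sum_ereal]
    exact Finset.sum_congr rfl fun n _ => by
      rw [userPayoff_eq hx hσ hD, payoff_of_isStable hx (h n)]
  have hm : ∑ m, (minerPayoff B D σ x m : EReal) = ((∑ m, minerLimit B D x m : ℝ) : EReal) := by
    rw [coe_sum_ereal]
    exact Finset.sum_congr rfl fun m _ => by rw [minerPayoff_eq hx hσ hD]
  rw [socialWelfare, hu, hm, ← EReal.coe_add, EReal.coe_eq_coe_iff, Finset.sum_sub_distrib,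
    sum_gain, sum_minerLimit, hwait, welfare]
  simp only [incl]
  have e : ∑ n, (utility B n - M * B.Cs * meanSize B) * (x n true + x n false) =
      ∑ n, ∑ c, x n c * (utility B n - meanSize B * D.fee c) +
        ∑ n, ∑ c, x n c * (meanSize B * (D.fee c - M * B.Cs)) := by
    rw [← Finset.sum_add_distrib]
    refine Finset.sum_congr rfl fun n _ => ?_
    rw [Fintype.sum_bool, Fintype.sum_bool]
    ring
  rw [e, ← load]
  ring

lemma socialWelfare_of_not_isStable (hσ : IsMinerEquilibrium B σ) (hD : D.Feasible)
    {n : User NH NL} (h : ¬ IsStable B D x n) : socialWelfare B D σ x = ⊥ := by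
  rw [socialWelfare, ← Finset.add_sum_erase _ _ (Finset.mem_univ n), userPayoff_eq hx hσ hD,
    payoff_of_not_isStable hx h, EReal.bot_add, EReal.bot_add]

end

/-! ### The social optimum -/

/-- The function of a user that is `a` for type `H` and `b` for type `L`. -/
def byType (a b : ℝ) : User NH NL → ℝ := Sum.elim (fun _ => a) (fun _ => b)

/-- A symmetric profile of total rates that maximizes the social welfare. It is found on the compact
set where the social welfare is nonnegative, which stays away from the saturated profiles. -/
lemma exists_max_welfare (hN : 0 < NH + NL) (B : Blockchain NH NL M) :
    ∃ a b : ℝ, a ∈ Set.Icc 0 (B.μ / ((NH : ℝ) + NL)) ∧ b ∈ Set.Icc 0 (B.μ / ((NH : ℝ) + NL)) ∧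
      ∑ n, byType (NH := NH) (NL := NL) a b n < B.μ ∧
      ∀ a' ∈ Set.Icc 0 (B.μ / ((NH : ℝ) + NL)), ∀ b' ∈ Set.Icc 0 (B.μ / ((NH : ℝ) + NL)),
        ∑ n, byType (NH := NH) (NL := NL) a' b' n < B.μ →
          welfare B (byType a' b') ≤ welfare B (byType a b) := by
  have hμ := B.μ_pos
  have hγ := B.γ_pos
  have hpos : (0 : ℝ) < (NH : ℝ) + NL := by exact_mod_cast hN
  set I := Set.Icc (0 : ℝ) (B.μ / ((NH : ℝ) + NL)) with hI
  set Λ : ℝ × ℝ → ℝ := fun p => ∑ n, byType (NH := NH) (NL := NL) p.1 p.2 n with hΛ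
  set G : ℝ × ℝ → ℝ := fun p => ∑ n, (utility B n - M * B.Cs * meanSize B) *
    byType (NH := NH) (NL := NL) p.1 p.2 n with hG
  have cr : ∀ n, Continuous fun p : ℝ × ℝ => byType (NH := NH) (NL := NL) p.1 p.2 n := by
    rintro (n | n)
    · exact continuous_fst
    · exact continuous_snd
  have cΛ : Continuous Λ := continuous_finsetSum _ fun n _ => cr n
  have cG : Continuous G := continuous_finsetSum _ fun n _ => continuous_const.mul (cr n)
  have hle : ∀ p ∈ I ×ˢ I, Λ p ≤ B.μ := by
    intro p hp
    have h1 : ∀ n, byType (NH := NH) (NL := NL) p.1 p.2 n ≤ B.μ / ((NH : ℝ) + NL) := by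
      rintro (n | n)
      · exact hp.1.2
      · exact hp.2.2
    refine (Finset.sum_le_sum fun n _ => h1 n).trans ?_
    simp only [Finset.sum_const, Finset.card_univ, Fintype.card_sum, Fintype.card_fin,
      nsmul_eq_mul, Nat.cast_add]
    rw [mul_div_cancel₀ _ hpos.ne']
  set K := (I ×ˢ I) ∩ {p | B.γ * Λ p ≤ (B.μ - Λ p) * G p} with hK
  have cK : IsCompact K := (isCompact_Icc.prod isCompact_Icc).inter_right
    (isClosed_le (continuous_const.mul cΛ) ((continuous_const.sub cΛ).mul cG))
  have hlt : ∀ p ∈ K, Λ p < B.μ := by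
    intro p hp
    refine lt_of_le_of_ne (hle p hp.1) fun h => ?_
    have h2 : B.γ * Λ p ≤ (B.μ - Λ p) * G p := hp.2
    rw [h, sub_self, zero_mul] at h2
    have : 0 < B.γ * B.μ := by positivity
    linarith
  have hz : (0 : ℝ) ∈ I := ⟨le_rfl, by positivity⟩
  have hr0 : ∀ n, byType (NH := NH) (NL := NL) (0 : ℝ) 0 n = 0 := by rintro (n | n) <;> rfl
  have h0K : ((0 : ℝ), (0 : ℝ)) ∈ K := by
    refine ⟨⟨hz, hz⟩, ?_⟩
    simp [hΛ, hG, hr0]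
  have hW : ∀ p : ℝ × ℝ, welfare B (byType p.1 p.2) = G p - B.γ * Λ p / (B.μ - Λ p) :=
    fun p => rfl
  have cW : ContinuousOn (fun p : ℝ × ℝ => welfare B (byType p.1 p.2)) K := by
    simp only [hW]
    exact cG.continuousOn.sub ((continuous_const.mul cΛ).continuousOn.div
      (continuous_const.sub cΛ).continuousOn fun p hp => by linarith [hlt p hp])
  obtain ⟨p, hp, hmax⟩ := cK.exists_isMaxOn ⟨_, h0K⟩ cW
  refine ⟨p.1, p.2, hp.1.1, hp.1.2, hlt p hp, fun a' ha' b' hb' hlt' => ?_⟩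
  by_cases hq : ((a', b') : ℝ × ℝ) ∈ K
  · exact hmax hq
  · have h1 : (B.μ - Λ (a', b')) * G (a', b') < B.γ * Λ (a', b') :=
      not_le.mp fun h => hq ⟨⟨ha', hb'⟩, h⟩
    have hd : 0 < B.μ - Λ (a', b') := by
      have : Λ (a', b') < B.μ := hlt'
      linarith
    have h2 : welfare B (byType a' b') < 0 := by
      rw [hW (a', b'), sub_neg, lt_div_iff₀ hd]
      linarith
    have h3 : (0 : ℝ) ≤ welfare B (byType p.1 p.2) := by
      have h4 := hmax h0K
      have h5 : welfare B (byType (0 : ℝ) 0) = 0 := by simp [welfare, hr0]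
      rw [← h5]
      exact h4
    linarith

/-! ### Best responses in a congestion game -/

lemma congestion_sub {A g c a b : ℝ} (ha : a < c) (hb : b < c) :
    (b * A - g * b / (c - b)) - (a * A - g * a / (c - a)) =
      (b - a) * (A - g * c / ((c - a) * (c - b))) := by
  have : c - a ≠ 0 := by linarith
  have : c - b ≠ 0 := by linarith
  field_simp
  ring

/-- First-order conditions at a maximizer of the payoff `b * A - g * b / (c - b)`. -/
lemma slope_of_isMax {A g c hi a : ℝ} (hac : a < c) (ha : a ∈ Set.Icc 0 hi)
    (h : ∀ b ∈ Set.Icc 0 hi, b < c → b * A - g * b / (c - b) ≤ a * A - g * a / (c - a)) :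
    (0 < a → g * c / (c - a) ^ 2 ≤ A) ∧ (a < hi → A ≤ g * c / (c - a) ^ 2) := by
  have lim : Tendsto (fun b => g * c / ((c - a) * (c - b))) (𝓝 a) (𝓝 (g * c / (c - a) ^ 2)) := by
    have : ContinuousAt (fun b => g * c / ((c - a) * (c - b))) a := by
      refine ContinuousAt.div (by fun_prop) (by fun_prop) ?_
      have : c - a ≠ 0 := by linarith
      exact mul_ne_zero this this
    simpa [pow_two] using this.tendsto
  constructor
  · intro h0
    refine le_of_tendsto (lim.mono_left (nhdsWithin_le_nhds (s := Set.Iio a))) ?_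
    filter_upwards [Ioo_mem_nhdsLT h0] with b hb
    have h1 := h b ⟨hb.1.le, hb.2.le.trans ha.2⟩ (hb.2.trans hac)
    have h2 := congestion_sub (A := A) (g := g) hac (hb.2.trans hac)
    by_contra! hcon
    have : 0 < (b - a) * (A - g * c / ((c - a) * (c - b))) :=
      mul_pos_of_neg_of_neg (by linarith [hb.2]) (by linarith)
    linarith
  · intro h0
    refine ge_of_tendsto (lim.mono_left (nhdsWithin_le_nhds (s := Set.Ioi a))) ?_
    filter_upwards [Ioo_mem_nhdsGT (lt_min h0 hac)] with b hb
    have hbh := (lt_min_iff.mp hb.2).1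
    have hbc := (lt_min_iff.mp hb.2).2
    have h1 := h b ⟨ha.1.trans hb.1.le, hbh.le⟩ hbc
    have h2 := congestion_sub (A := A) (g := g) hac hbc
    by_contra! hcon
    have : 0 < (b - a) * (A - g * c / ((c - a) * (c - b))) :=
      mul_pos (by linarith [hb.1]) (by linarith)
    linarith

/-- The first-order condition is sufficient for a maximum. -/
lemma isMax_of_slope {g c a b : ℝ} (hg : 0 < g) (h0 : 0 ≤ a) (hac : a < c) (hbc : b < c) :
    b * (g * c / (c - a) ^ 2) - g * b / (c - b) ≤
      a * (g * c / (c - a) ^ 2) - g * a / (c - a) := by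
  have h1 := congestion_sub (A := g * c / (c - a) ^ 2) (g := g) hac hbc
  have ha' : 0 < c - a := by linarith
  have hb' : 0 < c - b := by linarith
  have h2 : (b - a) * (g * c / (c - a) ^ 2 - g * c / ((c - a) * (c - b))) =
      - (g * c * (b - a) ^ 2 / ((c - a) ^ 2 * (c - b))) := by
    field_simp
    ring
  have h3 : 0 ≤ g * c * (b - a) ^ 2 / ((c - a) ^ 2 * (c - b)) := by
    have : 0 < c := by linarith
    positivity
  linarith

lemma slope_lt_slope {d d' a a' : ℝ} (hd' : 0 < d') (h : d' ≤ d) (h0 : 0 ≤ a) (ha : a < a') :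
    (d + a) / d ^ 2 < (d' + a') / d' ^ 2 := by
  have hd : 0 < d := hd'.trans_le h
  have e : ∀ u v : ℝ, 0 < u → (u + v) / u ^ 2 = 1 / u + v / u ^ 2 := by
    intro u v hu
    field_simp
  rw [e _ _ hd, e _ _ hd']
  have h1 : 1 / d ≤ 1 / d' := one_div_le_one_div_of_le hd' h
  have h2 : a / d ^ 2 ≤ a / d' ^ 2 := by gcongr
  have h3 : a / d' ^ 2 < a' / d' ^ 2 := by gcongr
  linarith

/-- Uniqueness in an aggregative game: the marginal waiting cost increases in the total rate and in
the own rate, so first-order conditions with the same marginal benefits have only one solution. -/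
lemma aggregative_unique {ι : Type*} [Fintype ι] {μ hi : ℝ} {r r' : ι → ℝ}
    (hr : ∀ n, r n ∈ Set.Icc 0 hi) (hr' : ∀ n, r' n ∈ Set.Icc 0 hi)
    (hS : ∑ n, r n < μ) (hS' : ∑ n, r' n < μ)
    (h1 : ∀ n, 0 < r' n → (μ - ∑ i, r' i + r' n) / (μ - ∑ i, r' i) ^ 2 ≤
      (μ - ∑ i, r i + r n) / (μ - ∑ i, r i) ^ 2)
    (h2 : ∀ n, r' n < hi → (μ - ∑ i, r i + r n) / (μ - ∑ i, r i) ^ 2 ≤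
      (μ - ∑ i, r' i + r' n) / (μ - ∑ i, r' i) ^ 2) : r' = r := by
  rcases le_total (∑ i, r i) (∑ i, r' i) with h | h
  · have hle : ∀ n, r' n ≤ r n := by
      intro n
      by_contra! hlt
      exact (slope_lt_slope (sub_pos.mpr hS') (by linarith) (hr n).1 hlt).not_ge
        (h1 n ((hr n).1.trans_lt hlt))
    have heq := le_antisymm (Finset.sum_le_sum fun n _ => hle n) h
    exact funext fun n =>
      (Finset.sum_eq_sum_iff_of_le fun n _ => hle n).mp heq n (Finset.mem_univ n)
  · have hle : ∀ n, r n ≤ r' n := by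
      intro n
      by_contra! hlt
      exact (slope_lt_slope (sub_pos.mpr hS) (by linarith) (hr' n).1 hlt).not_ge
        (h2 n (hlt.trans_le (hr n).2))
    have heq := le_antisymm (Finset.sum_le_sum fun n _ => hle n) h
    exact funext fun n =>
      ((Finset.sum_eq_sum_iff_of_le fun n _ => hle n).mp heq n (Finset.mem_univ n)).symm

/-! ### Symmetric equilibria with low fees only -/

/-- The strategy of a user who generates low-fee transactions only, at rate `r`. -/
def lowOnly (r : ℝ) : FeeClass → ℝ := fun c => cond c 0 r

/-- The profile in which user `n` generates low-fee transactions only, at rate `r n`. -/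
def lowProfile (r : User NH NL → ℝ) : Profile NH NL := fun n => lowOnly (r n)

@[simp] lemma lowOnly_true (r : ℝ) : lowOnly r true = 0 := rfl
@[simp] lemma lowOnly_false (r : ℝ) : lowOnly r false = r := rfl
@[simp] lemma lowProfile_true (r : User NH NL → ℝ) (n) : lowProfile r n true = 0 := rfl
@[simp] lemma lowProfile_false (r : User NH NL → ℝ) (n) : lowProfile r n false = r n := rfl

/-- Monetary value for user `n` of a low-fee transaction that is included. -/
def netValue (B : Blockchain NH NL M) (D : Mechanism) (n : User NH NL) : ℝ :=
  utility B n - meanSize B * D.ρlow - ∑ i ∈ Finset.univ.erase n, D.tax n i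

/-- Taxes that user `n` receives per unit of time. -/
def received (D : Mechanism) (x : Profile NH NL) (n : User NH NL) : ℝ :=
  ∑ l ∈ Finset.univ.erase n, (x l true + x l false) * D.tax l n

/-- Payoff of a user who generates low-fee transactions at rate `a`, whose included transactions are
worth `A`, if no one uses the high fee and the residual capacity without him is `c`. -/
def soloPayoff (g A c a : ℝ) : ℝ := a * A - g * a / (c - a)

lemma received_update (D : Mechanism) (x : Profile NH NL) (n : User NH NL) (y : FeeClass → ℝ) :
    received D (Function.update x n y) n = received D x n :=
  Finset.sum_congr rfl fun l hl => by rw [Function.update_of_ne (Finset.ne_of_mem_erase hl)]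

lemma update_lowProfile (r : User NH NL → ℝ) (n : User NH NL) (b : ℝ) :
    Function.update (lowProfile r) n (lowOnly b) = lowProfile (Function.update r n b) := by
  funext l
  by_cases h : l = n
  · subst h; simp [lowProfile]
  · simp [lowProfile, h]

lemma load_lowProfile (r : User NH NL → ℝ) : load (lowProfile r) = ∑ n, r n := by
  simp [load]

lemma lowProfile_mem {B : Blockchain NH NL M} {r : User NH NL → ℝ}
    (hr : ∀ n, r n ∈ Set.Icc 0 (B.μ / ((NH : ℝ) + NL))) (n : User NH NL) :
    lowProfile r n ∈ userStrategies B := by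
  refine ⟨by simpa using (hr n).2, ?_⟩
  rintro (_ | _)
  · exact (hr n).1
  · exact le_rfl

lemma lowOnly_mem {B : Blockchain NH NL M} {y : FeeClass → ℝ} (hy : y ∈ userStrategies B) :
    lowOnly (y false) ∈ userStrategies B := by
  refine ⟨?_, ?_⟩
  · simpa using by linarith [hy.1, hy.2 true]
  · rintro (_ | _)
    · exact hy.2 false
    · exact le_rfl

lemma update_mem {B : Blockchain NH NL M} {x : Profile NH NL} (hx : ∀ n, x n ∈ userStrategies B)
    {y : FeeClass → ℝ} (hy : y ∈ userStrategies B) (n l : User NH NL) :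
    Function.update x n y l ∈ userStrategies B := by
  by_cases h : l = n
  · subst h; simpa using hy
  · simpa [h] using hx l

section

variable {B : Blockchain NH NL M} {D : Mechanism} {σ : MinerStrategy M}
  (hD : D.Feasible) (hfee : B.Cs ≤ D.ρlow)
include hD hfee

lemma gain_eq (x : Profile NH NL) (n : User NH NL) :
    gain B D x n = x n true * (netValue B D n - meanSize B * (D.ρhigh - D.ρlow)) +
      x n false * netValue B D n + received D x n := by
  have h1 : B.Cs ≤ D.fee true := hfee.trans hD.1.le
  have h0 : B.Cs ≤ D.fee false := hfee
  have e : ∀ l ∈ Finset.univ.erase n, (∑ c, if B.Cs ≤ D.fee c then x l c * (if l = n then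
      utility B n - meanSize B * D.fee c - ∑ i ∈ Finset.univ.erase n, D.tax n i
      else D.tax l n) else 0) = (x l true + x l false) * D.tax l n := by
    intro l hl
    rw [Fintype.sum_bool, if_pos h1, if_pos h0, if_neg (Finset.ne_of_mem_erase hl),
      if_neg (Finset.ne_of_mem_erase hl)]
    ring
  rw [gain, ← Finset.add_sum_erase _ _ (Finset.mem_univ n), Finset.sum_congr rfl e,
    Fintype.sum_bool, if_pos h1, if_pos h0, if_pos rfl, if_pos rfl, received, netValue]
  simp only [Mechanism.fee]
  ring

lemma payoff_lowProfile {r : User NH NL → ℝ}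
    (hr : ∀ n, r n ∈ Set.Icc 0 (B.μ / ((NH : ℝ) + NL))) (hlt : ∑ n, r n < B.μ)
    (n : User NH NL) :
    payoff B D (lowProfile r) n =
      ((soloPayoff B.γ (netValue B D n) (B.μ - ∑ l ∈ Finset.univ.erase n, r l) (r n) +
        received D (lowProfile r) n : ℝ) : EReal) := by
  have hμ := B.μ_pos.ne'
  have hst : IsStable B D (lowProfile r) n :=
    ⟨fun h => absurd h (lt_irrefl 0), fun _ => ⟨hfee, by rwa [load_lowProfile]⟩⟩
  rw [payoff_of_isStable (lowProfile_mem hr) hst, gain_eq hD hfee, EReal.coe_eq_coe_iff,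
    soloPayoff, waitCost, load_lowProfile, ← Finset.add_sum_erase _ r (Finset.mem_univ n)]
  have e : highLoad (lowProfile r) = 0 := by simp [highLoad]
  rw [← Finset.add_sum_erase _ r (Finset.mem_univ n)] at hlt
  have h1 : B.μ - (r n + ∑ l ∈ Finset.univ.erase n, r l) ≠ 0 := by linarith
  have h2 : B.μ - ∑ l ∈ Finset.univ.erase n, r l - r n =
    B.μ - (r n + ∑ l ∈ Finset.univ.erase n, r l) := by ring
  rw [e, h2, lowProfile_true, lowProfile_false]
  field_simp
  ring

/-- If a high fee costs more than a transaction is worth, then a user gains by giving up his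
high-fee transactions: they also slow down his low-fee transactions. -/
lemma payoff_dropHigh {x : Profile NH NL} (hx : ∀ n, x n ∈ userStrategies B) {n : User NH NL}
    (hhigh : netValue B D n < meanSize B * (D.ρhigh - D.ρlow)) (hst : IsStable B D x n) :
    payoff B D x n ≤ payoff B D (Function.update x n (lowOnly (x n false))) n ∧
    (0 < x n true →
      payoff B D x n < payoff B D (Function.update x n (lowOnly (x n false))) n) := by
  have hμ := B.μ_pos
  have hγ := B.γ_pos
  set x' := Function.update x n (lowOnly (x n false)) with hx'
  have hmem := update_mem hx (lowOnly_mem (hx n)) n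
  rw [← hx'] at hmem
  have e1 : x' n true = 0 := by simp [hx']
  have e0 : x' n false = x n false := by simp [hx']
  have x1 := (hx n).2 true
  have x0 := (hx n).2 false
  have hle : ∀ l c, x' l c ≤ x l c := by
    intro l c
    by_cases h : l = n
    · subst h
      cases c
      · exact e0.le
      · rw [e1]; exact x1
    · simp [hx', h]
  have hhl : highLoad x' ≤ highLoad x := Finset.sum_le_sum fun l _ => hle l true
  have hl : load x' ≤ load x := Finset.sum_le_sum fun l _ => add_le_add (hle l true) (hle l false)
  have hst' : IsStable B D x' n := by
    refine ⟨fun h => absurd h (by rw [e1]; exact lt_irrefl 0), fun h => ⟨hfee, ?_⟩⟩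
    rw [e0] at h
    exact hl.trans_lt (hst.2 h).2
  have hwait : waitCost B x' n ≤ waitCost B x n := by
    have hload := highLoad_le_load hx
    have hload2 := load_le hx
    unfold waitCost
    rw [e1, e0, zero_div]
    refine mul_le_mul_of_nonneg_left (add_le_add (div_nonneg x1 (by linarith)) ?_) hγ.le
    rcases x0.eq_or_lt with hz | hp
    · simp [← hz]
    · have := (hst.2 hp).2
      have p1 : 0 < B.μ - load x := by linarith
      have p2 : 0 < B.μ - highLoad x := by linarith
      have p3 : 0 < B.μ - highLoad x' := by linarith
      gcongr
  have hg : gain B D x' n = x n false * netValue B D n + received D x n := by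
    rw [gain_eq hD hfee, e1, e0, hx', received_update]
    ring
  rw [payoff_of_isStable hx hst, payoff_of_isStable hmem hst', gain_eq hD hfee, hg,
    EReal.coe_le_coe_iff, EReal.coe_lt_coe_iff]
  constructor
  · have : x n true * (netValue B D n - meanSize B * (D.ρhigh - D.ρlow)) ≤ 0 :=
      mul_nonpos_of_nonneg_of_nonpos x1 (by linarith)
    linarith
  · intro hp
    have : x n true * (netValue B D n - meanSize B * (D.ρhigh - D.ρlow)) < 0 :=
      mul_neg_of_pos_of_neg hp (by linarith)
    linarith

variable (hσ : IsMinerEquilibrium B σ)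
  (hhigh : ∀ n, netValue B D n < meanSize B * (D.ρhigh - D.ρlow))
include hσ hhigh

/-- A profile of low-fee rates is an equilibrium if every rate is a best response among the low-fee
rates. -/
lemma isSNE_lowProfile {a b : ℝ}
    (hr : ∀ n, byType (NH := NH) (NL := NL) a b n ∈ Set.Icc 0 (B.μ / ((NH : ℝ) + NL)))
    (hlt : ∑ n, byType (NH := NH) (NL := NL) a b n < B.μ)
    (hbest : ∀ n, ∀ z ∈ Set.Icc 0 (B.μ / ((NH : ℝ) + NL)),
      z < B.μ - ∑ l ∈ Finset.univ.erase n, byType a b l →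
      soloPayoff B.γ (netValue B D n) (B.μ - ∑ l ∈ Finset.univ.erase n, byType a b l) z ≤
      soloPayoff B.γ (netValue B D n) (B.μ - ∑ l ∈ Finset.univ.erase n, byType a b l)
        (byType a b n)) :
    IsSNE B D σ (lowProfile (byType a b)) := by
  have hmem := lowProfile_mem hr
  refine ⟨hmem, ⟨fun _ _ => rfl, fun _ _ => rfl⟩, fun n y hy => ?_⟩
  set x := lowProfile (byType (NH := NH) (NL := NL) a b) with hxdef
  have hup := update_mem hmem hy n
  rw [userPayoff_eq hup hσ hD, userPayoff_eq hmem hσ hD]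
  by_cases hst : IsStable B D (Function.update x n y) n
  swap
  · rw [payoff_of_not_isStable hup hst]; exact bot_le
  refine (payoff_dropHigh hD hfee hup (hhigh n) hst).1.trans ?_
  rw [Function.update_idem, Function.update_self, hxdef, update_lowProfile]
  set r := byType (NH := NH) (NL := NL) a b with hrdef
  have er : ∑ l ∈ Finset.univ.erase n, Function.update r n (y false) l =
      ∑ l ∈ Finset.univ.erase n, r l :=
    Finset.sum_congr rfl fun l hl => Function.update_of_ne (Finset.ne_of_mem_erase hl) _ _
  have hy0 : y false ∈ Set.Icc 0 (B.μ / ((NH : ℝ) + NL)) :=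
    ⟨hy.2 false, by linarith [hy.1, hy.2 true]⟩
  have hr' : ∀ l, Function.update r n (y false) l ∈ Set.Icc 0 (B.μ / ((NH : ℝ) + NL)) := by
    intro l
    by_cases h : l = n
    · subst h; simpa using hy0
    · simpa [h] using hr l
  have hsum : ∑ l, r l = r n + ∑ l ∈ Finset.univ.erase n, r l :=
    (Finset.add_sum_erase _ _ (Finset.mem_univ n)).symm
  have hc : y false < B.μ - ∑ l ∈ Finset.univ.erase n, r l := by
    rcases (hy.2 false).eq_or_lt with h0 | hp
    · linarith [(hr n).1]
    · have h1 : load (Function.update x n y) < B.μ := (hst.2 (by simpa using hp)).2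
      have h2 : load (Function.update x n y) =
          y true + y false + ∑ l ∈ Finset.univ.erase n, r l := by
        rw [load, ← Finset.add_sum_erase _ _ (Finset.mem_univ n), Function.update_self]
        congr 1
        refine Finset.sum_congr rfl fun l hl => ?_
        rw [Function.update_of_ne (Finset.ne_of_mem_erase hl), hxdef]
        simp
      linarith [hy.2 true]
  have hlt' : ∑ l, Function.update r n (y false) l < B.μ := by
    rw [← Finset.add_sum_erase _ _ (Finset.mem_univ n), er, Function.update_self]
    linarith
  rw [payoff_lowProfile hD hfee hr' hlt', payoff_lowProfile hD hfee hr hlt, er,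
    Function.update_self, ← update_lowProfile, received_update, EReal.coe_le_coe_iff]
  linarith [hbest n _ hy0 hc]

/-- At an equilibrium nobody uses the high fee, and every rate is a best response among the low-fee
rates. -/
lemma IsSNE.lowOnly {x : Profile NH NL} (h : IsSNE B D σ x) :
    ∃ r : User NH NL → ℝ, x = lowProfile r ∧ (∀ n, r n ∈ Set.Icc 0 (B.μ / ((NH : ℝ) + NL))) ∧
      ∑ n, r n < B.μ ∧ ∀ n, ∀ z ∈ Set.Icc 0 (B.μ / ((NH : ℝ) + NL)),
        z < B.μ - ∑ l ∈ Finset.univ.erase n, r l →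
        soloPayoff B.γ (netValue B D n) (B.μ - ∑ l ∈ Finset.univ.erase n, r l) z ≤
        soloPayoff B.γ (netValue B D n) (B.μ - ∑ l ∈ Finset.univ.erase n, r l) (r n) := by
  obtain ⟨hx, -, hdev⟩ := h
  have hdev' : ∀ n, ∀ y ∈ userStrategies B,
      payoff B D (Function.update x n y) n ≤ payoff B D x n := by
    intro n y hy
    rw [← userPayoff_eq (update_mem hx hy n) hσ hD, ← userPayoff_eq hx hσ hD]
    exact hdev n y hy
  have hst : ∀ n, IsStable B D x n := by
    intro n
    by_contra hns
    -- abstaining guarantees a finite payoff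
    have hz : FWT.lowOnly 0 ∈ userStrategies B := by
      refine ⟨?_, ?_⟩
      · have := B.μ_pos
        simp only [lowOnly_true, lowOnly_false, add_zero]
        positivity
      · rintro (_ | _) <;> exact le_rfl
    have h1 := hdev' n _ hz
    have hup := update_mem hx hz n
    have h2 : IsStable B D (Function.update x n (FWT.lowOnly 0)) n :=
      ⟨fun h => by simp at h, fun h => by simp at h⟩
    rw [payoff_of_not_isStable hx hns, payoff_of_isStable hup h2, le_bot_iff] at h1
    exact EReal.coe_ne_bot _ h1
  have htrue : ∀ n, x n true = 0 := by
    intro n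
    refine le_antisymm (not_lt.mp fun hp => ?_) ((hx n).2 true)
    exact ((payoff_dropHigh hD hfee hx (hhigh n) (hst n)).2 hp).not_ge
      (hdev' n _ (lowOnly_mem (hx n)))
  set r : User NH NL → ℝ := fun n => x n false with hrdef
  have hxr : x = lowProfile r := by
    funext n c
    cases c
    · rfl
    · exact htrue n
  have hr : ∀ n, r n ∈ Set.Icc 0 (B.μ / ((NH : ℝ) + NL)) := fun n =>
    ⟨(hx n).2 false, by linarith [(hx n).1, (hx n).2 true]⟩
  have hlt : ∑ n, r n < B.μ := by
    rw [← load_lowProfile, ← hxr]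
    exact load_lt_of_isStable hx hst
  refine ⟨r, hxr, hr, hlt, fun n z hz hzc => ?_⟩
  have er : ∑ l ∈ Finset.univ.erase n, Function.update r n z l =
      ∑ l ∈ Finset.univ.erase n, r l :=
    Finset.sum_congr rfl fun l hl => Function.update_of_ne (Finset.ne_of_mem_erase hl) _ _
  have hr' : ∀ l, Function.update r n z l ∈ Set.Icc 0 (B.μ / ((NH : ℝ) + NL)) := by
    intro l
    by_cases h : l = n
    · subst h; simpa using hz
    · simpa [h] using hr l
  have hlt' : ∑ l, Function.update r n z l < B.μ := by
    rw [← Finset.add_sum_erase _ _ (Finset.mem_univ n), er, Function.update_self]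
    linarith
  have hzm : FWT.lowOnly z ∈ userStrategies B := by
    simpa [lowProfile] using lowProfile_mem hr' n
  have h1 := hdev' n _ hzm
  rw [hxr, update_lowProfile, payoff_lowProfile hD hfee hr' hlt',
    payoff_lowProfile hD hfee hr hlt, er, Function.update_self, ← update_lowProfile,
    received_update, EReal.coe_le_coe_iff] at h1
  linarith

end

/-! ### Implementing the social optimum -/

lemma le_miners_mul_Cs (B : Blockchain NH NL M) : B.Cs ≤ M * B.Cs := by
  have h1 : (1 : ℝ) ≤ M := by
    have : M ≠ 0 := by
      rintro rfl
      simpa using B.α_sum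
    exact_mod_cast Nat.one_le_iff_ne_zero.mpr this
  nlinarith [B.Cs_nonneg]

/-- The mechanism in which each user pays the same tax, `τH` or `τL` by his type, to every other
user; the low fee just covers the storage costs of all miners, and the high fee exceeds what any
transaction is worth. -/
def optimalMechanism (B : Blockchain NH NL M) (τH τL : ℝ) : Mechanism where
  ρhigh := M * B.Cs + (∑ n : User NH NL, |utility B n - meanSize B * (M * B.Cs) -
    ∑ _i ∈ Finset.univ.erase n, byType (NH := NH) (NL := NL) τH τL n| + 1) / meanSize B
  ρlow := M * B.Cs
  PHH := τH
  PHL := τH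
  PLH := τL
  PLL := τL

lemma optimalMechanism_tax (B : Blockchain NH NL M) (τH τL : ℝ) (n l : User NH NL) :
    (optimalMechanism B τH τL).tax n l = byType τH τL n := by
  rcases n with n | n <;> rcases l with l | l <;> rfl

lemma netValue_optimalMechanism (B : Blockchain NH NL M) (τH τL : ℝ) (n : User NH NL) :
    netValue B (optimalMechanism B τH τL) n = utility B n - meanSize B * (M * B.Cs) -
      ∑ _i ∈ Finset.univ.erase n, byType (NH := NH) (NL := NL) τH τL n := by
  rw [netValue]
  simp only [optimalMechanism_tax]
  rfl

lemma netValue_lt_optimalMechanism (B : Blockchain NH NL M) (τH τL : ℝ) (n : User NH NL) :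
    netValue B (optimalMechanism B τH τL) n < meanSize B *
      ((optimalMechanism B τH τL).ρhigh - (optimalMechanism B τH τL).ρlow) := by
  have hs := meanSize_pos B
  have e : meanSize B * ((optimalMechanism B τH τL).ρhigh - (optimalMechanism B τH τL).ρlow) =
      ∑ n : User NH NL, |utility B n - meanSize B * (M * B.Cs) -
        ∑ _i ∈ Finset.univ.erase n, byType (NH := NH) (NL := NL) τH τL n| + 1 := by
    simp only [optimalMechanism]
    field_simp
    ring
  rw [e, netValue_optimalMechanism]
  have h1 := Finset.single_le_sum (f := fun n : User NH NL =>
    |utility B n - meanSize B * (M * B.Cs) -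
      ∑ _i ∈ Finset.univ.erase n, byType (NH := NH) (NL := NL) τH τL n|)
    (fun _ _ => abs_nonneg _) (Finset.mem_univ n)
  have h2 := le_abs_self (utility B n - meanSize B * (M * B.Cs) -
    ∑ _i ∈ Finset.univ.erase n, byType (NH := NH) (NL := NL) τH τL n)
  linarith

lemma optimalMechanism_feasible (B : Blockchain NH NL M) (τH τL : ℝ) :
    (optimalMechanism B τH τL).Feasible := by
  have hs := meanSize_pos B
  refine ⟨?_, mul_nonneg (Nat.cast_nonneg M) B.Cs_nonneg⟩
  refine lt_add_of_pos_right _ (div_pos ?_ hs)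
  have := Finset.sum_nonneg (s := Finset.univ) (f := fun n : User NH NL =>
    |utility B n - meanSize B * (M * B.Cs) -
      ∑ _i ∈ Finset.univ.erase n, byType (NH := NH) (NL := NL) τH τL n|) fun _ _ => abs_nonneg _
  linarith

/-- With at least two users, suitable taxes give the transactions of each user any prescribed net
value that depends on his type only. -/
lemma exists_taxes (hN : 2 ≤ NH + NL) (B : Blockchain NH NL M) (vH vL : ℝ) :
    ∃ τH τL, ∀ n, netValue B (optimalMechanism B τH τL) n =
      byType (NH := NH) (NL := NL) vH vL n := by
  have hne : ((NH + NL - 1 : ℕ) : ℝ) ≠ 0 := by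
    have : NH + NL - 1 ≠ 0 := by omega
    exact_mod_cast this
  refine ⟨(B.RH - meanSize B * (M * B.Cs) - vH) / (NH + NL - 1 : ℕ),
    (B.RL - meanSize B * (M * B.Cs) - vL) / (NH + NL - 1 : ℕ), fun n => ?_⟩
  rw [netValue_optimalMechanism]
  simp only [Finset.sum_const, Finset.card_erase_of_mem (Finset.mem_univ n), Finset.card_univ,
    Fintype.card_sum, Fintype.card_fin, nsmul_eq_mul]
  rcases n with n | n
  · simp only [byType, Sum.elim_inl, utility]
    rw [mul_div_cancel₀ _ hne]
    ring
  · simp only [byType, Sum.elim_inr, utility]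
    rw [mul_div_cancel₀ _ hne]
    ring

section

variable {B : Blockchain NH NL M} {σ : MinerStrategy M} {a b : ℝ}

/-- A lone user who pays the storage costs of all miners maximizes the social welfare. -/
lemma isParetoDominantSNE_of_lone_user (hN : NH + NL = 1) (hσ : IsMinerEquilibrium B σ)
    (hr : ∀ n, byType (NH := NH) (NL := NL) a b n ∈ Set.Icc 0 (B.μ / ((NH : ℝ) + NL)))
    (hlt : ∑ n, byType (NH := NH) (NL := NL) a b n < B.μ)
    (hmax : ∀ a' ∈ Set.Icc 0 (B.μ / ((NH : ℝ) + NL)), ∀ b' ∈ Set.Icc 0 (B.μ / ((NH : ℝ) + NL)),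
      ∑ n, byType (NH := NH) (NL := NL) a' b' n < B.μ →
        welfare B (byType a' b') ≤ welfare B (byType a b)) :
    IsParetoDominantSNE B (optimalMechanism B 0 0) σ (lowProfile (byType a b)) := by
  have hsub : Subsingleton (User NH NL) := by
    rw [← Fintype.card_le_one_iff_subsingleton]
    simp [hN]
  have hW : ∀ r : User NH NL → ℝ, ∀ n, welfare B r =
      soloPayoff B.γ (netValue B (optimalMechanism B 0 0) n) B.μ (r n) := by
    intro r n
    rw [welfare, Fintype.sum_subsingleton _ n, Fintype.sum_subsingleton _ n,
      netValue_optimalMechanism, soloPayoff]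
    have : byType (NH := NH) (NL := NL) (0 : ℝ) 0 n = 0 := by rcases n with n | n <;> rfl
    rw [this, Finset.sum_const_zero]
    ring
  have hne : ∀ (r : User NH NL → ℝ) (n), ∑ l ∈ Finset.univ.erase n, r l = 0 := fun r n =>
    Finset.sum_eq_zero fun l hl => absurd (Subsingleton.elim l n) (Finset.ne_of_mem_erase hl)
  have hsne : IsSNE B (optimalMechanism B 0 0) σ (lowProfile (byType a b)) := by
    refine isSNE_lowProfile (optimalMechanism_feasible B 0 0) (le_miners_mul_Cs B) hσ
      (netValue_lt_optimalMechanism B 0 0) hr hlt fun n z hz hzc => ?_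
    rw [hne, sub_zero] at hzc ⊢
    have hzz : byType (NH := NH) (NL := NL) z z n = z := by rcases n with n | n <;> rfl
    have h1 := hmax z hz z hz (by rw [Fintype.sum_subsingleton _ n, hzz]; exact hzc)
    rwa [hW _ n, hW _ n, hzz] at h1
  refine ⟨hsne, fun x' hx' n => ?_⟩
  have e : Function.update (lowProfile (byType a b)) n (x' n) = x' := by
    funext l
    rw [Subsingleton.elim l n, Function.update_self]
  have h1 := hsne.2.2 n (x' n) (hx'.1 n)
  rwa [e] at h1

/-- If the net value of the transactions of each user equals his marginal waiting cost at the
low-fee rates `byType a b`, then these rates are the only symmetric equilibrium. -/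
lemma isParetoDominantSNE_of_slope {D : Mechanism} (hD : D.Feasible) (hfee : B.Cs ≤ D.ρlow)
    (hσ : IsMinerEquilibrium B σ)
    (hhigh : ∀ n : User NH NL, netValue B D n < meanSize B * (D.ρhigh - D.ρlow))
    (hr : ∀ n, byType (NH := NH) (NL := NL) a b n ∈ Set.Icc 0 (B.μ / ((NH : ℝ) + NL)))
    (hlt : ∑ n, byType (NH := NH) (NL := NL) a b n < B.μ)
    (hnet : ∀ n, netValue B D n =
      B.γ * (B.μ - ∑ l, byType (NH := NH) (NL := NL) a b l + byType a b n) /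
        (B.μ - ∑ l, byType (NH := NH) (NL := NL) a b l) ^ 2) :
    IsParetoDominantSNE B D σ (lowProfile (byType a b)) := by
  have hγ := B.γ_pos
  have hres : ∀ (r : User NH NL → ℝ) n, B.μ - ∑ l ∈ Finset.univ.erase n, r l =
      B.μ - ∑ l, r l + r n := by
    intro r n
    rw [← Finset.add_sum_erase _ r (Finset.mem_univ n)]
    ring
  have hsne : IsSNE B D σ (lowProfile (byType a b)) := by
    refine isSNE_lowProfile hD hfee hσ hhigh hr hlt fun n z hz hzc => ?_
    rw [hres] at hzc ⊢
    have h1 := isMax_of_slope hγ (hr n).1 (c := B.μ -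
      ∑ l, byType (NH := NH) (NL := NL) a b l + byType a b n) (by linarith) hzc
    rw [add_sub_cancel_right, ← hnet n] at h1
    simpa [soloPayoff] using h1
  refine ⟨hsne, fun x' hx' n => ?_⟩
  obtain ⟨r, rfl, hr', hlt', hbest⟩ := hx'.lowOnly hD hfee hσ hhigh
  have hfoc : ∀ n, (0 < r n → B.γ * (B.μ - ∑ l, r l + r n) / (B.μ - ∑ l, r l) ^ 2 ≤
      netValue B D n) ∧ (r n < B.μ / ((NH : ℝ) + NL) → netValue B D n ≤
      B.γ * (B.μ - ∑ l, r l + r n) / (B.μ - ∑ l, r l) ^ 2) := by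
    intro n
    have h1 := slope_of_isMax (g := B.γ) (A := netValue B D n) (c := B.μ - ∑ l, r l + r n)
      (by linarith) (hr' n) (fun z hz hzc => by
        have := hbest n z hz (by rwa [hres])
        rwa [hres] at this)
    rwa [add_sub_cancel_right] at h1
  have : r = byType a b := by
    refine aggregative_unique hr hr' hlt hlt' (fun n hn => ?_) fun n hn => ?_
    · have := (hfoc n).1 hn
      rw [hnet, mul_div_assoc, mul_div_assoc] at this
      exact le_of_mul_le_mul_left this hγ
    · have := (hfoc n).2 hn
      rw [hnet, mul_div_assoc, mul_div_assoc] at this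
      exact le_of_mul_le_mul_left this hγ
  rw [this]

end

/-- The socially optimal rates are the equilibrium of a mechanism whose low fee covers the storage
costs, with low-fee transactions only. -/
lemma exists_mechanism (hN : 0 < NH + NL) {B : Blockchain NH NL M} {σ : MinerStrategy M} {a b : ℝ}
    (hσ : IsMinerEquilibrium B σ)
    (hr : ∀ n, byType (NH := NH) (NL := NL) a b n ∈ Set.Icc 0 (B.μ / ((NH : ℝ) + NL)))
    (hlt : ∑ n, byType (NH := NH) (NL := NL) a b n < B.μ)
    (hmax : ∀ a' ∈ Set.Icc 0 (B.μ / ((NH : ℝ) + NL)), ∀ b' ∈ Set.Icc 0 (B.μ / ((NH : ℝ) + NL)),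
      ∑ n, byType (NH := NH) (NL := NL) a' b' n < B.μ →
        welfare B (byType a' b') ≤ welfare B (byType a b)) :
    ∃ τH τL, IsParetoDominantSNE B (optimalMechanism B τH τL) σ (lowProfile (byType a b)) := by
  rcases Nat.lt_or_ge 1 (NH + NL) with h2 | h1
  · set d := B.μ - ∑ l, byType (NH := NH) (NL := NL) a b l
    obtain ⟨τH, τL, hτ⟩ := exists_taxes h2 B (B.γ * (d + a) / d ^ 2) (B.γ * (d + b) / d ^ 2)
    refine ⟨τH, τL, isParetoDominantSNE_of_slope (optimalMechanism_feasible B τH τL)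
      (le_miners_mul_Cs B) hσ (netValue_lt_optimalMechanism B τH τL) hr hlt fun n => ?_⟩
    rw [hτ]
    rcases n with n | n <;> rfl
  · exact ⟨0, 0, isParetoDominantSNE_of_lone_user (by omega) hσ hr hlt hmax⟩

/-- The total rates of a symmetric profile depend on the types only. -/
lemma exists_byType {B : Blockchain NH NL M} {x : Profile NH NL}
    (hx : ∀ n, x n ∈ userStrategies B) (hsym : IsSymmetric x) :
    ∃ a ∈ Set.Icc 0 (B.μ / ((NH : ℝ) + NL)), ∃ b ∈ Set.Icc 0 (B.μ / ((NH : ℝ) + NL)),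
      (fun n => x n true + x n false) = byType a b := by
  have hmem : ∀ n, x n true + x n false ∈ Set.Icc 0 (B.μ / ((NH : ℝ) + NL)) := fun n =>
    ⟨add_nonneg ((hx n).2 true) ((hx n).2 false), (hx n).1⟩
  have h0 : (0 : ℝ) ∈ Set.Icc 0 (B.μ / ((NH : ℝ) + NL)) := by
    have := B.μ_pos
    exact ⟨le_rfl, by positivity⟩
  obtain ⟨a, ha, hxa⟩ : ∃ a ∈ Set.Icc 0 (B.μ / ((NH : ℝ) + NL)),
      ∀ i, x (.inl i) true + x (.inl i) false = a := by
    rcases isEmpty_or_nonempty (Fin NH) with he | ⟨⟨i⟩⟩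
    · exact ⟨0, h0, fun i => he.elim i⟩
    · exact ⟨_, hmem (.inl i), fun j => by rw [hsym.1 j i]⟩
  obtain ⟨b, hb, hxb⟩ : ∃ b ∈ Set.Icc 0 (B.μ / ((NH : ℝ) + NL)),
      ∀ i, x (.inr i) true + x (.inr i) false = b := by
    rcases isEmpty_or_nonempty (Fin NL) with he | ⟨⟨i⟩⟩
    · exact ⟨0, h0, fun i => he.elim i⟩
    · exact ⟨_, hmem (.inr i), fun j => by rw [hsym.2 j i]⟩
  refine ⟨a, ha, b, hb, ?_⟩
  funext n
  rcases n with i | i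
  · exact hxa i
  · exact hxb i

/-- The maximum of `welfare` over the symmetric rates is the maximum of the social welfare, with and
without the sufficient fee condition. -/
lemma exists_isGreatest (hN : 0 < NH + NL) (B : Blockchain NH NL M) :
    ∃ w : ℝ, IsGreatest (constrainedWelfare B) (w : EReal) ∧
      IsGreatest (unconstrainedWelfare B) (w : EReal) := by
  obtain ⟨a, b, ha, hb, hlt, hmax⟩ := exists_max_welfare hN B
  have hr : ∀ n, byType (NH := NH) (NL := NL) a b n ∈ Set.Icc 0 (B.μ / ((NH : ℝ) + NL)) := by
    rintro (n | n)
    · exact ha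
    · exact hb
  obtain ⟨σ, hσ⟩ := exists_isMinerEquilibrium B
  obtain ⟨τH, τL, hdom⟩ := exists_mechanism hN hσ hr hlt hmax
  have hD := optimalMechanism_feasible B τH τL
  have hmem : (welfare B (byType a b) : EReal) ∈ constrainedWelfare B := by
    refine ⟨optimalMechanism B τH τL, σ, lowProfile (byType a b), ⟨hD, hσ, hdom⟩,
      fun n hn => ?_, ?_⟩
    · rw [lowProfile_true, lowProfile_false, zero_add] at hn
      rw [lowProfile_true, lowProfile_false, zero_mul, zero_add, zero_add,
        mul_div_cancel_left₀ _ hn.ne']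
      exact le_rfl
    · rw [socialWelfare_of_isStable (lowProfile_mem hr) hσ hD]
      · simp
      · exact fun n => ⟨fun h => absurd h (lt_irrefl 0),
          fun _ => ⟨le_miners_mul_Cs B, by rwa [load_lowProfile]⟩⟩
  have hle : ∀ w ∈ unconstrainedWelfare B, w ≤ (welfare B (byType a b) : EReal) := by
    rintro w ⟨D, σ', x, ⟨hD', hσ', ⟨hx, hsym, -⟩, -⟩, rfl⟩
    by_cases hst : ∀ n, IsStable B D x n
    · obtain ⟨a', ha', b', hb', hab⟩ := exists_byType hx hsym
      have hload := load_lt_of_isStable hx hst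
      rw [socialWelfare_of_isStable hx hσ' hD' hst, EReal.coe_le_coe_iff, hab]
      refine hmax a' ha' b' hb' ?_
      rwa [← hab]
    · obtain ⟨n, hn⟩ := not_forall.mp hst
      rw [socialWelfare_of_not_isStable hx hσ' hD' hn]
      exact bot_le
  have hsub : constrainedWelfare B ⊆ unconstrainedWelfare B := by
    rintro w ⟨D, σ', x, h, -, hw⟩
    exact ⟨D, σ', x, h, hw⟩
  exact ⟨_, ⟨hmem, fun w hw => hle w (hsub hw)⟩, ⟨hsub hmem, hle⟩⟩

end FWT

end

theorem proposition2 {NH NL M : ℕ} (hN : 0 < NH + NL) (B : FWT.Blockchain NH NL M) :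
    -- the time averages that define the payoffs converge
    (∀ (D : FWT.Mechanism) (σ : FWT.MinerStrategy M) (x : FWT.Profile NH NL),
      D.Feasible → FWT.IsMinerEquilibrium B σ → (∀ n, x n ∈ FWT.userStrategies B) →
        (∀ n, Filter.Tendsto (FWT.userAverage B D σ x n) Filter.atTop
          (nhds (FWT.userPayoff B D σ x n))) ∧
        (∀ m, Filter.Tendsto (FWT.minerAverage B D σ x m) Filter.atTop
          (nhds (FWT.minerPayoff B D σ x m)))) ∧
    -- both maxima exist, and they are the same real number
    ∃ w : ℝ, IsGreatest (FWT.constrainedWelfare B) (w : EReal) ∧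
      IsGreatest (FWT.unconstrainedWelfare B) (w : EReal) := by
  refine ⟨fun D σ x hD hσ hx => ⟨fun n => ?_, fun m => ?_⟩, FWT.exists_isGreatest hN B⟩
  · rw [FWT.userPayoff_eq hx hσ hD]
    exact FWT.tendsto_userAverage hx hσ hD n
  · rw [FWT.minerPayoff_eq hx hσ hD]
    exact FWT.tendsto_minerAverage hx hσ hD m
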